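/- For $n\ge 1$ let $B_n$ be the braid group on $n$ strings, with Artin generators $\sigma_1,\dots,\sigma_{n-1}$ and relations $\sigma_t\sigma_s=\sigma_s\sigma_t$ for $|t-s|>1$ and $\sigma_t\sigma_s\sigma_t=\sigma_s\sigma_t\sigma_s$ for $|t-s|=1$. For $n\ge t>s\ge 1$ let $$a_{ts}=(\sigma_{t-1}\sigma_{t-2}\cdots\sigma_{s+1})\,\sigma_s\,(\sigma_{s+1}^{-1}\cdots\sigma_{t-2}^{-1}\sigma_{t-1}^{-1})\in B_n$$ be the band generators, and for a word $W$ in the letters $a_{ts}^{\pm1}$ let $|W|$ be its length. A random access machine (RAM) has registers numbered $0,1,2,\dots$ that hold integers, register $0$ being the accumulator, a read-only input tape and a write-only output tape of integers. Its program is a finite list of the instructions LOAD, STORE, ADD, SUB, MULT, DIV (with floor), READ, WRITE, JUMP, JGTZ (jump if the accumulator is positive), JZERO (jump if it is zero) and HALT, with constant, direct or indirect addressing. An instruction whose effect is undefined stops the machine. Under the uniform cost criterion, each executed instruction takes one unit of time. **Theorem.** The word problem in the braid groups, for words in the band generators, is solved by an algorithm of complexity $\mathcal O(|W|^2 n)$,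 where $|W|$ is the length of the longer of the two words being compared. Precisely: there are a single RAM program, independent of $n$, and constants $C,d\in\mathbb N$ such that the following holds for every $n\ge 1$ and all words $V,W$ in the letters $a_{ts}^{\pm1}$ ($n\ge t>s\ge 1$). Put $L=\max(|V|,|W|)$. The input is $n$, followed by $|V|$ and the letters of $V$, followed by $|W|$ and the letters of $W$, where a letter $a_{ts}^{\varepsilon}$ is given by the three integers $t,s,\varepsilon$. On this input the program stops after at most $$C\cdot\max(1,L)^2\cdot n$$ steps, and its output is $1$ if $V$ and $W$ represent the same element of $B_n$ and $0$ otherwise. Moreover, all integers held in registers during the computation have absolute value at most $(n+L+1)^d$, so that each fits into a word of $\mathcal O(\log(n+L+1))$ bits. -/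

import Mathlib

/-! ## Braid groups, band generators and words -/

/-- The index `i`, with `1 ≤ i ≤ n - 1`, of an Artin generator `σ_i` of the braid group `B_n`. -/
structure ArtinIndex (n : ℕ) where
  i : ℕ
  one_le : 1 ≤ i
  lt : i < n

/-- Artin's defining relators of the braid group on `n` strings:
`σ_t σ_s = σ_s σ_t` for `|t - s| > 1` and `σ_t σ_s σ_t = σ_s σ_t σ_s` for `|t - s| = 1`. -/
def artinRelators (n : ℕ) : Set (FreeGroup (ArtinIndex n)) :=
  {r | ∃ t s : ArtinIndex n,
      (1 < |(t.i : ℤ) - s.i| ∧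
        r = FreeGroup.of t * FreeGroup.of s * (FreeGroup.of s * FreeGroup.of t)⁻¹) ∨
      (|(t.i : ℤ) - s.i| = 1 ∧
        r = FreeGroup.of t * FreeGroup.of s * FreeGroup.of t *
          (FreeGroup.of s * FreeGroup.of t * FreeGroup.of s)⁻¹)}

/-- The braid group `B_n` on `n` strings. -/
abbrev BraidGroup (n : ℕ) : Type := PresentedGroup (artinRelators n)

/-- The Artin generator `σ_i` of `B_n`. -/
def artinGen {n : ℕ} (i : ArtinIndex n) : BraidGroup n := PresentedGroup.of i

/-- `bandAux n s k` is the band generator `a_{(s+k+1) s}`, that is,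
`(σ_{s+k} ⋯ σ_{s+1}) σ_s (σ_{s+k} ⋯ σ_{s+1})⁻¹`. -/
def bandAux (n s : ℕ) (hs : 1 ≤ s) : (k : ℕ) → s + k < n → BraidGroup n
  | 0, h => artinGen ⟨s, hs, h⟩
  | k + 1, h =>
      artinGen ⟨s + (k + 1), by omega, h⟩ * bandAux n s hs k (by omega) *
        (artinGen ⟨s + (k + 1), by omega, h⟩)⁻¹

/-- The pair of subscripts `n ≥ t > s ≥ 1` of a band generator `a_{ts}`. -/
structure BandIndex (n : ℕ) where
  t : ℕ
  s : ℕ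
  one_le : 1 ≤ s
  lt : s < t
  le : t ≤ n

/-- The band generator
`a_{ts} = (σ_{t-1} ⋯ σ_{s+1}) σ_s (σ_{s+1}⁻¹ ⋯ σ_{t-1}⁻¹)` of `B_n`. -/
def bandGen {n : ℕ} (a : BandIndex n) : BraidGroup n :=
  bandAux n a.s a.one_le (a.t - a.s - 1) (by have := a.lt; have := a.le; omega)

/-- A word in the band generators and their inverses: the letter `(a, true)` stands for the band
generator with subscripts `a`, and `(a, false)` for its inverse. The word need not be reduced;
`List.length` is the word length. -/
abbrev BandWord (n : ℕ) : Type := List (BandIndex n × Bool)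

/-- The element of `B_n` represented by a word in the band generators. -/
def BandWord.braid {n : ℕ} (W : BandWord n) : BraidGroup n :=
  (W.map fun x => if x.2 then bandGen x.1 else (bandGen x.1)⁻¹).prod

/-- The letter `a_{ts}^{±1}` is written on the input tape as the three integers `t, s, ±1`. -/
def encodeLetter {n : ℕ} (x : BandIndex n × Bool) : List ℤ :=
  [(x.1.t : ℤ), (x.1.s : ℤ), if x.2 then 1 else -1]

/-- A word is written on the input tape as its length followed by its letters. -/
def encodeWord {n : ℕ} (W : BandWord n) : List ℤ :=
  (W.length : ℤ) :: W.flatMap encodeLetter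

/-- The input tape for the word problem: the braid index, then the two words. -/
def encodeInstance (n : ℕ) (V W : BandWord n) : List ℤ :=
  (n : ℤ) :: (encodeWord V ++ encodeWord W)

open Classical in
/-- The answer to the word problem: `1` if the two words represent the same braid, else `0`. -/
noncomputable def wordProblemAnswer {n : ℕ} (V W : BandWord n) : ℤ :=
  if V.braid = W.braid then 1 else 0

/-! ## The random access machine, with uniform cost -/

namespace RAM

/-- Operands: the constant `k`; the contents of register `i`; the contents of the register whose
number is the contents of register `i`. -/
inductive Operand where
  | const (k : ℤ)
  | direct (i : ℕ)
  | indirect (i : ℕ)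

/-- Destinations: register `i`; the register whose number is the contents of register `i`. -/
inductive Dest where
  | direct (i : ℕ)
  | indirect (i : ℕ)

/-- The instructions; register `0` is the accumulator, and the argument of a jump is the position
of an instruction in the program. -/
inductive Instr where
  | load (a : Operand)
  | store (d : Dest)
  | add (a : Operand)
  | sub (a : Operand)
  | mult (a : Operand)
  | div (a : Operand)
  | read (d : Dest)
  | write (a : Operand)
  | jump (b : ℕ)
  | jgtz (b : ℕ)
  | jzero (b : ℕ)
  | halt

/-- A program is a finite list of instructions, with positions counted from `0`. -/
abbrev Program : Type := List Instr

/-- A configuration: location counter, contents of the registers, unread part of the input tape,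
and what has been written on the output tape. -/
structure Config where
  pc : ℕ
  reg : ℕ → ℤ
  input : List ℤ
  output : List ℤ

/-- Initially all registers hold `0`, the first instruction is about to be executed and the output
tape is empty. -/
def start (inp : List ℤ) : Config := ⟨0, fun _ => 0, inp, []⟩

/-- The register whose number is the integer `z`, if `z` is not negative. -/
def regOfInt (z : ℤ) : Option ℕ := if 0 ≤ z then some z.toNat else none

/-- The value of an operand, if defined. -/
def Operand.value (reg : ℕ → ℤ) : Operand → Option ℤ
  | .const k => some k
  | .direct i => some (reg i)
  | .indirect i => (regOfInt (reg i)).map reg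

/-- The register designated by a destination, if defined. -/
def Dest.register (reg : ℕ → ℤ) : Dest → Option ℕ
  | .direct i => some i
  | .indirect i => regOfInt (reg i)

/-- Go on to the next instruction with contents `z` in register `r`. -/
def Config.set (c : Config) (r : ℕ) (z : ℤ) : Config :=
  { c with pc := c.pc + 1, reg := Function.update c.reg r z }

/-- Execution of one instruction. The value `none` means that the machine stops; this is the effect
of `halt` and of every instruction whose effect is undefined (a negative register number, division
by zero, reading an exhausted input tape). -/
def exec (c : Config) : Instr → Option Config
  | .load a => (a.value c.reg).map fun v => c.set 0 v
  | .store d => (d.register c.reg).map fun r => c.set r (c.reg 0)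
  | .add a => (a.value c.reg).map fun v => c.set 0 (c.reg 0 + v)
  | .sub a => (a.value c.reg).map fun v => c.set 0 (c.reg 0 - v)
  | .mult a => (a.value c.reg).map fun v => c.set 0 (c.reg 0 * v)
  | .div a => (a.value c.reg).bind fun v =>
      if v = 0 then none else some (c.set 0 (Int.fdiv (c.reg 0) v))
  | .read d => (d.register c.reg).bind fun r =>
      match c.input with
      | [] => none
      | z :: rest => some { c.set r z with input := rest }
  | .write a => (a.value c.reg).map fun v => { c with pc := c.pc + 1, output := c.output ++ [v] }
  | .jump b => some { c with pc := b }
  | .jgtz b => some { c with pc := if 0 < c.reg 0 then b else c.pc + 1 }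
  | .jzero b => some { c with pc := if c.reg 0 = 0 then b else c.pc + 1 }
  | .halt => none

/-- One step of the program `P`; the machine also stops when there is no instruction at the
location counter. -/
def step (P : Program) (c : Config) : Option Config := P[c.pc]?.bind (exec c)

/-- The configuration after `k` steps from `c`, if the machine does not stop before. -/
def run (P : Program) : ℕ → Config → Option Config
  | 0, c => some c
  | k + 1, c => (step P c).bind (run P k)

/-- On the input `inp`, the program `P` stops after exactly `T` steps, having written `out`. -/
def HaltsWith (P : Program) (inp out : List ℤ) (T : ℕ) : Prop :=
  ∃ c : Config, run P T (start inp) = some c ∧ step P c = none ∧ c.output = out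

/-- On the input `inp`, every integer in a register at any time is at most `B` in absolute value. -/
def RegistersBoundedBy (P : Program) (inp : List ℤ) (B : ℕ) : Prop :=
  ∀ (k : ℕ) (c : Config), run P k (start inp) = some c → ∀ r : ℕ, |c.reg r| ≤ (B : ℤ)

end RAM

/-! The question whether V = W becomes whether W⁻¹V = 1, and this is decided in the dual
(Birman–Ko–Lee) Garside structure of B_n. Its simple elements are the noncrossing permutations, that
is, the divisors of the long cycle c = (x ↦ x + 1) in the absolute order on the symmetric group; the
braid of c is δ. An inverse letter is written a⁻¹ = δ⁻¹(δa⁻¹), and powers of δ⁻¹ are moved to the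
left, which only rotates the letters they pass. Thus W⁻¹V = δ⁻ᵏw, where w is a product of |V| + |W|
simple braids, and it remains to decide whether w = δᵏ.

Left multiplication of a sequence of simple elements by a simple u is one greedy sweep (`star`): at
each position as much of the entry as possible is moved into the carried element, and the rest of
the entry is carried on. By `star_star` the sweep respects every factorization of a simple element.
On the sequences that c changes only by prepending c, after formal powers of c⁻¹ have been adjoined,
all simple elements act by permutations (`fracAct_bijective`). These satisfy the relations between
the band generators (`dualRelations_fracSwap`), so B_n acts (`braidAction`). Acting on the trivial
sequence shows that a word for δᵏ has the normal sequence c, …, c, 1, 1, … with k entries c;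
conversely `prod_map_normalSeq` recovers the braid from the sequence. Together this is
`prod_ncBraid_eq_pow_iff`.

The length of a permutation s is the rank of s - 1 over ℚ. The criterion `le_iff` shows that below c
the order is refinement of cycle partitions (`le_of_sameCycle`). Hence the meet of two simple
elements is the intersection of their cycle partitions, each class being run through in increasing
order (`nc_classPerm`). Passing from permutations to braids rests on `lift_eq`: any transposition
below s may be split off first, by the dual relations alone.

For the running time, a simple element is an array of n integers, and one step of a sweep costs
O(n). Cycles are labelled by their least elements in one increasing pass, and two partitions are
intersected by means of a table indexed by pairs of labels. The table has n² cells, but they are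
zero at the start and only the cells in use are cleared, so no step costs n². A letter passes at
most 2L entries, and there are at most 2L letters: O(L²n) in all. The program is written in a small
structured language with a cost semantics; `Big.correct` transfers result, cost and register bound
to the machine. -/

/-! ## Groups with a length function and Garside germs -/

/-- A conjugation invariant length function on a group. -/
structure LengthFunction (Γ : Type*) [Group Γ] where
  len : Γ → ℕ
  len_eq_zero : ∀ g, len g = 0 ↔ g = 1
  len_mul_le : ∀ g h, len (g * h) ≤ len g + len h
  len_conj : ∀ g h, len (h⁻¹ * g * h) = len g

namespace LengthFunction

variable {Γ : Type*} [Group Γ] (ℓ : LengthFunction Γ) {s t r x y : Γ}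

/-- The absolute order defined by a length function. -/
def Le (s t : Γ) : Prop := ℓ.len s + ℓ.len (s⁻¹ * t) = ℓ.len t

theorem one_le (s : Γ) : ℓ.Le 1 s := by simp [Le, (ℓ.len_eq_zero 1).2 rfl]

theorem le_refl (s : Γ) : ℓ.Le s s := by simp [Le, (ℓ.len_eq_zero 1).2 rfl]

theorem Le.antisymm {ℓ : LengthFunction Γ} (h : ℓ.Le s t) (h' : ℓ.Le t s) : s = t := by
  unfold Le at h h'
  have : ℓ.len (s⁻¹ * t) = 0 := by omega
  rw [ℓ.len_eq_zero] at this
  exact (inv_mul_eq_one.1 this)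

theorem Le.trans {ℓ : LengthFunction Γ} (h : ℓ.Le s t) (h' : ℓ.Le t r) : ℓ.Le s r := by
  unfold Le at *
  have h1 := ℓ.len_mul_le (s⁻¹ * t) (t⁻¹ * r)
  have h2 := ℓ.len_mul_le s (s⁻¹ * r)
  simp only [mul_assoc, mul_inv_cancel_left] at h1 h2
  omega

/-- The complement of s⁻¹t in t is t⁻¹st, a conjugate of s. This is the point where conjugation
invariance makes left and right divisors coincide. -/
theorem Le.inv_mul_le {ℓ : LengthFunction Γ} (h : ℓ.Le s t) : ℓ.Le (s⁻¹ * t) t := by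
  unfold Le at *
  have := ℓ.len_conj s t
  simp only [mul_inv_rev, inv_inv]
  omega

theorem Le.inv_mul_le_inv_mul {ℓ : LengthFunction Γ} (h : ℓ.Le s t) (h' : ℓ.Le t r) :
    ℓ.Le (s⁻¹ * t) (s⁻¹ * r) := by
  have h3 := h.trans h'
  unfold Le at *
  have : (s⁻¹ * t)⁻¹ * (s⁻¹ * r) = t⁻¹ * r := by group
  rw [this]
  omega

/-- The lengths of s, x and the remaining factor already add up to that of r, so subadditivity
forces every partial product to have additive length. -/
theorem Le.le_mul_and {ℓ : LengthFunction Γ} (h : ℓ.Le s r) (hx : ℓ.Le x (s⁻¹ * r)) :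
    ℓ.Le s (s * x) ∧ ℓ.Le (s * x) r := by
  unfold Le at *
  have h1 := ℓ.len_mul_le s x
  have h2 := ℓ.len_mul_le (s * x) ((s * x)⁻¹ * r)
  rw [mul_inv_cancel_left] at h2
  rw [inv_mul_cancel_left]
  have : x⁻¹ * (s⁻¹ * r) = (s * x)⁻¹ * r := by group
  rw [this] at hx
  omega

theorem Le.le_mul {ℓ : LengthFunction Γ} (h : ℓ.Le s r) (hx : ℓ.Le x (s⁻¹ * r)) :
    ℓ.Le s (s * x) := (h.le_mul_and hx).1

theorem Le.mul_le {ℓ : LengthFunction Γ} (h : ℓ.Le s r) (hx : ℓ.Le x (s⁻¹ * r)) :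
    ℓ.Le (s * x) r := (h.le_mul_and hx).2

theorem Le.mul_le_mul {ℓ : LengthFunction Γ} (h : ℓ.Le s r) (hx : ℓ.Le x y)
    (hy : ℓ.Le y (s⁻¹ * r)) : ℓ.Le (s * x) (s * y) :=
  (h.le_mul hy).mul_le (by rwa [inv_mul_cancel_left])

end LengthFunction

/-- A Garside element `c` of a group with a length function, whose divisors have meets. -/
structure GarsideGerm (Γ : Type*) [Group Γ] extends LengthFunction Γ where
  c : Γ
  meet : Γ → Γ → Γ
  meet_le_left : ∀ {s t}, toLengthFunction.Le s c → toLengthFunction.Le t c →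
    toLengthFunction.Le (meet s t) s
  meet_le_right : ∀ {s t}, toLengthFunction.Le s c → toLengthFunction.Le t c →
    toLengthFunction.Le (meet s t) t
  le_meet : ∀ {s t x}, toLengthFunction.Le s c → toLengthFunction.Le t c →
    toLengthFunction.Le x s → toLengthFunction.Le x t → toLengthFunction.Le x (meet s t)

/-! ### Greedy multiplication of sequences of simple elements -/

namespace GarsideGerm

open LengthFunction

variable {Γ : Type*} [Group Γ] (𝒢 : GarsideGerm Γ) {s t u x y : Γ} {N : ℕ → Γ}

/-- Simple elements are the divisors of the Garside element. -/
def Simple (s : Γ) : Prop := 𝒢.Le s 𝒢.c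

theorem simple_one : 𝒢.Simple 1 := 𝒢.one_le _

theorem simple_c : 𝒢.Simple 𝒢.c := 𝒢.le_refl _

variable {𝒢}

theorem Simple.inv_mul_c (h : 𝒢.Simple s) : 𝒢.Simple (s⁻¹ * 𝒢.c) := Le.inv_mul_le h

/-- Conjugation by c carries cs⁻¹ to s⁻¹c, whose length is complementary to that of s. Both
conjuncts are the same fact, folded and unfolded. -/
theorem Simple.c_mul_inv (h : 𝒢.Simple s) : 𝒢.Simple (𝒢.c * s⁻¹) ∧ 𝒢.Le (𝒢.c * s⁻¹) 𝒢.c := by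
  have key : 𝒢.Le (𝒢.c * s⁻¹) 𝒢.c := by
    unfold Simple Le at *
    have h1 := 𝒢.len_conj (𝒢.c * s⁻¹) 𝒢.c
    have e1 : 𝒢.c⁻¹ * (𝒢.c * s⁻¹) * 𝒢.c = s⁻¹ * 𝒢.c := by group
    have e2 : (𝒢.c * s⁻¹)⁻¹ * 𝒢.c = s := by group
    rw [e1] at h1
    rw [e2]
    omega
  exact ⟨key, key⟩

theorem Simple.conj (h : 𝒢.Simple s) : 𝒢.Simple (𝒢.c * s * 𝒢.c⁻¹) := by
  have := (h.c_mul_inv.1).c_mul_inv.1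
  simpa [mul_assoc] using this

theorem meet_eq_left (hs : 𝒢.Simple s) (ht : 𝒢.Simple t) (h : 𝒢.Le s t) : 𝒢.meet s t = s :=
  (𝒢.meet_le_left hs ht).antisymm (𝒢.le_meet hs ht (𝒢.le_refl _) h)

theorem meet_eq_right (hs : 𝒢.Simple s) (ht : 𝒢.Simple t) (h : 𝒢.Le t s) : 𝒢.meet s t = t :=
  (𝒢.meet_le_right hs ht).antisymm (𝒢.le_meet hs ht h (𝒢.le_refl _))

variable (𝒢)

/-- The part of `s` that can be moved into `u`. -/
def slide (u s : Γ) : Γ := 𝒢.meet (u⁻¹ * 𝒢.c) s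

/-- The simple element carried to position `i` when `u` is multiplied to the left of the
sequence `N`. -/
def carry (u : Γ) (N : ℕ → Γ) : ℕ → Γ
  | 0 => u
  | i + 1 => (𝒢.slide (carry u N i) (N i))⁻¹ * N i

/-- The sequence of simple elements obtained when `u` is multiplied to the left of `N`. -/
def star (u : Γ) (N : ℕ → Γ) (i : ℕ) : Γ :=
  𝒢.carry u N i * 𝒢.slide (𝒢.carry u N i) (N i)

variable {𝒢}

theorem slide_le (hu : 𝒢.Simple u) (hs : 𝒢.Simple s) : 𝒢.Le (𝒢.slide u s) s :=
  𝒢.meet_le_right hu.inv_mul_c hs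

theorem slide_le_inv_mul (hu : 𝒢.Simple u) (hs : 𝒢.Simple s) :
    𝒢.Le (𝒢.slide u s) (u⁻¹ * 𝒢.c) :=
  𝒢.meet_le_left hu.inv_mul_c hs

theorem simple_slide_inv_mul (hu : 𝒢.Simple u) (hs : 𝒢.Simple s) :
    𝒢.Simple ((𝒢.slide u s)⁻¹ * s) :=
  (slide_le hu hs).inv_mul_le.trans hs

theorem simple_mul_slide (hu : 𝒢.Simple u) (hs : 𝒢.Simple s) : 𝒢.Simple (u * 𝒢.slide u s) :=
  Le.mul_le hu (slide_le_inv_mul hu hs)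

theorem le_mul_slide (hu : 𝒢.Simple u) (hs : 𝒢.Simple s) : 𝒢.Le u (u * 𝒢.slide u s) :=
  Le.le_mul hu (slide_le_inv_mul hu hs)

theorem simple_carry (hu : 𝒢.Simple u) (hN : ∀ i, 𝒢.Simple (N i)) (i : ℕ) :
    𝒢.Simple (𝒢.carry u N i) := by
  induction i with
  | zero => exact hu
  | succ i ih => exact simple_slide_inv_mul ih (hN i)

theorem simple_star (hu : 𝒢.Simple u) (hN : ∀ i, 𝒢.Simple (N i)) (i : ℕ) :
    𝒢.Simple (𝒢.star u N i) :=
  simple_mul_slide (simple_carry hu hN i) (hN i)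

/-- Sliding past two factors at once. -/
theorem slide_mul_slide {a b z : Γ} (hab : 𝒢.Le a (a * b)) (hc : 𝒢.Simple (a * b))
    (hb : 𝒢.Simple b) (hz : 𝒢.Simple z) :
    𝒢.slide a (b * 𝒢.slide b z) = b * 𝒢.slide (a * b) z := by
  have ha : 𝒢.Simple a := hab.trans hc
  have hm := simple_mul_slide hb hz
  -- Both arguments of the meet on the left are multiples of b, so b can be divided out of it. What
  -- remains is the meet of (ab)⁻¹c, b⁻¹c and z, in which b⁻¹c is redundant because (ab)⁻¹c divides
  -- it.
  have hbd : 𝒢.Le b (a⁻¹ * 𝒢.c) := by simpa using hab.inv_mul_le_inv_mul hc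
  have e : (a * b)⁻¹ * 𝒢.c = b⁻¹ * (a⁻¹ * 𝒢.c) := by group
  have h1 : 𝒢.Le (𝒢.slide (a * b) z) (b⁻¹ * (a⁻¹ * 𝒢.c)) := e ▸ slide_le_inv_mul hc hz
  have h2 : 𝒢.Le (b⁻¹ * (a⁻¹ * 𝒢.c)) (b⁻¹ * 𝒢.c) := hbd.inv_mul_le_inv_mul ha.inv_mul_c
  have h3 : 𝒢.Le (𝒢.slide (a * b) z) (𝒢.slide b z) :=
    𝒢.le_meet hb.inv_mul_c hz (h1.trans h2) (slide_le hc hz)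
  have hbm : 𝒢.Le b (𝒢.slide a (b * 𝒢.slide b z)) :=
    𝒢.le_meet ha.inv_mul_c hm hbd (le_mul_slide hb hz)
  apply Le.antisymm
  · have h4 : 𝒢.Le (b⁻¹ * 𝒢.slide a (b * 𝒢.slide b z)) (𝒢.slide (a * b) z) := by
      apply 𝒢.le_meet hc.inv_mul_c hz
      · rw [e]
        exact hbm.inv_mul_le_inv_mul (slide_le_inv_mul ha hm)
      · have := hbm.inv_mul_le_inv_mul (slide_le ha hm)
        rw [inv_mul_cancel_left] at this
        exact this.trans (slide_le hb hz)
    simpa using Le.mul_le_mul hb h4 (h1.trans h2)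
  · exact 𝒢.le_meet ha.inv_mul_c hm (hbd.mul_le h1) (Le.mul_le_mul hb h3 (slide_le_inv_mul hb hz))

/-- Two successive sweeps, by t and then by s, carry elements whose product is what a single sweep
by st carries. By `slide_mul_slide` the common factor cancels at each position. -/
theorem carry_star (hst : 𝒢.Le s (s * t)) (hc : 𝒢.Simple (s * t)) (ht : 𝒢.Simple t)
    (hN : ∀ i, 𝒢.Simple (N i)) (i : ℕ) :
    𝒢.carry s (𝒢.star t N) i * 𝒢.carry t N i = 𝒢.carry (s * t) N i ∧
      𝒢.Le (𝒢.carry s (𝒢.star t N) i) (𝒢.carry (s * t) N i) := by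
  induction i with
  | zero => exact ⟨rfl, hst⟩
  | succ i ih =>
    obtain ⟨h1, h2⟩ := ih
    have hb := simple_carry ht hN i
    have hg := simple_carry hc hN i
    simp only [carry, star]
    set b := 𝒢.carry t N i
    set a := 𝒢.carry s (𝒢.star t N) i
    rw [← h1] at h2 hg ⊢
    rw [slide_mul_slide h2 hg hb (hN i)]
    have h3 : 𝒢.Le (𝒢.slide (a * b) (N i)) (𝒢.slide b (N i)) := by
      have e : (a * b)⁻¹ * 𝒢.c = b⁻¹ * (a⁻¹ * 𝒢.c) := by group
      have hbd : 𝒢.Le b (a⁻¹ * 𝒢.c) := by simpa using h2.inv_mul_le_inv_mul hg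
      exact 𝒢.le_meet hb.inv_mul_c (hN i) ((e ▸ slide_le_inv_mul hg (hN i)).trans
        (hbd.inv_mul_le_inv_mul (Simple.inv_mul_c (h2.trans hg)))) (slide_le hg (hN i))
    refine ⟨by group, ?_⟩
    have := h3.inv_mul_le_inv_mul (slide_le hb (hN i))
    convert this using 1
    group

/-- The associativity on which the group action rests: factorizations of a simple element into
simple elements with additive lengths are respected. -/
theorem star_star (hst : 𝒢.Le s (s * t)) (hc : 𝒢.Simple (s * t)) (ht : 𝒢.Simple t)
    (hN : ∀ i, 𝒢.Simple (N i)) : 𝒢.star s (𝒢.star t N) = 𝒢.star (s * t) N := by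
  funext i
  obtain ⟨h1, h2⟩ := carry_star hst hc ht hN i
  have hb := simple_carry ht hN i
  have hg := simple_carry hc hN i
  simp only [star]
  rw [← h1] at h2 hg ⊢
  have := slide_mul_slide h2 hg hb (hN i)
  unfold star at this ⊢
  rw [this]
  group

/-- Prepend `c` to a sequence. -/
def consC (𝒢 : GarsideGerm Γ) (N : ℕ → Γ) : ℕ → Γ
  | 0 => 𝒢.c
  | i + 1 => N i

theorem consC_injective : Function.Injective 𝒢.consC := fun N N' h => by
  funext i
  exact congrFun h (i + 1)

/-- At the entry c, the carried cuc⁻¹ takes its whole complement and becomes c; what is carried on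
is u. -/
theorem star_conj_consC (hu : 𝒢.Simple u) :
    𝒢.star (𝒢.c * u * 𝒢.c⁻¹) (𝒢.consC N) = 𝒢.consC (𝒢.star u N) := by
  have hs : 𝒢.slide (𝒢.c * u * 𝒢.c⁻¹) 𝒢.c = (𝒢.c * u * 𝒢.c⁻¹)⁻¹ * 𝒢.c :=
    meet_eq_left hu.conj.inv_mul_c 𝒢.simple_c hu.conj.inv_mul_c
  have h : ∀ i, 𝒢.carry (𝒢.c * u * 𝒢.c⁻¹) (𝒢.consC N) (i + 1) = 𝒢.carry u N i := by
    intro i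
    induction i with
    | zero =>
      simp only [carry, consC, hs]
      group
    | succ i ih =>
      rw [carry, ih]
      simp [carry, consC]
  funext i
  cases i with
  | zero =>
    simp only [star, carry, consC, hs]
    group
  | succ i =>
    rw [star, h]
    simp [star, consC]

/-- Factor c as (cu⁻¹)u and as (cuc⁻¹)(cu⁻¹), and apply `star_star` to both factorizations. -/
theorem star_c_star (hu : 𝒢.Simple u) (hN : ∀ i, 𝒢.Simple (N i)) :
    𝒢.star 𝒢.c (𝒢.star u N) = 𝒢.star (𝒢.c * u * 𝒢.c⁻¹) (𝒢.star 𝒢.c N) := by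
  have h1 : 𝒢.star 𝒢.c N = 𝒢.star (𝒢.c * u⁻¹) (𝒢.star u N) := by
    rw [star_star _ _ hu hN]
    · simp
    · simpa using hu.c_mul_inv.2
    · simpa using 𝒢.simple_c
  have e : 𝒢.c * u * 𝒢.c⁻¹ * (𝒢.c * u⁻¹) = 𝒢.c := by group
  rw [h1, star_star (by rw [e]; exact hu.conj) (by rw [e]; exact 𝒢.simple_c) hu.c_mul_inv.1
    (simple_star hu hN), e]

theorem star_c_one : 𝒢.star 𝒢.c (fun _ => 1) = 𝒢.consC (fun _ => 1) := by
  have hs : ∀ u : Γ, 𝒢.Simple u → 𝒢.slide u 1 = 1 := fun u hu =>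
    meet_eq_right hu.inv_mul_c 𝒢.simple_one (𝒢.one_le _)
  have h : ∀ i, 𝒢.carry 𝒢.c (fun _ => 1) (i + 1) = 1 := by
    intro i
    induction i with
    | zero => simp [carry, hs _ 𝒢.simple_c]
    | succ i ih => rw [carry, ih]; simp [hs _ 𝒢.simple_one]
  funext i
  cases i with
  | zero => simp [star, carry, consC, hs _ 𝒢.simple_c]
  | succ i => rw [star, h]; simp [consC, hs _ 𝒢.simple_one]

/-! ### The group action -/

variable (𝒢)

/-- The sequences of simple elements on which `c` acts by prepending `c`. -/
abbrev Seq : Type _ := {N : ℕ → Γ // (∀ i, 𝒢.Simple (N i)) ∧ 𝒢.star 𝒢.c N = 𝒢.consC N}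

/-- The trivial sequence. -/
def Seq.one : 𝒢.Seq := ⟨fun _ => 1, fun _ => 𝒢.simple_one, star_c_one⟩

/-- The type of simple elements. -/
abbrev Simples : Type _ := {s : Γ // 𝒢.Simple s}

variable {𝒢}

/-- The action of simple elements on sequences. -/
def act (u : 𝒢.Simples) (N : 𝒢.Seq) : 𝒢.Seq :=
  ⟨𝒢.star u.1 N.1, simple_star u.2 N.2.1, by
    -- c ∗ (u ∗ N) = (cuc⁻¹) ∗ (c ∗ N), and c ∗ N is N with c prepended, so the sweep passes the
    -- first entry as u.
    rw [star_c_star u.2 N.2.1, N.2.2, star_conj_consC u.2]⟩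

/-- The Garside element as a simple element. -/
def cS : 𝒢.Simples := ⟨𝒢.c, 𝒢.simple_c⟩

/-- Conjugation of a simple element by the `k`-th power of the Garside element. -/
def tau (k : ℕ) (u : 𝒢.Simples) : 𝒢.Simples :=
  ⟨𝒢.c ^ k * u.1 * (𝒢.c ^ k)⁻¹, by
    induction k with
    | zero => simpa using u.2
    | succ k ih =>
      convert ih.conj using 1
      rw [pow_succ']
      group⟩

/-- Prepending c loses nothing. Cancellation of c is all that is needed to form quotients on which c
becomes invertible. -/
theorem act_cS_injective : Function.Injective (act (𝒢 := 𝒢) cS) := by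
  intro N N' h
  have := congrArg Subtype.val h
  simp only [act, cS, N.2.2, N'.2.2] at this
  exact Subtype.ext (consC_injective this)

theorem act_act (s t w : 𝒢.Simples) (h : s.1 * t.1 = w.1) (hs : 𝒢.Le s.1 w.1) (N : 𝒢.Seq) :
    act s (act t N) = act w N := by
  apply Subtype.ext
  simp only [act]
  rw [star_star (by rwa [h]) (by rw [h]; exact w.2) t.2 N.2.1, h]

theorem act_cS_iterate (k : ℕ) (u : 𝒢.Simples) (N : 𝒢.Seq) :
    (act cS)^[k] (act u N) = act (tau k u) ((act cS)^[k] N) := by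
  induction k with
  | zero => simp [tau]
  | succ k ih =>
    rw [Function.iterate_succ_apply', Function.iterate_succ_apply', ih]
    have e : (tau (k + 1) u).1 = 𝒢.c * (tau k u).1 * 𝒢.c⁻¹ := by
      simp only [tau]
      rw [pow_succ']
      group
    apply Subtype.ext
    change 𝒢.star 𝒢.c (𝒢.star _ _) = 𝒢.star _ (𝒢.star 𝒢.c _)
    rw [star_c_star (tau k u).2 ((act cS)^[k] N).2.1, e]

theorem tau_add (k l : ℕ) (u : 𝒢.Simples) : tau k (tau l u) = tau (k + l) u := by
  apply Subtype.ext
  simp only [tau, pow_add]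
  group

/-- Formal quotients `c⁻ᵏ N`. -/
def fracSetoid (𝒢 : GarsideGerm Γ) : Setoid (ℕ × 𝒢.Seq) where
  r a b := (act cS)^[b.1] a.2 = (act cS)^[a.1] b.2
  iseqv :=
    { refl := fun _ => rfl
      symm := fun h => h.symm
      trans := by
        intro a b d h1 h2
        apply act_cS_injective.iterate b.1
        rw [← Function.iterate_add_apply, add_comm, Function.iterate_add_apply, h1,
          ← Function.iterate_add_apply, add_comm, Function.iterate_add_apply, h2,
          ← Function.iterate_add_apply, ← Function.iterate_add_apply, add_comm] }

/-- The set of formal quotients `c⁻ᵏ N`. -/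
def Frac (𝒢 : GarsideGerm Γ) : Type _ := Quotient 𝒢.fracSetoid

/-- The formal quotient `c⁻ᵏ N`. -/
def Frac.mk (k : ℕ) (N : 𝒢.Seq) : 𝒢.Frac := Quotient.mk 𝒢.fracSetoid (k, N)

theorem Frac.mk_eq {k l : ℕ} {N N' : 𝒢.Seq} :
    Frac.mk k N = Frac.mk l N' ↔ (act cS)^[l] N = (act cS)^[k] N' := Quotient.eq

/-- The action of simple elements on formal quotients. -/
def fracAct (u : 𝒢.Simples) : 𝒢.Frac → 𝒢.Frac :=
  Quotient.lift (fun a => Frac.mk a.1 (act (tau a.1 u) a.2)) (by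
    rintro ⟨k, N⟩ ⟨l, N'⟩ h
    change (act cS)^[l] N = (act cS)^[k] N' at h
    simp only [Frac.mk_eq, act_cS_iterate, tau_add]
    rw [h, add_comm])

theorem fracAct_mk (u : 𝒢.Simples) (k : ℕ) (N : 𝒢.Seq) :
    fracAct u (Frac.mk k N) = Frac.mk k (act (tau k u) N) := rfl

theorem tau_le (k : ℕ) {s t : Γ} (h : 𝒢.Le s t) :
    𝒢.Le (𝒢.c ^ k * s * (𝒢.c ^ k)⁻¹) (𝒢.c ^ k * t * (𝒢.c ^ k)⁻¹) := by
  have e : ∀ g, 𝒢.len (𝒢.c ^ k * g * (𝒢.c ^ k)⁻¹) = 𝒢.len g := fun g => by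
    simpa using 𝒢.len_conj g (𝒢.c ^ k)⁻¹
  unfold Le at *
  have : (𝒢.c ^ k * s * (𝒢.c ^ k)⁻¹)⁻¹ * (𝒢.c ^ k * t * (𝒢.c ^ k)⁻¹) =
    𝒢.c ^ k * (s⁻¹ * t) * (𝒢.c ^ k)⁻¹ := by group
  rw [this, e, e, e]
  exact h

theorem fracAct_fracAct (s t w : 𝒢.Simples) (h : s.1 * t.1 = w.1) (hs : 𝒢.Le s.1 w.1)
    (y : 𝒢.Frac) : fracAct s (fracAct t y) = fracAct w y := by
  induction y using Quotient.inductionOn with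
  | h a =>
    change fracAct s (fracAct t (Frac.mk a.1 a.2)) = fracAct w (Frac.mk a.1 a.2)
    simp only [fracAct_mk]
    rw [act_act _ _ (tau a.1 w) _ (tau_le _ hs)]
    simp only [tau, ← h]
    group

theorem tau_cS (k : ℕ) : tau k (cS : 𝒢.Simples) = cS := by
  apply Subtype.ext
  simp only [tau, cS]
  group

theorem fracAct_cS_bijective : Function.Bijective (fracAct (cS : 𝒢.Simples)) := by
  constructor
  · intro y y' h
    induction y using Quotient.inductionOn with
    | h a =>
      induction y' using Quotient.inductionOn with
      | h b =>
        change fracAct cS (Frac.mk a.1 a.2) = fracAct cS (Frac.mk b.1 b.2) at h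
        change Frac.mk a.1 a.2 = Frac.mk b.1 b.2
        simp only [fracAct_mk, Frac.mk_eq, tau_cS, ← Function.iterate_succ_apply] at h ⊢
        simp only [Function.iterate_succ_apply'] at h
        exact act_cS_injective h
  · intro y
    induction y using Quotient.inductionOn with
    | h a =>
      refine ⟨Frac.mk (a.1 + 1) a.2, ?_⟩
      change _ = Frac.mk a.1 a.2
      simp only [fracAct_mk, Frac.mk_eq, tau_cS, ← Function.iterate_succ_apply]

/-- The complements on both sides, u⁻¹c and cu⁻¹, compose with u to c, which acts bijectively. One
composite gives surjectivity, the other injectivity. -/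
theorem fracAct_bijective (u : 𝒢.Simples) : Function.Bijective (fracAct u) := by
  have h1 : fracAct u ∘ fracAct (⟨_, u.2.inv_mul_c⟩ : 𝒢.Simples) = fracAct cS := by
    funext y
    exact fracAct_fracAct u ⟨_, u.2.inv_mul_c⟩ cS (by simp [cS]) u.2 y
  have h2 : fracAct (⟨_, u.2.c_mul_inv.1⟩ : 𝒢.Simples) ∘ fracAct u = fracAct cS := by
    funext y
    exact fracAct_fracAct ⟨_, u.2.c_mul_inv.1⟩ u cS (by simp [cS]) u.2.c_mul_inv.2 y
  exact ⟨Function.Injective.of_comp (h2 ▸ fracAct_cS_bijective.1),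
    Function.Surjective.of_comp (h1 ▸ fracAct_cS_bijective.2)⟩

/-- Simple elements as permutations of the set of formal quotients. -/
noncomputable def fracPerm (u : 𝒢.Simples) : Equiv.Perm 𝒢.Frac :=
  Equiv.ofBijective _ (fracAct_bijective u)

theorem fracPerm_mul (s t w : 𝒢.Simples) (h : s.1 * t.1 = w.1) (hs : 𝒢.Le s.1 w.1) :
    fracPerm s * fracPerm t = fracPerm w := by
  ext y
  exact fracAct_fracAct s t w h hs y

theorem fracPerm_one : fracPerm (⟨1, 𝒢.simple_one⟩ : 𝒢.Simples) = 1 := by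
  have := fracPerm_mul (⟨1, 𝒢.simple_one⟩ : 𝒢.Simples) ⟨1, 𝒢.simple_one⟩ ⟨1, 𝒢.simple_one⟩
    (by simp) (𝒢.le_refl _)
  exact mul_eq_left.1 this

/-- The sequence obtained by multiplying a list of simple elements. -/
def normalSeq (𝒢 : GarsideGerm Γ) (w : List Γ) : ℕ → Γ := w.foldr 𝒢.star (fun _ => 1)

theorem simple_normalSeq {w : List Γ} (hw : ∀ u ∈ w, 𝒢.Simple u) (i : ℕ) :
    𝒢.Simple (𝒢.normalSeq w i) := by
  induction w generalizing i with
  | nil => exact 𝒢.simple_one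
  | cons u w ih =>
    simp only [List.mem_cons, forall_eq_or_imp] at hw
    exact simple_star hw.1 (ih hw.2) i

theorem iterate_act_cS_one (k i : ℕ) :
    ((act (𝒢 := 𝒢) cS)^[k] (Seq.one 𝒢)).1 i = if i < k then 𝒢.c else 1 := by
  induction k generalizing i with
  | zero => rfl
  | succ k ih =>
    rw [Function.iterate_succ_apply']
    change 𝒢.star 𝒢.c _ i = _
    rw [((act (𝒢 := 𝒢) cS)^[k] (Seq.one 𝒢)).2.2]
    cases i with
    | zero => simp [consC]
    | succ i => simp [consC, ih]

/-- If the product of permutations of the formal quotients defined by a list of simple elements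
is that of a power of `c`, so is the normal sequence. -/
theorem normalSeq_of_prod_fracPerm (w : List 𝒢.Simples) (k : ℕ)
    (h : (w.map fracPerm).prod = fracPerm cS ^ k) (i : ℕ) :
    𝒢.normalSeq (w.map Subtype.val) i = if i < k then 𝒢.c else 1 := by
  -- Evaluated at the trivial sequence, both sides keep the denominator c⁰, so equality of classes
  -- is equality of sequences.
  have h1 : ∀ w : List 𝒢.Simples, ∃ N : 𝒢.Seq, N.1 = 𝒢.normalSeq (w.map Subtype.val) ∧
      (w.map fracPerm).prod (Frac.mk 0 (Seq.one 𝒢)) = Frac.mk 0 N := by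
    intro w
    induction w with
    | nil => exact ⟨Seq.one 𝒢, rfl, rfl⟩
    | cons u w ih =>
      obtain ⟨N, hN, hN'⟩ := ih
      refine ⟨act u N, ?_, ?_⟩
      · simp [act, normalSeq, hN]
      · rw [List.map_cons, List.prod_cons, Equiv.Perm.mul_apply, hN']
        change fracAct u (Frac.mk 0 N) = _
        rw [fracAct_mk]
        simp [tau]
  have h2 : ∀ k : ℕ, (fracPerm (cS : 𝒢.Simples) ^ k) (Frac.mk 0 (Seq.one 𝒢)) =
      Frac.mk 0 ((act cS)^[k] (Seq.one 𝒢)) := by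
    intro k
    induction k with
    | zero => rfl
    | succ k ih =>
      rw [pow_succ', Equiv.Perm.mul_apply, ih, Function.iterate_succ_apply']
      change fracAct (cS : 𝒢.Simples) (Frac.mk 0 ((act cS)^[k] (Seq.one 𝒢))) = _
      rw [fracAct_mk, tau_cS]
  obtain ⟨N, hN, hN'⟩ := h1 w
  rw [h, h2, Frac.mk_eq] at hN'
  simp only [Function.iterate_zero, id] at hN'
  rw [← hN, ← hN', iterate_act_cS_one]

/-! ### Evaluation in a group -/

/-- Once the entries are trivial, the carried element stops there and the next one is trivial. So
each factor lengthens the sequence by at most one. -/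
theorem normalSeq_eq_one {w : List Γ} (hw : ∀ u ∈ w, 𝒢.Simple u) {i : ℕ} (hi : w.length ≤ i) :
    𝒢.normalSeq w i = 1 := by
  induction w generalizing i with
  | nil => rfl
  | cons u w ih =>
    simp only [List.mem_cons, forall_eq_or_imp] at hw
    have hs : ∀ u : Γ, 𝒢.Simple u → 𝒢.slide u 1 = 1 := fun u hu =>
      meet_eq_right hu.inv_mul_c 𝒢.simple_one (𝒢.one_le _)
    obtain ⟨i, rfl⟩ : ∃ j, i = j + 1 := ⟨i - 1, by simp at hi; omega⟩
    simp only [List.length_cons, Nat.add_le_add_iff_right] at hi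
    have hc : ∀ j, w.length ≤ j → 𝒢.carry u (𝒢.normalSeq w) (j + 1) = 1 := by
      intro j hj
      rw [carry, ih hw.2 hj, hs _ (simple_carry hw.1 (simple_normalSeq hw.2) j)]
      simp
    change 𝒢.star u (𝒢.normalSeq w) (i + 1) = 1
    rw [star, hc i hi, ih hw.2 (by omega), hs _ 𝒢.simple_one, one_mul]

theorem star_eq_carry {N : ℕ → Γ} (hu : 𝒢.Simple u) (hN : ∀ i, 𝒢.Simple (N i)) {i : ℕ}
    (hi : N i = 1) : 𝒢.star u N i = 𝒢.carry u N i := by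
  rw [star, hi]
  have : 𝒢.slide (𝒢.carry u N i) 1 = 1 :=
    meet_eq_right (simple_carry hu hN i).inv_mul_c 𝒢.simple_one (𝒢.one_le _)
  rw [this, mul_one]

/-- A multiplicative map of simple elements to a group sees only the normal sequence. -/
theorem prod_map_normalSeq {G : Type*} [Group G] (φ : Γ → G)
    (hφ : ∀ s t, 𝒢.Le s (s * t) → 𝒢.Simple (s * t) → φ (s * t) = φ s * φ t)
    {w : List Γ} (hw : ∀ u ∈ w, 𝒢.Simple u) :
    ((List.range w.length).map fun i => φ (𝒢.normalSeq w i)).prod = (w.map φ).prod := by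
  induction w with
  | nil => rfl
  | cons u w ih =>
    simp only [List.mem_cons, forall_eq_or_imp] at hw
    have hN := simple_normalSeq hw.2
    -- At every moment of the sweep, the finished entries times the carried element equal u times
    -- the entries already consumed.
    have key : ∀ i, ((List.range i).map fun j => φ (𝒢.star u (𝒢.normalSeq w) j)).prod *
        φ (𝒢.carry u (𝒢.normalSeq w) i) =
        φ u * ((List.range i).map fun j => φ (𝒢.normalSeq w j)).prod := by
      intro i
      induction i with
      | zero => simp [carry]
      | succ i ihi =>
        have hc := simple_carry hw.1 hN i
        have h1 : φ (𝒢.star u (𝒢.normalSeq w) i) = φ (𝒢.carry u (𝒢.normalSeq w) i) *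
            φ (𝒢.slide (𝒢.carry u (𝒢.normalSeq w) i) (𝒢.normalSeq w i)) :=
          hφ _ _ (le_mul_slide hc (hN i)) (simple_mul_slide hc (hN i))
        have h2 : φ (𝒢.normalSeq w i) =
            φ (𝒢.slide (𝒢.carry u (𝒢.normalSeq w) i) (𝒢.normalSeq w i)) *
            φ (𝒢.carry u (𝒢.normalSeq w) (i + 1)) := by
          rw [carry, ← hφ, mul_inv_cancel_left]
          · rw [mul_inv_cancel_left]
            exact slide_le hc (hN i)
          · rw [mul_inv_cancel_left]
            exact hN i
        rw [List.range_succ, List.map_append, List.map_append, List.prod_append, List.prod_append]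
        simp only [List.map_cons, List.map_nil, List.prod_cons, List.prod_nil, mul_one]
        rw [← mul_assoc (φ u), ← ihi, h1, h2]
        group
    have h3 := key w.length
    rw [ih hw.2] at h3
    rw [List.length_cons, List.range_succ, List.map_append, List.prod_append, List.map_cons (f := φ),
      List.prod_cons, ← h3]
    congr 1
    simp only [List.map_cons, List.map_nil, List.prod_cons, List.prod_nil, mul_one]
    exact congrArg φ (star_eq_carry hw.1 hN (normalSeq_eq_one hw.2 le_rfl))

end GarsideGerm

/-! ## The absolute order on permutations -/

namespace AbsoluteOrder

open Equiv

section Linear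

variable {α : Type*} [Fintype α] [DecidableEq α]

/-- The difference of the permutation representation and the identity. -/
def diff (s : Perm α) : (α → ℚ) →ₗ[ℚ] (α → ℚ) :=
  LinearMap.funLeft ℚ ℚ s.symm - LinearMap.id

omit [Fintype α] [DecidableEq α] in
theorem diff_apply (s : Perm α) (v : α → ℚ) (i : α) : diff s v i = v (s.symm i) - v i := rfl

/-- The moved space of a permutation. -/
def moved (s : Perm α) : Submodule ℚ (α → ℚ) := LinearMap.range (diff s)

omit [Fintype α] [DecidableEq α] in
theorem diff_mul (s t : Perm α) (v : α → ℚ) :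
    diff (s * t) v = diff s (LinearMap.funLeft ℚ ℚ t.symm v) + diff t v := by
  funext i
  simp only [diff_apply, LinearMap.funLeft_apply, Pi.add_apply, sub_add_sub_cancel]
  rfl

omit [Fintype α] [DecidableEq α] in
theorem moved_mul_le (s t : Perm α) : moved (s * t) ≤ moved s ⊔ moved t := by
  rintro _ ⟨v, rfl⟩
  rw [diff_mul]
  exact Submodule.add_mem_sup ⟨_, rfl⟩ ⟨_, rfl⟩

omit [Fintype α] in
theorem diff_single (s : Perm α) (i : α) :
    diff s (Pi.single i 1) = Pi.single (s i) 1 - Pi.single i 1 := by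
  funext j
  simp only [diff_apply, Pi.sub_apply, Pi.single_apply, symm_apply_eq]

omit [Fintype α] in
theorem diff_eq_zero_iff (s : Perm α) : diff s = 0 ↔ s = 1 := by
  constructor
  · intro h
    ext i
    have := congrFun (LinearMap.congr_fun h (Pi.single i 1)) i
    simp only [diff_apply, Pi.single_apply, LinearMap.zero_apply, Pi.zero_apply, if_true] at this
    by_cases h' : s.symm i = i
    · rw [symm_apply_eq] at h'
      exact h'.symm
    · simp [h'] at this
  · rintro rfl
    refine LinearMap.ext fun v => funext fun i => ?_
    exact sub_self (v i)

omit [DecidableEq α] in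
theorem finrank_moved_conj_le (g h : Perm α) :
    Module.finrank ℚ (moved (h⁻¹ * g * h)) ≤ Module.finrank ℚ (moved g) := by
  have : diff (h⁻¹ * g * h) = LinearMap.funLeft ℚ ℚ (h : Perm α) ∘ₗ
      (diff g ∘ₗ LinearMap.funLeft ℚ ℚ h.symm) := by
    refine LinearMap.ext fun v => funext fun i => ?_
    change v (h.symm (g.symm (h i))) - v i =
      v (h.symm (g.symm (h i))) - v (h.symm (h i))
    rw [symm_apply_apply]
  rw [moved, this, LinearMap.range_comp]
  exact (Submodule.finrank_map_le _ _).trans (Submodule.finrank_mono (LinearMap.range_comp_le_range _ _))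

/-- The absolute length of a permutation. -/
noncomputable def absLength (α : Type*) [Fintype α] [DecidableEq α] : LengthFunction (Perm α) where
  len s := Module.finrank ℚ (moved s)
  len_eq_zero s := by
    rw [Submodule.finrank_eq_zero, moved, LinearMap.range_eq_bot, diff_eq_zero_iff]
  len_mul_le s t := (Submodule.finrank_mono (moved_mul_le s t)).trans
    (Submodule.finrank_add_le_finrank_add_finrank _ _)
  len_conj g h := by
    apply le_antisymm (finrank_moved_conj_le g h)
    have := finrank_moved_conj_le (h⁻¹ * g * h) h⁻¹
    have e : h⁻¹⁻¹ * (h⁻¹ * g * h) * h⁻¹ = g := by group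
    rwa [e] at this

/-- If the lengths add up, the moved space of t is the direct sum of those of s and s⁻¹t, and the
component of (t - 1)v in the second one is (s⁻¹t - 1)v. So s - 1 and t - 1 agree on every v whose
image under t - 1 lies in the moved space of s. Conversely, all these v are fixed by s⁻¹t, which
bounds its rank. In particular a divisor of t is determined by its moved space. -/
theorem le_iff {s t : Perm α} : (absLength α).Le s t ↔
    moved s ≤ moved t ∧ ∀ v, diff t v ∈ moved s → diff s v = diff t v := by
  have hst : s * (s⁻¹ * t) = t := by group
  constructor
  · intro h
    change Module.finrank ℚ (moved s) + Module.finrank ℚ (moved (s⁻¹ * t)) =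
      Module.finrank ℚ (moved t) at h
    have h1 : moved t ≤ moved s ⊔ moved (s⁻¹ * t) := by
      conv_lhs => rw [← hst]
      exact moved_mul_le _ _
    have h2 := Submodule.finrank_sup_add_finrank_inf_eq (moved s) (moved (s⁻¹ * t))
    have h3 := Submodule.finrank_mono h1
    have h4 : moved s ⊓ moved (s⁻¹ * t) = ⊥ := by
      rw [← Submodule.finrank_eq_zero (R := ℚ)]
      omega
    have h5 : moved t = moved s ⊔ moved (s⁻¹ * t) :=
      Submodule.eq_of_le_of_finrank_le h1 (by omega)
    refine ⟨h5 ▸ le_sup_left, fun v hv => ?_⟩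
    have h6 := diff_mul s (s⁻¹ * t) v
    rw [hst] at h6
    have h7 : diff (s⁻¹ * t) v ∈ moved s ⊓ moved (s⁻¹ * t) := by
      refine ⟨?_, ⟨v, rfl⟩⟩
      have : diff (s⁻¹ * t) v = diff t v -
          diff s (LinearMap.funLeft ℚ ℚ (s⁻¹ * t).symm v) := by
        rw [h6]; abel
      rw [this]
      exact Submodule.sub_mem _ hv ⟨_, rfl⟩
    rw [h4, Submodule.mem_bot] at h7
    have h8 : LinearMap.funLeft ℚ ℚ (s⁻¹ * t).symm v = v := by
      have : LinearMap.funLeft ℚ ℚ (s⁻¹ * t).symm v - v = 0 := h7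
      exact sub_eq_zero.1 this
    rw [h6, h7, h8, add_zero]
  · rintro ⟨h1, h2⟩
    have hle := (absLength α).len_mul_le s (s⁻¹ * t)
    rw [hst] at hle
    apply le_antisymm _ hle
    change Module.finrank ℚ (moved s) + Module.finrank ℚ (moved (s⁻¹ * t)) ≤
      Module.finrank ℚ (moved t)
    -- dim A = rank(s - 1) + dim ker(t - 1), and A lies in ker(s⁻¹t - 1); hence rank(s⁻¹t - 1) ≤
    -- rank(t - 1) - rank(s - 1).
    set A := (moved s).comap (diff t) with hA
    have h3 : A ≤ LinearMap.ker (diff (s⁻¹ * t)) := by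
      intro v hv
      have h4 := h2 v hv
      rw [LinearMap.mem_ker]
      funext i
      have h5 := congrFun h4 (s i)
      simp only [diff_apply, symm_apply_apply] at h5
      change v (t.symm (s i)) - v i = 0
      linarith
    have h4 : LinearMap.ker (diff t) ≤ A := by
      intro v hv
      rw [LinearMap.mem_ker] at hv
      rw [hA, Submodule.mem_comap, hv]
      exact Submodule.zero_mem _
    have e1 := LinearMap.finrank_range_add_finrank_ker ((diff t).domRestrict A)
    have e2 := LinearMap.finrank_range_add_finrank_ker (diff t)
    have e3 := LinearMap.finrank_range_add_finrank_ker (diff (s⁻¹ * t))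
    have e4 := Submodule.finrank_mono h3
    have e5 : Module.finrank ℚ (LinearMap.ker ((diff t).domRestrict A)) =
        Module.finrank ℚ (LinearMap.ker (diff t)) :=
      (Submodule.comapSubtypeEquivOfLe h4).finrank_eq
    have e6 : moved s ≤ LinearMap.range ((diff t).domRestrict A) := by
      intro w hw
      obtain ⟨v, rfl⟩ := h1 hw
      exact ⟨⟨v, hw⟩, rfl⟩
    have e7 := Submodule.finrank_mono e6
    unfold moved at *
    omega

theorem single_sub_single_mem_moved {s : Perm α} {i j : α} (h : s.SameCycle i j) :
    (Pi.single j 1 - Pi.single i 1 : α → ℚ) ∈ moved s := by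
  obtain ⟨k, -, rfl⟩ := h.exists_pow_eq'
  induction k with
  | zero => simp
  | succ k ih =>
    rw [← sub_add_sub_cancel _ (Pi.single ((s ^ k) i) 1 : α → ℚ)]
    refine Submodule.add_mem _ ?_ (ih ?_)
    · rw [pow_succ', Perm.mul_apply, ← diff_single]
      exact ⟨_, rfl⟩
    · exact ⟨k, rfl⟩

theorem moved_le {s : Perm α} {W : Submodule ℚ (α → ℚ)}
    (h : ∀ i, (Pi.single (s i) 1 - Pi.single i 1 : α → ℚ) ∈ W) : moved s ≤ W := by
  rintro _ ⟨v, rfl⟩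
  rw [← (Pi.basisFun ℚ α).sum_repr v, map_sum]
  refine Submodule.sum_mem _ fun i _ => ?_
  rw [map_smul, Pi.basisFun_apply, diff_single]
  exact Submodule.smul_mem _ _ (h i)

omit [DecidableEq α] in
theorem sum_mul_eq_zero {s : Perm α} {χ w : α → ℚ} (hχ : ∀ i, χ (s i) = χ i) (hw : w ∈ moved s) :
    ∑ i, χ i * w i = 0 := by
  obtain ⟨v, rfl⟩ := hw
  simp only [diff_apply, mul_sub, Finset.sum_sub_distrib, sub_eq_zero]
  rw [← Equiv.sum_comp s]
  simp [hχ]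

/-- A vector in the moved space has sum zero over every cycle; the cycle of i is tested. -/
theorem sameCycle_of_mem_moved {s : Perm α} {i j : α}
    (h : (Pi.single j 1 - Pi.single i 1 : α → ℚ) ∈ moved s) : s.SameCycle i j := by
  classical
  have := sum_mul_eq_zero (χ := fun k => if s.SameCycle i k then 1 else 0) (by simp) h
  simp only [Pi.sub_apply, mul_sub, Finset.sum_sub_distrib, Pi.single_apply, mul_ite, mul_one,
    mul_zero, Finset.sum_ite_eq', Finset.mem_univ, if_true, Perm.SameCycle.refl] at this
  by_contra h'
  simp [h'] at this

theorem Le.sameCycle {s t : Perm α} (h : (absLength α).Le s t) {i j : α} (hij : s.SameCycle i j) :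
    t.SameCycle i j :=
  sameCycle_of_mem_moved ((le_iff.1 h).1 (single_sub_single_mem_moved hij))

/-- Below a common element, the absolute order is the refinement of cycle partitions. -/
theorem le_of_sameCycle {s t c : Perm α} (hs : (absLength α).Le s c) (ht : (absLength α).Le t c)
    (h : ∀ i, t.SameCycle i (s i)) : (absLength α).Le s t := by
  have h1 : moved s ≤ moved t := moved_le fun i => single_sub_single_mem_moved (h i)
  refine le_iff.2 ⟨h1, fun v hv => ?_⟩
  -- u is chosen with (c - 1)u = (t - 1)v. On u both s and t agree with c, so u - v is fixed by t.
  -- It is therefore constant on the cycles of t, hence fixed by s.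
  obtain ⟨u, hu⟩ := (le_iff.1 ht).1 (h1 hv)
  have h2 := (le_iff.1 hs).2 u (by rwa [hu])
  have h3 := (le_iff.1 ht).2 u (by rw [hu]; exact h1 hv)
  have h4 : diff t (u - v) = 0 := by rw [map_sub, h3, hu, sub_self]
  have h5 : ∀ i, (u - v) (t i) = (u - v) i := fun i => by
    have := congrFun h4 (t i)
    simp only [diff_apply, symm_apply_apply, Pi.zero_apply] at this
    linarith
  have h6 : ∀ i j, t.SameCycle i j → (u - v) j = (u - v) i := by
    intro i j hij
    obtain ⟨k, -, rfl⟩ := hij.exists_pow_eq'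
    clear hij
    induction k with
    | zero => rfl
    | succ k ih => rw [pow_succ', Perm.mul_apply, h5, ih]
  have h7 : diff s (u - v) = 0 := by
    funext i
    have := h6 _ _ (h (s.symm i))
    rw [apply_symm_apply] at this
    rw [diff_apply, ← this, sub_self, Pi.zero_apply]
  rw [map_sub, sub_eq_zero] at h7
  rw [← h7, h2, hu]

end Linear

/-! ### Divisors of the long cycle and noncrossing partitions -/

section Noncrossing

variable {n : ℕ}

theorem finRotate_val (x : Fin n) : (finRotate n x : ℕ) = if (x : ℕ) + 1 < n then (x : ℕ) + 1 else 0 := by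
  cases n with
  | zero => exact x.elim0
  | succ n =>
    split_ifs with h
    · exact coe_finRotate_of_ne_last (fun h' => by simp [h'] at h)
    · have : x = Fin.last n := Fin.ext (by simp; omega)
      rw [this, finRotate_last]
      rfl

/-- The divisors of the cycle `x ↦ x + 1`. -/
def NC (s : Perm (Fin n)) : Prop := (absLength (Fin n)).Le s (finRotate n)

/-- Shifting an interval by one changes its indicator only at the two ends. These explicit preimages
turn `le_iff` into statements about intervals. -/
theorem diff_finRotate_indicator {a b : Fin n} (hab : a < b) :
    diff (finRotate n) (fun k => if a ≤ k ∧ k < b then 1 else 0) =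
      Pi.single b 1 - Pi.single a 1 := by
  funext i
  obtain ⟨k, rfl⟩ := (finRotate n).surjective i
  have hk := finRotate_val k
  simp only [diff_apply, symm_apply_apply, Pi.sub_apply, Pi.single_apply, Fin.le_def,
    Fin.lt_def, Fin.ext_iff] at *
  rw [hk]
  have := k.2; have := b.2
  split_ifs <;> first | omega | norm_num

theorem moved_le_moved_finRotate (s : Perm (Fin n)) : moved s ≤ moved (finRotate n) := by
  have key : ∀ a b : Fin n, a < b →
      (Pi.single b 1 - Pi.single a 1 : Fin n → ℚ) ∈ moved (finRotate n) := fun a b hab =>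
    ⟨_, diff_finRotate_indicator hab⟩
  apply moved_le
  intro i
  rcases lt_trichotomy i (s i) with h | h | h
  · exact key _ _ h
  · rw [← h, sub_self]
    exact Submodule.zero_mem _
  · rw [← neg_sub]
    exact Submodule.neg_mem _ (key _ _ h)

/-- By `le_iff`, s moves the indicator of [a, b) exactly as the long cycle does. So s maps [a, b)
onto (a, b]. -/
theorem NC.mem_Ico_iff {s : Perm (Fin n)} (hs : NC s) {a b : Fin n} (hab : a < b)
    (h : s.SameCycle a b) (j : Fin n) : (a ≤ j ∧ j < b) ↔ (a < s j ∧ s j ≤ b) := by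
  have h1 := diff_finRotate_indicator hab
  have h2 := (le_iff.1 hs).2 (fun k => if a ≤ k ∧ k < b then 1 else 0)
    (by rw [h1]; exact single_sub_single_mem_moved h)
  rw [h1] at h2
  have h3 := congrFun h2 (s j)
  simp only [diff_apply, symm_apply_apply, Pi.sub_apply, Pi.single_apply] at h3
  generalize s j = k at *
  simp only [Fin.le_def, Fin.lt_def, Fin.ext_iff] at hab h3 ⊢
  split_ifs at h3 <;> first | omega | norm_num at h3

/-- The moved-space condition of `le_iff` is automatic for the long cycle, so only the agreement on
v is at stake, and it reads v(j) = v(c⁻¹ s j). The hypotheses make the interval between j and s j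
invariant under s; pairing (c - 1)v with its indicator and summing by parts leaves just this
equation. -/
theorem nc_of_forall {s : Perm (Fin n)} (h1 : ∀ j k, j < k → k < s j → j < s k ∧ s k < s j)
    (h2 : ∀ j k, s j ≤ k → k ≤ j → s j ≤ s k ∧ s k ≤ j) : NC s := by
  refine le_iff.2 ⟨moved_le_moved_finRotate s, fun v hv => ?_⟩
  -- s has finite order, so a predicate preserved forwards is also preserved backwards.
  have inv : ∀ p : Fin n → Prop, (∀ k, p k → p (s k)) → ∀ k, p (s k) ↔ p k := by
    classical
    intro p hp k
    refine ⟨fun h => ?_, hp k⟩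
    have h3 : ∀ m : ℕ, p ((s ^ m) (s k)) := by
      intro m
      induction m with
      | zero => exact h
      | succ m ih => rw [pow_succ', Perm.mul_apply]; exact hp _ ih
    have := h3 (orderOf s - 1)
    rwa [← Perm.mul_apply, ← pow_succ, Nat.sub_add_cancel (orderOf_pos s), pow_orderOf_eq_one,
      Perm.one_apply] at this
  have key : ∀ χ : Fin n → ℚ, (∀ k, χ (s k) = χ k) →
      ∑ k, (χ (finRotate n k) - χ k) * v k = 0 := by
    intro χ hχ
    have := sum_mul_eq_zero hχ hv
    simp only [diff_apply, mul_sub, Finset.sum_sub_distrib] at this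
    rw [← Equiv.sum_comp (finRotate n)] at this
    simp only [symm_apply_apply] at this
    simpa only [sub_mul, Finset.sum_sub_distrib] using this
  funext i
  obtain ⟨j, rfl⟩ := s.surjective i
  simp only [diff_apply, symm_apply_apply, sub_left_inj]
  obtain ⟨l, hl⟩ := (finRotate n).surjective (s j)
  rw [← hl, symm_apply_apply]
  have hlv := finRotate_val l
  rcases lt_or_ge j (s j) with hj | hj
  · have hinv := inv (fun k => j < k ∧ k < s j) (fun k hk => h1 j k hk.1 hk.2)
    have := key (fun k => if j < k ∧ k < s j then 1 else 0) (fun k => by simp only [hinv k])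
    have e : ∀ k, ((if j < finRotate n k ∧ finRotate n k < s j then 1 else 0) -
        (if j < k ∧ k < s j then 1 else 0) : ℚ) = (if k = j then 1 else 0) - (if k = l then 1 else 0) := by
      intro k
      have hk := finRotate_val k
      rw [← hl] at hj ⊢
      simp only [Fin.lt_def, Fin.ext_iff, hk, hlv] at hj ⊢
      have := k.2; have := l.2
      split_ifs at * <;> first | omega | norm_num
    simp only [e, sub_mul, ite_mul, one_mul, zero_mul, Finset.sum_sub_distrib,
      Finset.sum_ite_eq', Finset.mem_univ, if_true] at this
    linarith
  · have hinv := inv (fun k => s j ≤ k ∧ k ≤ j) (fun k hk => h2 j k hk.1 hk.2)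
    have := key (fun k => if s j ≤ k ∧ k ≤ j then 1 else 0) (fun k => by simp only [hinv k])
    have e : ∀ k, ((if s j ≤ finRotate n k ∧ finRotate n k ≤ j then 1 else 0) -
        (if s j ≤ k ∧ k ≤ j then 1 else 0) : ℚ) = (if k = l then 1 else 0) - (if k = j then 1 else 0) := by
      intro k
      have hk := finRotate_val k
      rw [← hl] at hj ⊢
      simp only [Fin.le_def, Fin.ext_iff, hk, hlv] at hj ⊢
      have := k.2; have := l.2; have := j.2
      split_ifs at * <;> first | omega | norm_num
    simp only [e, sub_mul, ite_mul, one_mul, zero_mul, Finset.sum_sub_distrib,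
      Finset.sum_ite_eq', Finset.mem_univ, if_true] at this
    linarith

/-- The cycles of a divisor of the long cycle do not cross. -/
theorem NC.sameCycle_of_crossing {s : Perm (Fin n)} (hs : NC s) {a x b y : Fin n} (h1 : a < x)
    (h2 : x < b) (h3 : b < y) (hab : s.SameCycle a b) (hxy : s.SameCycle x y) :
    s.SameCycle a x := by
  by_contra hax
  -- If the cycle of x misses that of a and b, it can never leave the open interval (a, b), and so
  -- never reaches y.
  have key : ∀ k : ℕ, a < (s ^ k) x ∧ (s ^ k) x < b := by
    intro k
    induction k with
    | zero => exact ⟨h1, h2⟩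
    | succ k ih =>
      rw [pow_succ', Perm.mul_apply]
      have := (hs.mem_Ico_iff (h1.trans h2) hab ((s ^ k) x)).1 ⟨ih.1.le, ih.2⟩
      refine ⟨this.1, lt_of_le_of_ne this.2 fun h => hax ?_⟩
      have h4 : s.SameCycle x b := ⟨(k + 1 : ℕ), by
        rw [zpow_natCast, pow_succ', Perm.mul_apply, h]⟩
      exact hab.trans h4.symm
  obtain ⟨k, -, hk⟩ := hxy.exists_pow_eq'
  have := (key k).2
  rw [hk] at this
  exact absurd (this.trans h3) (lt_irrefl _)

/-- `m` maps every element to the next element of its class, cyclically. -/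
def IsNext (E : Fin n → Fin n → Prop) (m : Perm (Fin n)) : Prop :=
  ∀ y, E y (m y) ∧ ((y < m y ∧ ∀ z, E y z → y < z → m y ≤ z) ∨ ∀ z, E y z → m y ≤ z ∧ z ≤ y)

/-- From a, repeated steps to the next larger element of the class reach any larger b in it. -/
theorem IsNext.sameCycle_iff {E : Fin n → Fin n → Prop} {m : Perm (Fin n)} (hE : Equivalence E)
    (h : IsNext E m) (a b : Fin n) : m.SameCycle a b ↔ E a b := by
  constructor
  · intro hab
    obtain ⟨k, -, rfl⟩ := hab.exists_pow_eq'
    clear hab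
    induction k with
    | zero => exact hE.refl _
    | succ k ih =>
      rw [pow_succ', Perm.mul_apply]
      exact hE.trans ih (h _).1
  · have key : ∀ d : ℕ, ∀ a b : Fin n, (b : ℕ) - a = d → a ≤ b → E a b → m.SameCycle a b := by
      intro d
      induction d using Nat.strong_induction_on with
      | _ d ih =>
        intro a b hd hab hE'
        rcases eq_or_lt_of_le hab with rfl | hlt
        · exact Perm.SameCycle.refl _ _
        · obtain ⟨h1, ⟨h2, h3⟩ | h2⟩ := h a
          · have h4 := h3 b hE' hlt
            have : m.SameCycle (m a) b :=
              ih ((b : ℕ) - m a) (by simp only [Fin.lt_def, Fin.le_def] at *; omega) _ _ rfl h4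
                (hE.trans (hE.symm h1) hE')
            exact Perm.SameCycle.trans (Perm.sameCycle_apply_right.2 (Perm.SameCycle.refl _ _)) this
          · exact absurd (h2 b hE').2 (not_le.2 hlt)
    intro hE'
    rcases le_total a b with hab | hab
    · exact key _ a b rfl hab hE'
    · exact (key _ b a rfl hab (hE.symm hE')).symm

/-- An element of another class that left the interval between j and m j would make the two classes
cross. Each way of leaving contradicts one instance of the noncrossing hypothesis. -/
theorem IsNext.nc {E : Fin n → Fin n → Prop} {m : Perm (Fin n)} (hE : Equivalence E)
    (h : IsNext E m) (hnc : ∀ {a x b y}, a < x → x < b → b < y → E a b → E x y → E a x) :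
    NC m := by
  apply nc_of_forall
  · intro j k h1 h2
    obtain ⟨hj, ⟨-, hj'⟩ | hj'⟩ := h j
    swap
    · exact absurd (h2.trans_le (hj' _ (hE.refl j)).1) (lt_asymm h1)
    have hjk : ¬ E j k := fun h' => absurd (hj' k h' h1) (not_le.2 h2)
    obtain ⟨hk, -⟩ := h k
    have hne1 : m k ≠ m j := fun h' => h1.ne' (m.injective h')
    have hne2 : m k ≠ j := fun h' => hjk (hE.symm (h' ▸ hk))
    constructor
    · by_contra h3
      have h3 : m k < j := lt_of_le_of_ne (not_lt.1 h3) hne2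
      exact hjk (hE.trans (hE.symm (hnc h3 h1 h2 (hE.symm hk) hj)) (hE.symm hk))
    · by_contra h3
      have h3 : m j < m k := lt_of_le_of_ne (not_lt.1 h3) hne1.symm
      exact hjk (hnc h1 h2 h3 hj hk)
  · intro j k h1 h2
    obtain ⟨hk, hk'⟩ := h k
    obtain ⟨hj, ⟨hj', -⟩ | hj'⟩ := h j
    · exact absurd (hj'.trans_le (h1.trans h2)) (lt_irrefl _)
    by_cases hjk : E j k
    · exact hj' _ (hE.trans hjk hk)
    have hne1 : m j ≠ k := fun h' => hjk (h' ▸ hj)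
    have hne2 : k ≠ j := fun h' => hjk (h' ▸ hE.refl _)
    have h1 := lt_of_le_of_ne h1 hne1
    have h2 := lt_of_le_of_ne h2 hne2
    have hjk' : ¬ E (m j) k := fun h' => hjk (hE.trans hj h')
    constructor
    · by_contra h3
      exact hjk' (hE.trans (hE.symm (hnc (not_le.1 h3) h1 h2 (hE.symm hk) (hE.symm hj)))
        (hE.symm hk))
    · by_contra h3
      exact hjk' (hnc h1 h2 (not_le.1 h3) (hE.symm hj) hk)

end Noncrossing

end AbsoluteOrder

namespace AbsoluteOrder

open Equiv

/-! ### Meets of noncrossing permutations -/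

section Meet

variable {n : ℕ}

open Classical in
/-- The largest smaller element of the class of `x`, or `x` itself. -/
noncomputable def prevInClass (E : Fin n → Fin n → Prop) (x : Fin n) : Fin n :=
  if h : (Finset.univ.filter fun y => y < x ∧ E y x).Nonempty then Finset.max' _ h else x

theorem prevInClass_spec (E : Fin n → Fin n → Prop) (x : Fin n) :
    (prevInClass E x = x ∧ ∀ y, y < x → ¬ E y x) ∨
    (prevInClass E x < x ∧ E (prevInClass E x) x ∧ ∀ z, z < x → E z x → z ≤ prevInClass E x) := by
  classical
  unfold prevInClass
  split_ifs with h
  · right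
    have h1 := Finset.max'_mem _ h
    simp only [Finset.mem_filter, Finset.mem_univ, true_and] at h1
    exact ⟨h1.1, h1.2, fun z hz hz' => Finset.le_max' _ _ (by simp [hz, hz'])⟩
  · left
    refine ⟨rfl, fun y hy hy' => h ⟨y, by simp [hy, hy']⟩⟩

/-- The permutation that maps every element below `k` to the next element below `k` of its class,
cyclically. -/
noncomputable def classPermAux (E : Fin n → Fin n → Prop) : ℕ → Perm (Fin n)
  | 0 => 1
  | k + 1 => if h : k < n then classPermAux E k * swap (prevInClass E ⟨k, h⟩) ⟨k, h⟩
      else classPermAux E k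

/-- The permutation that maps every element to the next element of its class, cyclically. -/
noncomputable def classPerm (E : Fin n → Fin n → Prop) : Perm (Fin n) := classPermAux E n

/-- Let p be the last element below k in the class of k; it points to the least element of the
class. Right multiplication by the transposition of p and k inserts k between the two. This is also
the update made by the loop of `Prog.meet`. -/
theorem classPermAux_spec {E : Fin n → Fin n → Prop} (hE : Equivalence E) (k : ℕ) (hk : k ≤ n) :
    (∀ y : Fin n, k ≤ y → classPermAux E k y = y) ∧
    ∀ y : Fin n, (y : ℕ) < k → (classPermAux E k y : ℕ) < k ∧ E y (classPermAux E k y) ∧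
      ((y < classPermAux E k y ∧ ∀ z : Fin n, (z : ℕ) < k → E y z → y < z → classPermAux E k y ≤ z) ∨
        ∀ z : Fin n, (z : ℕ) < k → E y z → classPermAux E k y ≤ z ∧ z ≤ y) := by
  induction k with
  | zero => exact ⟨fun y _ => rfl, fun y hy => by omega⟩
  | succ k ih =>
    have hkn : k < n := by omega
    obtain ⟨ih1, ih2⟩ := ih (by omega)
    rw [classPermAux, dif_pos hkn]
    set m := classPermAux E k
    set x : Fin n := ⟨k, hkn⟩ with hx
    have hxv : (x : ℕ) = k := rfl
    have hlt : ∀ z : Fin n, (z : ℕ) < k + 1 → z < x ∨ z = x := by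
      intro z hz
      rcases Nat.lt_succ_iff_lt_or_eq.1 hz with h | h
      · exact Or.inl h
      · exact Or.inr (Fin.ext h)
    rcases prevInClass_spec E x with ⟨h1, h2⟩ | ⟨h1, h2, h3⟩
    · rw [h1, swap_self]
      change (∀ y : Fin n, k + 1 ≤ y → m y = y) ∧ ∀ y : Fin n, (y : ℕ) < k + 1 →
        (m y : ℕ) < k + 1 ∧ E y (m y) ∧ _
      refine ⟨fun y hy => ih1 y (by omega), fun y hy => ?_⟩
      rcases hlt y hy with hy | rfl
      · obtain ⟨i1, i2, i3⟩ := ih2 y hy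
        refine ⟨by omega, i2, i3.imp (fun i3 => ⟨i3.1, fun z hz hz' => ?_⟩) fun i3 z hz hz' => ?_⟩
        · rcases hlt z hz with hz | rfl
          · exact i3.2 z hz hz'
          · exact absurd hz' (h2 y hy)
        · rcases hlt z hz with hz | rfl
          · exact i3 z hz hz'
          · exact absurd hz' (h2 y hy)
      · have := ih1 x le_rfl
        change (m x : ℕ) < k + 1 ∧ E x (m x) ∧ ((x < m x ∧ _) ∨
          ∀ z : Fin n, (z : ℕ) < k + 1 → E x z → m x ≤ z ∧ z ≤ x)
        rw [this]
        refine ⟨by omega, hE.refl _, Or.inr fun z hz hz' => ?_⟩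
        rcases hlt z hz with hz | rfl
        · exact absurd (hE.symm hz') (h2 z hz)
        · exact ⟨_root_.le_refl _, _root_.le_refl _⟩
    · set p := prevInClass E x
      obtain ⟨p1, p2, p3⟩ := ih2 p h1
      have hp : ∀ z : Fin n, (z : ℕ) < k → E p z → m p ≤ z ∧ z ≤ p := by
        rcases p3 with ⟨p3, -⟩ | p3
        · exact absurd (h3 (m p) p1 (hE.trans (hE.symm p2) h2)) (not_le.2 p3)
        · exact p3
      refine ⟨fun y hy => ?_, fun y hy => ?_⟩
      · rw [Perm.mul_apply, swap_apply_of_ne_of_ne, ih1 y (by omega)]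
        · rintro rfl
          simp only [Fin.lt_def] at h1
          omega
        · rintro rfl
          omega
      · rw [Perm.mul_apply]
        rcases hlt y hy with hy | rfl
        · by_cases hyp : y = p
          · subst hyp
            rw [swap_apply_left, ih1 x le_rfl]
            refine ⟨by omega, h2, Or.inl ⟨h1, fun z hz hz' hz'' => ?_⟩⟩
            rcases hlt z hz with hz | rfl
            · exact absurd (hp z hz hz').2 (not_le.2 hz'')
            · exact _root_.le_refl _
          · rw [swap_apply_of_ne_of_ne hyp hy.ne]
            obtain ⟨i1, i2, i3⟩ := ih2 y hy
            refine ⟨by omega, i2, i3.imp (fun i3 => ⟨i3.1, fun z hz hz' => ?_⟩) fun i3 z hz hz' => ?_⟩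
            · rcases hlt z hz with hz | rfl
              · exact i3.2 z hz hz'
              · exact fun _ => Fin.le_def.2 (by omega)
            · rcases hlt z hz with hz | rfl
              · exact i3 z hz hz'
              · exact absurd (le_antisymm (h3 y hy hz') (i3 p h1 (hE.trans hz' (hE.symm h2))).2) hyp
        · rw [swap_apply_right]
          refine ⟨by omega, hE.trans (hE.symm h2) p2, Or.inr fun z hz hz' => ?_⟩
          rcases hlt z hz with hz | rfl
          · exact ⟨(hp z hz (hE.trans h2 hz')).1, hz.le⟩
          · exact ⟨((hp p h1 (hE.refl _)).1.trans h1.le), _root_.le_refl _⟩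

theorem isNext_classPerm {E : Fin n → Fin n → Prop} (hE : Equivalence E) :
    IsNext E (classPerm E) := by
  intro y
  obtain ⟨-, h⟩ := classPermAux_spec hE n le_rfl
  obtain ⟨-, h1, h2⟩ := h y y.2
  exact ⟨h1, h2.imp (fun h => ⟨h.1, fun z => h.2 z z.2⟩) fun h z => h z z.2⟩

/-- The intersection of two cycle partitions. -/
def BothCycle (s t : Perm (Fin n)) (x y : Fin n) : Prop := s.SameCycle x y ∧ t.SameCycle x y

theorem equivalence_bothCycle (s t : Perm (Fin n)) : Equivalence (BothCycle s t) where
  refl _ := ⟨Perm.SameCycle.refl _ _, Perm.SameCycle.refl _ _⟩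
  symm h := ⟨h.1.symm, h.2.symm⟩
  trans h h' := ⟨h.1.trans h'.1, h.2.trans h'.2⟩

/-- A crossing of classes of the intersection is a crossing for s and for t, and each of them
forbids it unless the classes coincide. -/
theorem nc_classPerm {s t : Perm (Fin n)} (hs : NC s) (ht : NC t) :
    NC (classPerm (BothCycle s t)) :=
  (isNext_classPerm (equivalence_bothCycle s t)).nc (equivalence_bothCycle s t)
    fun h1 h2 h3 h4 h5 => ⟨hs.sameCycle_of_crossing h1 h2 h3 h4.1 h5.1,
      ht.sameCycle_of_crossing h1 h2 h3 h4.2 h5.2⟩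

/-- The Garside germ of noncrossing partitions. -/
noncomputable def germ (n : ℕ) : GarsideGerm (Perm (Fin n)) where
  toLengthFunction := absLength (Fin n)
  c := finRotate n
  meet s t := classPerm (BothCycle s t)
  meet_le_left {s t} hs ht := le_of_sameCycle (nc_classPerm hs ht) hs fun i =>
    (isNext_classPerm (equivalence_bothCycle s t) i).1.1
  meet_le_right {s t} hs ht := le_of_sameCycle (nc_classPerm hs ht) ht fun i =>
    (isNext_classPerm (equivalence_bothCycle s t) i).1.2
  le_meet {s t x} hs ht h1 h2 := le_of_sameCycle (h1.trans hs) (nc_classPerm hs ht) fun i => by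
    rw [(isNext_classPerm (equivalence_bothCycle s t)).sameCycle_iff (equivalence_bothCycle s t)]
    have : x.SameCycle i (x i) := Perm.sameCycle_apply_right.2 (Perm.SameCycle.refl _ _)
    exact ⟨Le.sameCycle h1 this, Le.sameCycle h2 this⟩

end Meet

/-! ### Noncrossing products of one or two transpositions -/

section Transpositions

variable {n : ℕ}

theorem nc_swap {x y : Fin n} (hxy : x < y) : NC (swap x y) := by
  have h : ∀ j, swap x y j = if j = x then y else if j = y then x else j :=
    fun j => swap_apply_def x y j
  apply nc_of_forall <;> intro j k h1 h2 <;> simp only [h] at h1 h2 ⊢ <;> clear h <;>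
    split_ifs at * <;> simp only [Fin.lt_def, Fin.le_def, Fin.ext_iff] at * <;> try omega

theorem swap_sameCycle {s : Perm (Fin n)} {x y : Fin n} (h : s.SameCycle x y) (i : Fin n) :
    s.SameCycle i (swap x y i) := by
  rcases eq_or_ne i x with rfl | h1
  · rwa [swap_apply_left]
  rcases eq_or_ne i y with rfl | h2
  · rw [swap_apply_right]
    exact h.symm
  rw [swap_apply_of_ne_of_ne h1 h2]

theorem swap_le {s : Perm (Fin n)} (hs : NC s) {x y : Fin n} (hxy : x < y) (h : s.SameCycle x y) :
    (absLength (Fin n)).Le (swap x y) s :=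
  le_of_sameCycle (nc_swap hxy) hs (swap_sameCycle h)

theorem swap_mul_swap_le {s : Perm (Fin n)} (hs : NC s) {x y z w : Fin n} (hxy : s.SameCycle x y)
    (hzw : s.SameCycle z w) (h : NC (swap x y * swap z w)) :
    (absLength (Fin n)).Le (swap x y * swap z w) s :=
  le_of_sameCycle h hs fun i => (swap_sameCycle hzw i).trans (swap_sameCycle hxy _)

theorem sameCycle_swap (x y : Fin n) : (swap x y).SameCycle x y :=
  ⟨1, by simp⟩

/-- This and the next two products are the divisors of rank two: an increasing 3-cycle, and two
nested or two separated transpositions. Both sides of each dual relation factor one of them. -/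
theorem nc_three_cycle {x y z : Fin n} (hxy : x < y) (hyz : y < z) :
    NC (swap x y * swap y z) := by
  have h : ∀ j, (swap x y * swap y z) j = if j = x then y else if j = y then z else
      if j = z then x else j := by
    intro j
    simp only [Perm.mul_apply, swap_apply_def]
    grind
  apply nc_of_forall <;> intro j k h1 h2 <;> simp only [h] at h1 h2 ⊢ <;> clear h <;>
    split_ifs at * <;> simp only [Fin.lt_def, Fin.le_def, Fin.ext_iff] at * <;> try omega

theorem nc_swap_mul_swap_nested {x y z w : Fin n} (hxy : x < y) (hyz : y < z) (hzw : z < w) :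
    NC (swap x w * swap y z) := by
  have h : ∀ j, (swap x w * swap y z) j = if j = x then w else if j = y then z else
      if j = z then y else if j = w then x else j := by
    intro j
    simp only [Perm.mul_apply, swap_apply_def]
    grind
  apply nc_of_forall <;> intro j k h1 h2 <;> simp only [h] at h1 h2 ⊢ <;> clear h <;>
    split_ifs at * <;> simp only [Fin.lt_def, Fin.le_def, Fin.ext_iff] at * <;> try omega

theorem nc_swap_mul_swap_separated {x y z w : Fin n} (hxy : x < y) (hyz : y < z) (hzw : z < w) :
    NC (swap x y * swap z w) := by
  have h : ∀ j, (swap x y * swap z w) j = if j = x then y else if j = y then x else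
      if j = z then w else if j = w then z else j := by
    intro j
    simp only [Perm.mul_apply, swap_apply_def]
    grind
  apply nc_of_forall <;> intro j k h1 h2 <;> simp only [h] at h1 h2 ⊢ <;> clear h <;>
    split_ifs at * <;> simp only [Fin.lt_def, Fin.le_def, Fin.ext_iff] at * <;> try omega

end Transpositions

end AbsoluteOrder

/-! ## The relations between band generators -/

section BandRelations

variable {G : Type*} [Group G]

/-- The band element `(σ_{t-1} ⋯ σ_{s+1}) σ_s (σ_{t-1} ⋯ σ_{s+1})⁻¹` with `t = s + k + 1`. -/
def bandElem (σ : ℕ → G) (s : ℕ) : ℕ → G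
  | 0 => σ s
  | k + 1 => σ (s + (k + 1)) * bandElem σ s k * (σ (s + (k + 1)))⁻¹

/-- The band element with subscripts `t > s`. -/
def band (σ : ℕ → G) (s t : ℕ) : G := bandElem σ s (t - s - 1)

/-- The braid relations for `σ_1, …, σ_{n-1}`. -/
structure BraidRelations (n : ℕ) (σ : ℕ → G) : Prop where
  comm : ∀ i j, i + 1 < j → Commute (σ i) (σ j)
  braid : ∀ i, 1 ≤ i → i + 1 < n → σ i * σ (i + 1) * σ i = σ (i + 1) * σ i * σ (i + 1)

variable {n : ℕ} {σ : ℕ → G}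

theorem band_self_succ (s : ℕ) : band σ s (s + 1) = σ s := by
  simp [band, bandElem]

theorem band_succ {s t : ℕ} (h : s < t) : band σ s (t + 1) = MulAut.conj (σ t) (band σ s t) := by
  have e1 : t + 1 - s - 1 = (t - s - 1) + 1 := by omega
  have e2 : s + (t - s - 1 + 1) = t := by omega
  rw [band, e1, bandElem, e2, MulAut.conj_apply, band]

theorem conj_eq_of_commute {g h : G} (c : Commute g h) : MulAut.conj g h = h := by
  rw [MulAut.conj_apply, c.eq, mul_inv_cancel_right]

theorem BraidRelations.commute_band (H : BraidRelations n σ) {i s t : ℕ} (hst : s < t)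
    (h : i + 1 < s ∨ t < i) : Commute (σ i) (band σ s t) := by
  induction t, hst using Nat.le_induction with
  | base =>
    rw [band_self_succ]
    rcases h with h | h
    · exact H.comm _ _ h
    · exact (H.comm _ _ h).symm
  | succ t hst ih =>
    have h1 : Commute (σ i) (σ t) := by
      rcases h with h | h
      · exact H.comm _ _ (by omega)
      · exact (H.comm _ _ (by omega)).symm
    rw [band_succ hst, MulAut.conj_apply]
    exact (h1.mul_right (ih (by omega))).mul_right h1.inv_right

/-- The case t = i + 2 is a direct computation from one braid relation, because σ_{i+1} commutes
with the band ending at i. Every later conjugation is by a generator that commutes with σ_i. -/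
theorem BraidRelations.commute_band_of_lt (H : BraidRelations n σ) {i s t : ℕ} (hs : 1 ≤ s)
    (hsi : s < i) (hit : i + 1 < t) (ht : t ≤ n) : Commute (σ i) (band σ s t) := by
  induction t, hit using Nat.le_induction with
  | base =>
    rw [band_succ (by omega), band_succ hsi]
    have hX := H.commute_band (i := i + 1) hsi (Or.inr (by omega))
    have hb := H.braid i (by omega) (by omega)
    simp only [MulAut.conj_apply]
    set X := band σ s i
    set a := σ i
    set b := σ (i + 1)
    have e3 : a⁻¹ * b⁻¹ * a = b * a⁻¹ * b⁻¹ := by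
      rw [← mul_left_cancel_iff (a := b * a), ← mul_right_cancel_iff (a := b * a)]
      have : b * a * (a⁻¹ * b⁻¹ * a) * (b * a) = a * b * a := by group
      rw [this, hb]
      group
    calc a * (b * (a * X * a⁻¹) * b⁻¹) = a * b * a * X * a⁻¹ * b⁻¹ := by group
      _ = b * a * (b * X) * a⁻¹ * b⁻¹ := by rw [hb]; group
      _ = b * a * X * (b * a⁻¹ * b⁻¹) := by rw [hX.eq]; group
      _ = _ := by rw [← e3]; group
  | succ t hit ih =>
    have h1 : Commute (σ i) (σ t) := H.comm _ _ (by omega)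
    rw [band_succ (by omega), MulAut.conj_apply]
    exact (h1.mul_right (ih (by omega))).mul_right h1.inv_right

theorem BraidRelations.band_left (H : BraidRelations n σ) {s t : ℕ} (hs : 1 ≤ s)
    (hst : s + 1 < t) (ht : t ≤ n) : σ s * band σ s t = band σ (s + 1) t * σ s := by
  induction t, hst using Nat.le_induction with
  | base =>
    rw [band_succ (by omega), band_self_succ, band_self_succ, MulAut.conj_apply]
    have := H.braid s hs (by omega)
    rw [← mul_left_inj (σ (s + 1)), ← this]
    group at this ⊢
  | succ t hst ih =>
    have h1 : Commute (σ s) (σ t) := H.comm _ _ (by omega)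
    rw [band_succ (by omega), band_succ (by omega)]
    have := congrArg (MulAut.conj (σ t)) (ih (by omega))
    rwa [map_mul, map_mul, conj_eq_of_commute h1.symm] at this

/-- Conjugation by σ_s⁻¹ lowers the subscript s + 1 of the band to s and fixes σ_t, so the braid
relation for neighbouring generators propagates. -/
theorem BraidRelations.braid_band (H : BraidRelations n σ) {s t : ℕ} (hs : 1 ≤ s)
    (hst : s < t) (ht : t < n) :
    band σ s t * σ t * band σ s t = σ t * band σ s t * σ t := by
  obtain ⟨k, rfl⟩ : ∃ k, t = s + 1 + k := ⟨t - (s + 1), by omega⟩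
  clear hst
  induction k generalizing s with
  | zero =>
    rw [add_zero, band_self_succ]
    exact H.braid s hs (by omega)
  | succ k ih =>
    have h1 := ih (s := s + 1) (by omega) (by omega)
    have e : s + 1 + (k + 1) = s + 1 + 1 + k := by omega
    rw [e]
    have h2 := H.band_left (t := s + 1 + 1 + k) hs (by omega) (by omega)
    have h3 : Commute (σ s) (σ (s + 1 + 1 + k)) := H.comm _ _ (by omega)
    have h4 : band σ s (s + 1 + 1 + k) =
        MulAut.conj (σ s)⁻¹ (band σ (s + 1) (s + 1 + 1 + k)) := by
      rw [MulAut.conj_apply, inv_inv, mul_assoc, ← h2, inv_mul_cancel_left]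
    have := congrArg (MulAut.conj (σ s)⁻¹) h1
    simpa only [map_mul, ← h4, conj_eq_of_commute h3.inv_left] using this

/-- The Birman–Ko–Lee relations for three strings. The first case is the definition together with
`braid_band`; conjugation by σ_t raises the top subscript t and leaves the lower band alone. -/
theorem BraidRelations.band_mul_band (H : BraidRelations n σ) {r s t : ℕ} (hr : 1 ≤ r)
    (hrs : r < s) (hst : s < t) (ht : t ≤ n) :
    band σ s t * band σ r s = band σ r t * band σ s t ∧
      band σ s t * band σ r s = band σ r s * band σ r t := by
  induction t, hst using Nat.le_induction with
  | base =>
    have := H.braid_band hr hrs (by omega)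
    rw [band_self_succ, band_succ hrs, MulAut.conj_apply]
    refine ⟨by group, ?_⟩
    rw [← mul_left_inj (σ s), ← this]
    group
  | succ t hst ih =>
    obtain ⟨h1, h2⟩ := ih (by omega)
    have h3 := conj_eq_of_commute (H.commute_band (i := t) hrs (Or.inr (by omega)))
    have h1 := congrArg (MulAut.conj (σ t)) h1
    have h2 := congrArg (MulAut.conj (σ t)) h2
    rw [map_mul, map_mul, h3] at h1 h2
    rw [band_succ hst, band_succ (by omega)]
    exact ⟨h1, h2⟩

theorem commute_band_of_forall {g : G} {s t : ℕ} (hst : s < t)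
    (h : ∀ i, s ≤ i → i < t → Commute g (σ i)) : Commute g (band σ s t) := by
  induction t, hst using Nat.le_induction with
  | base =>
    rw [band_self_succ]
    exact h s le_rfl (by omega)
  | succ t hst ih =>
    have h1 := h t (by omega) (by omega)
    rw [band_succ hst, MulAut.conj_apply]
    exact (h1.mul_right (ih fun i h2 h3 => h i h2 (by omega))).mul_right h1.inv_right

theorem BraidRelations.commute_separated (H : BraidRelations n σ) {r s t u : ℕ}
    (hrs : r < s) (hst : s < t) (htu : t < u) : Commute (band σ r s) (band σ t u) :=
  commute_band_of_forall htu fun _ h1 _ => (H.commute_band hrs (Or.inr (by omega))).symm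

theorem BraidRelations.commute_nested (H : BraidRelations n σ) {r s t u : ℕ} (hr : 1 ≤ r)
    (hrs : r < s) (hst : s < t) (htu : t < u) (hu : u ≤ n) :
    Commute (band σ r u) (band σ s t) :=
  commute_band_of_forall hst fun _ h1 h2 =>
    (H.commute_band_of_lt hr (by omega) (by omega) hu).symm

end BandRelations

/-- The relations between the band generators, in terms of `a x y` for `x < y`. -/
structure DualRelations {G : Type*} [Group G] {n : ℕ} (a : Fin n → Fin n → G) : Prop where
  left : ∀ {x y z}, x < y → y < z → a x y * a y z = a x z * a x y
  right : ∀ {x y z}, x < y → y < z → a x y * a y z = a y z * a x z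
  separated : ∀ {x y z w}, x < y → y < z → z < w → Commute (a x y) (a z w)
  nested : ∀ {x y z w}, x < y → y < z → z < w → Commute (a x w) (a y z)

/-! ### Band generators of the braid group satisfy the dual relations -/

section BraidGroup

variable {n : ℕ}

/-- The Artin generators, extended by `1`. -/
def artin (n i : ℕ) : BraidGroup n := if h : 1 ≤ i ∧ i < n then artinGen ⟨i, h.1, h.2⟩ else 1

theorem artinGen_relation {t s : ArtinIndex n} :
    (1 < |(t.i : ℤ) - s.i| → artinGen t * artinGen s = artinGen s * artinGen t) ∧
    (|(t.i : ℤ) - s.i| = 1 →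
      artinGen t * artinGen s * artinGen t = artinGen s * artinGen t * artinGen s) := by
  constructor
  · intro h
    have := PresentedGroup.mk_eq_one_iff.2 (Subgroup.subset_normalClosure
      (show _ ∈ artinRelators n from ⟨t, s, Or.inl ⟨h, rfl⟩⟩))
    rw [map_mul, map_inv, mul_inv_eq_one] at this
    exact this
  · intro h
    have := PresentedGroup.mk_eq_one_iff.2 (Subgroup.subset_normalClosure
      (show _ ∈ artinRelators n from ⟨t, s, Or.inr ⟨h, rfl⟩⟩))
    rw [map_mul, map_inv, mul_inv_eq_one] at this
    exact this

theorem braidRelations_artin (n : ℕ) : BraidRelations n (artin n) where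
  comm i j hij := by
    unfold artin
    split_ifs with h1 h2
    · refine artinGen_relation.1 ?_
      rw [lt_abs]
      right
      push_cast
      omega
    · exact Commute.one_right _
    · exact Commute.one_left _
    · exact Commute.one_left _
  braid i h1 h2 := by
    rw [artin, artin, dif_pos ⟨h1, by omega⟩, dif_pos ⟨by omega, h2⟩]
    refine artinGen_relation.2 ?_
    push_cast
    simp

theorem bandAux_eq (s : ℕ) (hs : 1 ≤ s) (k : ℕ) (h : s + k < n) :
    bandAux n s hs k h = bandElem (artin n) s k := by
  induction k with
  | zero => simp only [bandAux, bandElem, artin]; rw [dif_pos ⟨hs, h⟩]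
  | succ k ih =>
    simp only [bandAux, bandElem, artin]
    rw [dif_pos ⟨by omega, h⟩, ih]

theorem bandGen_eq (a : BandIndex n) : bandGen a = band (artin n) a.s a.t := bandAux_eq _ _ _ _

/-- The band generator with subscripts `n - x > n - y`. -/
def finBand (n : ℕ) (x y : Fin n) : BraidGroup n := band (artin n) (n - y) (n - x)

/-- The reversal x ↦ n - x fits the orientations together: a_{ts} a_{sr} with t > s > r corresponds
to a product of transpositions that is an increasing 3-cycle, hence a divisor of x ↦ x + 1. -/
theorem dualRelations_finBand (n : ℕ) : DualRelations (finBand n) where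
  left {x y z} h1 h2 := ((braidRelations_artin n).band_mul_band (by omega) (by omega) (by omega)
    (by omega)).1
  right {x y z} h1 h2 := ((braidRelations_artin n).band_mul_band (by omega) (by omega) (by omega)
    (by omega)).2
  separated {x y z w} h1 h2 h3 := ((braidRelations_artin n).commute_separated (by omega)
    (by omega) (by omega)).symm
  nested {x y z w} h1 h2 h3 := (braidRelations_artin n).commute_nested (by omega) (by omega)
    (by omega) (by omega) (by omega)

end BraidGroup

/-! ### From noncrossing permutations to groups with the dual relations -/

namespace AbsoluteOrder

open Equiv

variable {n : ℕ} {G : Type*} [Group G]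

theorem support_nonempty {s : Perm (Fin n)} (h : s ≠ 1) : s.support.Nonempty := by
  rwa [Finset.nonempty_iff_ne_empty, Ne, Perm.support_eq_empty_iff]

/-- The least element moved by a permutation. -/
noncomputable def firstMoved (s : Perm (Fin n)) (h : s ≠ 1) : Fin n :=
  s.support.min' (support_nonempty h)

theorem apply_firstMoved_ne (s : Perm (Fin n)) (h : s ≠ 1) : s (firstMoved s h) ≠ firstMoved s h :=
  Perm.mem_support.1 (Finset.min'_mem _ _)

theorem firstMoved_le (s : Perm (Fin n)) (h : s ≠ 1) {x : Fin n} (hx : s x ≠ x) :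
    firstMoved s h ≤ x :=
  Finset.min'_le _ _ (Perm.mem_support.2 hx)

theorem firstMoved_lt (s : Perm (Fin n)) (h : s ≠ 1) : firstMoved s h < s (firstMoved s h) := by
  have h1 := apply_firstMoved_ne s h
  exact lt_of_le_of_ne (firstMoved_le s h fun h2 => h1 (s.injective h2)) h1.symm

/-- The element of `G` assigned to a noncrossing permutation by writing it as a product of
transpositions. -/
noncomputable def lift (a : Fin n → Fin n → G) (s : Perm (Fin n)) : G :=
  if h : s = 1 then 1
  else a (firstMoved s h) (s (firstMoved s h)) *
    lift a (swap (firstMoved s h) (s (firstMoved s h)) * s)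
termination_by s.support.card
decreasing_by exact Perm.card_support_swap_mul (apply_firstMoved_ne s h)

theorem lift_one (a : Fin n → Fin n → G) : lift a 1 = 1 := by
  rw [lift, dif_pos rfl]

theorem lift_of_ne_one (a : Fin n → Fin n → G) {s : Perm (Fin n)} (h : s ≠ 1) :
    lift a s = a (firstMoved s h) (s (firstMoved s h)) *
      lift a (swap (firstMoved s h) (s (firstMoved s h)) * s) := by
  rw [lift, dif_neg h]

section

variable {s : Perm (Fin n)} {x y z w : Fin n}

theorem NC.swap_mul (hs : NC s) (hxy : x < y) (h : s.SameCycle x y) : NC (swap x y * s) := by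
  have := (swap_le hs hxy h).inv_mul_le.trans hs
  rwa [swap_inv] at this

theorem NC.len_swap_mul_lt (hs : NC s) (hxy : x < y) (h : s.SameCycle x y) :
    (absLength (Fin n)).len (swap x y * s) < (absLength (Fin n)).len s := by
  have h1 := swap_le hs hxy h
  have h2 : (absLength (Fin n)).len (swap x y) ≠ 0 := by
    rw [Ne, (absLength (Fin n)).len_eq_zero]
    intro h3
    have := Perm.ext_iff.1 h3 x
    rw [swap_apply_left, Perm.one_apply] at this
    exact hxy.ne this.symm
  unfold LengthFunction.Le at h1
  rw [swap_inv] at h1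
  omega

/-- The product of the two transpositions divides s. After the first one has been cancelled, the
second still divides what is left. -/
theorem NC.sameCycle_swap_mul (hs : NC s) (hxy : x < y) (h : s.SameCycle x y)
    (hzw : s.SameCycle z w) (hnc : NC (swap x y * swap z w))
    (h' : (swap x y * swap z w).SameCycle x y) : (swap x y * s).SameCycle z w := by
  have h1 := (swap_le hnc hxy h').inv_mul_le_inv_mul (swap_mul_swap_le hs h hzw hnc)
  rw [swap_inv, swap_mul_self_mul] at h1
  exact Le.sameCycle h1 (sameCycle_swap z w)

end

/-- The exchange step in the proof of `lift_eq`. -/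
theorem lift_exchange {a : Fin n → Fin n → G} {s : Perm (Fin n)} (hs : NC s)
    {p q z w x y z' w' : Fin n} (hpq : p < q) (hzw : z < w) (hxy : x < y) (hzw' : z' < w')
    (spq : s.SameCycle p q) (szw : s.SameCycle z w) (sxy : s.SameCycle x y)
    (szw' : s.SameCycle z' w') (e : swap p q * swap z w = swap x y * swap z' w')
    (hnc : NC (swap p q * swap z w)) (cpq : (swap p q * swap z w).SameCycle p q)
    (cxy : (swap p q * swap z w).SameCycle x y) (ea : a p q * a z w = a x y * a z' w')
    (h0 : lift a s = a p q * lift a (swap p q * s))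
    (ih : ∀ t : Perm (Fin n), (absLength (Fin n)).len t < (absLength (Fin n)).len s → NC t →
      ∀ x y, x < y → t.SameCycle x y → lift a t = a x y * lift a (swap x y * t)) :
    lift a s = a x y * lift a (swap x y * s) := by
  have h1 := ih _ (hs.len_swap_mul_lt hpq spq) (hs.swap_mul hpq spq) z w hzw
    (hs.sameCycle_swap_mul hpq spq szw hnc cpq)
  have h2 := ih _ (hs.len_swap_mul_lt hxy sxy) (hs.swap_mul hxy sxy) z' w' hzw'
    (hs.sameCycle_swap_mul hxy sxy szw' (e ▸ hnc) (e ▸ cxy))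
  have h3 : swap z w * (swap p q * s) = swap z' w' * (swap x y * s) := by
    have := congrArg (fun g => g⁻¹ * s) e
    simpa only [mul_inv_rev, swap_inv, mul_assoc] using this
  rw [h0, h1, h2, h3, ← mul_assoc, ea, mul_assoc]

/-- The recursion for `lift` splits off one particular transposition (p q); here every (x y) below s
is allowed. The two choices are exchanged inside a divisor of rank two, by the dual relation that
fits their position (common end, nested or separated), and the rest is induction on length. -/
theorem lift_eq {a : Fin n → Fin n → G} (ha : DualRelations a) :
    ∀ (s : Perm (Fin n)), NC s → ∀ x y, x < y → s.SameCycle x y →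
      lift a s = a x y * lift a (swap x y * s) := by
  intro s
  induction hl : (absLength (Fin n)).len s using Nat.strong_induction_on generalizing s with
  | _ l ih =>
  subst hl
  have ih : ∀ t : Perm (Fin n), (absLength (Fin n)).len t < (absLength (Fin n)).len s → NC t →
      ∀ x y, x < y → t.SameCycle x y → lift a t = a x y * lift a (swap x y * t) :=
    fun t ht => ih _ ht t rfl
  intro hs x y hxy hc
  have hne : s ≠ 1 := by
    rintro rfl
    rw [Perm.sameCycle_one] at hc
    exact hxy.ne hc
  have h0 := lift_of_ne_one a hne
  have hpq := firstMoved_lt s hne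
  have hpx : firstMoved s hne ≤ x := firstMoved_le s hne fun h =>
    hxy.ne (hc.eq_of_left h)
  set p := firstMoved s hne
  set q := s p with hq
  have spq : s.SameCycle p q := Perm.sameCycle_apply_right.2 (Perm.SameCycle.refl _ _)
  -- q is the next element of its cycle above p, and cycles meeting the open interval (p, q) stay
  -- inside it. So the pairs (p, q) and (x, y) cannot cross.
  have hnext : ∀ z, p < z → s.SameCycle p z → q ≤ z := fun z hz hz' =>
    ((hs.mem_Ico_iff hz hz' p).1 ⟨le_rfl, hz⟩).2
  have hinv : ∀ j, p < j → j < q → p < s j ∧ s j < q := by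
    intro j h1 h2
    obtain ⟨h3, h4⟩ := (hs.mem_Ico_iff hpq spq j).1 ⟨h1.le, h2⟩
    exact ⟨h3, lt_of_le_of_ne h4 fun h => h1.ne' (s.injective h)⟩
  have hinv' : ∀ j k, s.SameCycle j k → p < j → j < q → p < k ∧ k < q := by
    intro j k hjk h1 h2
    obtain ⟨m, -, rfl⟩ := hjk.exists_pow_eq'
    clear hjk
    induction m with
    | zero => exact ⟨h1, h2⟩
    | succ m ihm =>
      rw [pow_succ', Perm.mul_apply]
      exact hinv _ ihm.1 ihm.2
  rcases eq_or_lt_of_le hpx with rfl | hpx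
  · rcases eq_or_lt_of_le (hnext y hxy hc) with rfl | hqy
    · exact h0
    · have e : swap p q * swap q y = swap p y * swap p q := by
        rw [Equiv.ext_iff]
        intro j
        simp only [Perm.mul_apply, swap_apply_def]
        grind
      have hpy : (swap p q * swap q y) y = p := by simp
      refine lift_exchange hs hpq hqy hxy hpq spq (spq.symm.trans hc) hc spq e
        (nc_three_cycle hpq hqy) ⟨1, ?_⟩ (Perm.SameCycle.symm ⟨1, ?_⟩) (ha.left hpq hqy) h0 ih
      · rw [zpow_one, Perm.mul_apply, swap_apply_of_ne_of_ne hpq.ne hxy.ne, swap_apply_left]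
      · rw [zpow_one, hpy]
  · rcases lt_or_ge x q with hxq | hqx
    · obtain ⟨-, hyq⟩ := hinv' x y hc hpx hxq
      have hcm := nc_swap_mul_swap_nested hpx hxy hyq
      have e : swap p q * swap x y = swap x y * swap p q := by
        apply (Perm.disjoint_iff_disjoint_support.2 _).commute
        rw [Perm.support_swap hpq.ne, Perm.support_swap hxy.ne]
        simp only [Finset.disjoint_insert_left, Finset.mem_insert, Finset.mem_singleton,
          Finset.disjoint_singleton_left]
        grind
      refine lift_exchange hs hpq hxy hxy hpq spq hc hc spq e hcm ⟨1, ?_⟩ ⟨1, ?_⟩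
        (ha.nested hpx hxy hyq).eq h0 ih
      · rw [zpow_one, Perm.mul_apply, swap_apply_of_ne_of_ne hpx.ne (hpx.trans hxy).ne,
          swap_apply_left]
      · rw [zpow_one, e, Perm.mul_apply, swap_apply_of_ne_of_ne hpx.ne' hxq.ne, swap_apply_left]
    · rcases eq_or_lt_of_le hqx with hqx' | hqx
      · clear_value q
        subst hqx'
        have e : swap p q * swap q y = swap q y * swap p y := by
          rw [Equiv.ext_iff]
          intro j
          simp only [Perm.mul_apply, swap_apply_def]
          grind
        refine lift_exchange hs hpq hxy hxy (hpq.trans hxy) spq hc hc (spq.trans hc) e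
          (nc_three_cycle hpq hxy) ⟨1, ?_⟩ ⟨1, ?_⟩ (ha.right hpq hxy) h0 ih
        · rw [zpow_one, Perm.mul_apply, swap_apply_of_ne_of_ne hpq.ne (hpq.trans hxy).ne,
            swap_apply_left]
        · rw [zpow_one, Perm.mul_apply, swap_apply_left,
            swap_apply_of_ne_of_ne (hpq.trans hxy).ne' hxy.ne']
      · have hcm := nc_swap_mul_swap_separated hpq hqx hxy
        have e : swap p q * swap x y = swap x y * swap p q := by
          apply (Perm.disjoint_iff_disjoint_support.2 _).commute
          rw [Perm.support_swap hpq.ne, Perm.support_swap hxy.ne]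
          simp only [Finset.disjoint_insert_left, Finset.mem_insert, Finset.mem_singleton,
            Finset.disjoint_singleton_left]
          grind
        refine lift_exchange hs hpq hxy hxy hpq spq hc hc spq e hcm ⟨1, ?_⟩ ⟨1, ?_⟩
          (ha.separated hpq hqx hxy).eq h0 ih
        · rw [zpow_one, Perm.mul_apply, swap_apply_of_ne_of_ne hpx.ne (hpx.trans hxy).ne,
            swap_apply_left]
        · rw [zpow_one, e, Perm.mul_apply, swap_apply_of_ne_of_ne hpx.ne' hqx.ne', swap_apply_left]

theorem lift_swap {a : Fin n → Fin n → G} (ha : DualRelations a) {x y : Fin n} (hxy : x < y) :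
    lift a (swap x y) = a x y := by
  rw [lift_eq ha _ (nc_swap hxy) x y hxy (sameCycle_swap x y), swap_mul_self, lift_one, mul_one]

theorem NC.induction {P : Perm (Fin n) → Prop} (one : P 1)
    (mul : ∀ s x y, NC s → x < y → s.SameCycle x y → P (swap x y * s) → P s) :
    ∀ s, NC s → P s := by
  intro s
  induction hl : (absLength (Fin n)).len s using Nat.strong_induction_on generalizing s with
  | _ l ih =>
  subst hl
  intro hs
  by_cases h : s = 1
  · rwa [h]
  have h1 := firstMoved_lt s h
  have h2 : s.SameCycle (firstMoved s h) (s (firstMoved s h)) :=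
    Perm.sameCycle_apply_right.2 (Perm.SameCycle.refl _ _)
  exact mul s _ _ hs h1 h2 (ih _ (hs.len_swap_mul_lt h1 h2) _ rfl (hs.swap_mul h1 h2))

/-- A transposition split off from s is also below st, so `lift_eq` removes it from both sides. -/
theorem lift_mul {a : Fin n → Fin n → G} (ha : DualRelations a) {s t : Perm (Fin n)}
    (hst : (absLength (Fin n)).Le s (s * t)) (h : NC (s * t)) :
    lift a (s * t) = lift a s * lift a t := by
  have hs : NC s := hst.trans h
  revert hst h
  refine NC.induction (P := fun s => (absLength (Fin n)).Le s (s * t) → NC (s * t) →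
    lift a (s * t) = lift a s * lift a t) ?_ ?_ s hs
  · intro _ _
    rw [lift_one, one_mul, one_mul]
  · intro s x y hs hxy hc ih hst h
    have h1 := Le.sameCycle hst hc
    have h2 := (swap_le hs hxy hc).inv_mul_le_inv_mul hst
    rw [swap_inv, ← mul_assoc] at h2
    rw [lift_eq ha _ h x y hxy h1, lift_eq ha _ hs x y hxy hc, mul_assoc, ← ih h2, mul_assoc]
    rw [mul_assoc]
    exact h.swap_mul hxy h1

theorem lift_map {H : Type*} [Group H] (f : G →* H) {a : Fin n → Fin n → G}
    {b : Fin n → Fin n → H} (hb : DualRelations b) (ha : DualRelations a)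
    (h : ∀ x y, x < y → f (a x y) = b x y) (s : Perm (Fin n)) (hs : NC s) :
    f (lift a s) = lift b s := by
  refine NC.induction (P := fun s => f (lift a s) = lift b s) ?_ ?_ s hs
  · rw [lift_one, lift_one, map_one]
  · intro s x y hs hxy hc ih
    rw [lift_eq ha _ hs x y hxy hc, lift_eq hb _ hs x y hxy hc, map_mul, ih, h x y hxy]

/-! ### The action of the braid group -/

/-- A transposition as a permutation of formal quotients. -/
noncomputable def fracSwap (x y : Fin n) : Perm (germ n).Frac := by
  classical
  exact if h : NC (swap x y) then GarsideGerm.fracPerm ⟨swap x y, h⟩ else 1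

theorem fracSwap_of_lt {x y : Fin n} (h : x < y) :
    fracSwap x y = GarsideGerm.fracPerm (𝒢 := germ n) ⟨swap x y, nc_swap h⟩ :=
  dif_pos (nc_swap h)

theorem fracSwap_mul {x y z w : Fin n} (hxy : x < y) (hzw : z < w)
    (h : NC (swap x y * swap z w)) (h' : (swap x y * swap z w).SameCycle x y) :
    fracSwap x y * fracSwap z w =
      GarsideGerm.fracPerm (𝒢 := germ n) ⟨swap x y * swap z w, h⟩ := by
  rw [fracSwap_of_lt hxy, fracSwap_of_lt hzw]
  exact GarsideGerm.fracPerm_mul _ _ _ rfl (swap_le h hxy h')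

theorem fracSwap_mul_eq {x y z w x' y' z' w' : Fin n} (hxy : x < y) (hzw : z < w)
    (hxy' : x' < y') (hzw' : z' < w')
    (e : swap x y * swap z w = swap x' y' * swap z' w')
    (h : NC (swap x y * swap z w)) (h1 : (swap x y * swap z w).SameCycle x y)
    (h2 : (swap x y * swap z w).SameCycle x' y') :
    fracSwap x y * fracSwap z w = fracSwap x' y' * fracSwap z' w' := by
  rw [fracSwap_mul hxy hzw h h1, fracSwap_mul hxy' hzw' (e ▸ h) (e ▸ h2)]
  congr 1
  exact Subtype.ext e

/-- Both sides of each relation are the action of one and the same simple element, factored in two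
ways. -/
theorem dualRelations_fracSwap (n : ℕ) : DualRelations (fracSwap (n := n)) where
  left {x y z} h1 h2 := by
    have e : swap x y * swap y z = swap x z * swap x y := by
      rw [Equiv.ext_iff]
      intro j
      simp only [Perm.mul_apply, swap_apply_def]
      grind
    refine fracSwap_mul_eq h1 h2 (h1.trans h2) h1 e (nc_three_cycle h1 h2) ⟨1, ?_⟩
      (Perm.SameCycle.symm ⟨1, ?_⟩)
    · rw [zpow_one, Perm.mul_apply, swap_apply_of_ne_of_ne h1.ne (h1.trans h2).ne, swap_apply_left]
    · simp
  right {x y z} h1 h2 := by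
    have e : swap x y * swap y z = swap y z * swap x z := by
      rw [Equiv.ext_iff]
      intro j
      simp only [Perm.mul_apply, swap_apply_def]
      grind
    refine fracSwap_mul_eq h1 h2 h2 (h1.trans h2) e (nc_three_cycle h1 h2) ⟨1, ?_⟩ ⟨1, ?_⟩
    · rw [zpow_one, Perm.mul_apply, swap_apply_of_ne_of_ne h1.ne (h1.trans h2).ne, swap_apply_left]
    · rw [zpow_one, Perm.mul_apply, swap_apply_left,
        swap_apply_of_ne_of_ne (h1.trans h2).ne' h2.ne']
  separated {x y z w} h1 h2 h3 := by
    have e : swap x y * swap z w = swap z w * swap x y := by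
      apply (Perm.disjoint_iff_disjoint_support.2 _).commute
      rw [Perm.support_swap h1.ne, Perm.support_swap h3.ne]
      simp only [Finset.disjoint_insert_left, Finset.mem_insert, Finset.mem_singleton,
        Finset.disjoint_singleton_left]
      grind
    refine fracSwap_mul_eq h1 h3 h3 h1 e (nc_swap_mul_swap_separated h1 h2 h3) ⟨1, ?_⟩ ⟨1, ?_⟩
    · rw [zpow_one, Perm.mul_apply, swap_apply_of_ne_of_ne (h1.trans h2).ne
        ((h1.trans h2).trans h3).ne, swap_apply_left]
    · rw [zpow_one, e, Perm.mul_apply, swap_apply_of_ne_of_ne (h1.trans h2).ne' h2.ne',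
        swap_apply_left]
  nested {x y z w} h1 h2 h3 := by
    have hxw := (h1.trans h2).trans h3
    have e : swap x w * swap y z = swap y z * swap x w := by
      apply (Perm.disjoint_iff_disjoint_support.2 _).commute
      rw [Perm.support_swap hxw.ne, Perm.support_swap h2.ne]
      simp only [Finset.disjoint_insert_left, Finset.mem_insert, Finset.mem_singleton,
        Finset.disjoint_singleton_left]
      grind
    refine fracSwap_mul_eq hxw h2 h2 hxw e (nc_swap_mul_swap_nested h1 h2 h3) ⟨1, ?_⟩ ⟨1, ?_⟩
    · rw [zpow_one, Perm.mul_apply, swap_apply_of_ne_of_ne h1.ne (h1.trans h2).ne,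
        swap_apply_left]
    · rw [zpow_one, e, Perm.mul_apply, swap_apply_of_ne_of_ne h1.ne' (h2.trans h3).ne,
        swap_apply_left]

theorem lift_fracSwap (s : Perm (Fin n)) (hs : NC s) :
    lift fracSwap s = GarsideGerm.fracPerm (𝒢 := germ n) ⟨s, hs⟩ := by
  refine NC.induction (P := fun s => ∀ hs : NC s,
    lift fracSwap s = GarsideGerm.fracPerm (𝒢 := germ n) ⟨s, hs⟩) ?_ ?_ s hs hs
  · intro _
    rw [lift_one]
    exact GarsideGerm.fracPerm_one.symm
  · intro s x y hs hxy hc ih hs'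
    rw [lift_eq (dualRelations_fracSwap n) s hs x y hxy hc, ih (hs.swap_mul hxy hc),
      fracSwap_of_lt hxy]
    exact GarsideGerm.fracPerm_mul _ _ _ (swap_mul_self_mul x y s) (swap_le hs hxy hc)

/-- The images of the Artin generators. -/
noncomputable def artinAction (n : ℕ) (i : ArtinIndex n) : Perm (germ n).Frac :=
  fracSwap ⟨n - (i.i + 1), by have := i.lt; omega⟩ ⟨n - i.i, by have := i.lt; have := i.one_le; omega⟩

/-- Artin's braid relation is a consequence of the two dual relations for three neighbouring points;
far commutation is the separated case. -/
theorem artinAction_relators (n : ℕ) : ∀ r ∈ artinRelators n,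
    FreeGroup.lift (artinAction n) r = 1 := by
  have D := dualRelations_fracSwap n
  have key : ∀ t s : ArtinIndex n, (s.i + 1 < t.i →
      artinAction n t * artinAction n s = artinAction n s * artinAction n t) ∧
      (s.i + 1 = t.i → artinAction n t * artinAction n s * artinAction n t =
        artinAction n s * artinAction n t * artinAction n s) := by
    intro t s
    have := t.lt; have := t.one_le; have := s.lt; have := s.one_le
    constructor
    · intro h
      exact (D.separated (Fin.lt_def.2 (by dsimp only; omega)) (Fin.lt_def.2 (by dsimp only; omega))
        (Fin.lt_def.2 (by dsimp only; omega))).eq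
    · intro h
      obtain ⟨t, ht1, ht2⟩ := t
      obtain ⟨s, hs1, hs2⟩ := s
      dsimp only at h
      subst h
      simp only [artinAction]
      have h1 : (⟨n - (s + 1 + 1), by omega⟩ : Fin n) < ⟨n - (s + 1), by omega⟩ :=
        Fin.lt_def.2 (by dsimp only; omega)
      have h2 : (⟨n - (s + 1), by omega⟩ : Fin n) < ⟨n - s, by omega⟩ :=
        Fin.lt_def.2 (by dsimp only; omega)
      rw [D.right h1 h2, mul_assoc, ← D.left h1 h2, mul_assoc]
  rintro r ⟨t, s, ⟨h, rfl⟩ | ⟨h, rfl⟩⟩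
  · simp only [map_mul, map_inv, FreeGroup.lift_apply_of]
    rw [mul_inv_eq_one]
    rw [lt_abs] at h
    rcases h with h | h
    · exact (key t s).1 (by omega)
    · exact ((key s t).1 (by omega)).symm
  · simp only [map_mul, map_inv, FreeGroup.lift_apply_of]
    rw [mul_inv_eq_one]
    rw [abs_eq (by norm_num)] at h
    rcases h with h | h
    · exact (key t s).2 (by omega)
    · exact ((key s t).2 (by omega)).symm

/-- The action of the braid group on formal quotients. -/
noncomputable def braidAction (n : ℕ) : BraidGroup n →* Perm (germ n).Frac :=
  PresentedGroup.toGroup (artinAction_relators n)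

/-- A band is built by conjugating with Artin generators, and the first dual relation says that the
transpositions transform in the same way. -/
theorem braidAction_finBand {x y : Fin n} (h : x < y) :
    braidAction n (finBand n x y) = fracSwap x y := by
  have key : ∀ s t : ℕ, ∀ hs : 1 ≤ s, ∀ hst : s < t, ∀ ht : t ≤ n,
      braidAction n (band (artin n) s t) = fracSwap ⟨n - t, by omega⟩ ⟨n - s, by omega⟩ := by
    have hσ : ∀ t : ℕ, ∀ h1 : 1 ≤ t, ∀ h2 : t < n, braidAction n (artin n t) =
        fracSwap ⟨n - (t + 1), by omega⟩ ⟨n - t, by omega⟩ := by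
      intro t h1 h2
      rw [artin, dif_pos ⟨h1, h2⟩]
      exact PresentedGroup.toGroup.of _
    intro s t hs hst
    induction t, hst using Nat.le_induction with
    | base =>
      intro ht
      rw [band_self_succ]
      exact hσ s hs ht
    | succ t hst ih =>
      intro ht
      rw [band_succ hst, MulAut.conj_apply, map_mul, map_mul, map_inv, ih (by omega),
        hσ t (by omega) (by omega), mul_inv_eq_iff_eq_mul]
      exact (dualRelations_fracSwap n).left (Fin.lt_def.2 (by dsimp only; omega))
        (Fin.lt_def.2 (by dsimp only; omega))
  have hx := x.2
  have hy := y.2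
  rw [Fin.lt_def] at h
  rw [finBand, key (n - y) (n - x) (by omega) (by omega) (by omega)]
  congr 1 <;> apply Fin.ext <;> dsimp only <;> omega

/-- The braid of a noncrossing permutation. -/
noncomputable def ncBraid (s : Perm (Fin n)) : BraidGroup n := lift (finBand n) s

theorem ncBraid_mul {s t : Perm (Fin n)} (hst : (germ n).Le s (s * t))
    (h : (germ n).Simple (s * t)) : ncBraid (s * t) = ncBraid s * ncBraid t :=
  lift_mul (dualRelations_finBand n) hst h

theorem ncBraid_swap {x y : Fin n} (h : x < y) : ncBraid (swap x y) = finBand n x y :=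
  lift_swap (dualRelations_finBand n) h

theorem braidAction_ncBraid (s : Perm (Fin n)) (hs : NC s) :
    braidAction n (ncBraid s) = GarsideGerm.fracPerm (𝒢 := germ n) ⟨s, hs⟩ := by
  rw [ncBraid, lift_map _ (dualRelations_fracSwap n) (dualRelations_finBand n)
    (fun x y => braidAction_finBand) s hs, lift_fracSwap]

theorem braidAction_prod (w : List (germ n).Simples) :
    braidAction n ((w.map Subtype.val).map ncBraid).prod = (w.map GarsideGerm.fracPerm).prod := by
  induction w with
  | nil => simp
  | cons u w ih =>
    simp only [List.map_cons, List.prod_cons, map_mul]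
    rw [ih, braidAction_ncBraid u.1 u.2]

/-- Normal sequences decide whether a product of simple braids is a power of the Garside braid. -/
theorem prod_ncBraid_eq_pow_iff {w : List (Perm (Fin n))} (hw : ∀ u ∈ w, NC u) {k : ℕ}
    (hk : k ≤ w.length) : (w.map ncBraid).prod = ncBraid (finRotate n) ^ k ↔
      ∀ i, (germ n).normalSeq w i = if i < k then finRotate n else 1 := by
  constructor
  -- This direction uses the action: a braid equal to δᵏ acts like cᵏ.
  · intro h i
    have hw0 : ∀ u ∈ w, (germ n).Simple u := hw
    lift w to List (germ n).Simples using hw0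
    have h1 := congrArg (braidAction n) h
    rw [braidAction_prod, map_pow, braidAction_ncBraid (finRotate n) (germ n).simple_c] at h1
    exact GarsideGerm.normalSeq_of_prod_fracPerm w k h1 i
  · intro h
    -- The first `w.length` entries multiply to the braid of w; as k ≤ `w.length`, all k entries c
    -- are among them.
    rw [← GarsideGerm.prod_map_normalSeq (𝒢 := germ n) ncBraid (fun s t => ncBraid_mul) hw]
    simp only [h]
    obtain ⟨d, hd⟩ := Nat.exists_eq_add_of_le hk
    rw [hd, List.range_add, List.map_append, List.prod_append, List.map_map]
    have h1 : (List.range k).map (fun i => ncBraid (if i < k then finRotate n else 1)) =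
        List.replicate k (ncBraid (finRotate n)) := by
      rw [List.eq_replicate_iff]
      refine ⟨by simp, ?_⟩
      simp only [List.mem_map, List.mem_range]
      rintro _ ⟨i, hi, rfl⟩
      rw [if_pos hi]
    have h2 : (List.range d).map ((fun i => ncBraid (if i < k then finRotate n else 1)) ∘
        fun x => k + x) = List.replicate d 1 := by
      rw [List.eq_replicate_iff]
      refine ⟨by simp, ?_⟩
      simp only [List.mem_map, List.mem_range, Function.comp_apply]
      rintro _ ⟨i, hi, rfl⟩
      rw [if_neg (by omega), ncBraid, lift_one]
    rw [h1, h2, List.prod_replicate, List.prod_replicate, one_pow, mul_one]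

/-! ### Processing a word letter by letter -/

/-- The state `(k, w)` stands for the braid `δ⁻ᵏ w`. Here it is multiplied on the left by
the braid of `s` or its inverse. -/
def pushSimple (s : Perm (Fin n)) (ε : Bool) (st : ℕ × List (Perm (Fin n))) :
    ℕ × List (Perm (Fin n)) :=
  if ε then (st.1, (finRotate n ^ st.1 * s * (finRotate n ^ st.1)⁻¹) :: st.2)
  else (st.1 + 1, (finRotate n * (finRotate n ^ st.1 * s * (finRotate n ^ st.1)⁻¹)⁻¹) :: st.2)

/-- The braid of a state. -/
noncomputable def stateBraid (st : ℕ × List (Perm (Fin n))) : BraidGroup n :=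
  (ncBraid (finRotate n) ^ st.1)⁻¹ * (st.2.map ncBraid).prod

theorem nc_conj_pow {s : Perm (Fin n)} (hs : NC s) (k : ℕ) :
    NC (finRotate n ^ k * s * (finRotate n ^ k)⁻¹) :=
  (GarsideGerm.tau (𝒢 := germ n) k ⟨s, hs⟩).2

theorem ncBraid_c_mul_inv {s : Perm (Fin n)} (hs : NC s) :
    ncBraid (finRotate n * s⁻¹) * ncBraid s = ncBraid (finRotate n) := by
  have h1 : (germ n).Simple s := hs
  have h2 := h1.c_mul_inv.2
  have e : (germ n).c * s⁻¹ * s = (germ n).c := by group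
  have := ncBraid_mul (s := (germ n).c * s⁻¹) (t := s) (by rwa [e]) (by rw [e]; exact (germ n).simple_c)
  rw [e] at this
  exact this.symm

/-- The two factorizations c = (csc⁻¹)(cs⁻¹) and c = (cs⁻¹)s lift to braids; δ can thus be moved
past a simple braid at the price of a rotation. -/
theorem ncBraid_conj {s : Perm (Fin n)} (hs : NC s) :
    ncBraid (finRotate n * s * (finRotate n)⁻¹) * ncBraid (finRotate n) =
      ncBraid (finRotate n) * ncBraid s := by
  have h1 : (germ n).Simple s := hs
  have h2 := ncBraid_c_mul_inv h1.c_mul_inv.1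
  have h3 := ncBraid_c_mul_inv hs
  have e : finRotate n * ((germ n).c * s⁻¹)⁻¹ = finRotate n * s * (finRotate n)⁻¹ := by
    change finRotate n * (finRotate n * s⁻¹)⁻¹ = _
    group
  rw [e] at h2
  change _ * ncBraid (finRotate n * s⁻¹) = _ at h2
  calc _ = ncBraid (finRotate n * s * (finRotate n)⁻¹) * (ncBraid (finRotate n * s⁻¹) * ncBraid s) := by
        rw [h3]
    _ = _ := by rw [← mul_assoc, h2]

theorem ncBraid_conj_pow {s : Perm (Fin n)} (hs : NC s) (k : ℕ) :
    ncBraid (finRotate n ^ k * s * (finRotate n ^ k)⁻¹) * ncBraid (finRotate n) ^ k =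
      ncBraid (finRotate n) ^ k * ncBraid s := by
  induction k with
  | zero => simp
  | succ k ih =>
    have e : finRotate n ^ (k + 1) * s * (finRotate n ^ (k + 1))⁻¹ =
        finRotate n * (finRotate n ^ k * s * (finRotate n ^ k)⁻¹) * (finRotate n)⁻¹ := by
      rw [pow_succ']
      group
    rw [e, pow_succ', ← mul_assoc, ncBraid_conj (nc_conj_pow hs k), mul_assoc, ih, mul_assoc]

/-- With s' = cᵏsc⁻ᵏ, moving δ⁻ᵏ to the left gives sδ⁻ᵏ = δ⁻ᵏs', and s⁻¹δ⁻ᵏ = δ⁻ᵏ⁻¹(δs'⁻¹), where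
δs'⁻¹ is again a simple braid. -/
theorem stateBraid_pushSimple {s : Perm (Fin n)} (hs : NC s) (ε : Bool)
    (st : ℕ × List (Perm (Fin n))) :
    stateBraid (pushSimple s ε st) = (if ε then ncBraid s else (ncBraid s)⁻¹) * stateBraid st := by
  have h1 := ncBraid_conj_pow hs st.1
  cases ε with
  | true =>
    simp only [pushSimple, stateBraid, if_true, List.map_cons, List.prod_cons]
    rw [← mul_assoc, ← mul_assoc]
    congr 1
    rw [inv_mul_eq_iff_eq_mul, ← mul_assoc, eq_mul_inv_iff_mul_eq, h1]
  | false =>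
    simp only [pushSimple, stateBraid, Bool.false_eq_true, if_false, List.map_cons, List.prod_cons]
    rw [← mul_assoc, ← mul_assoc]
    congr 1
    have h2 := ncBraid_c_mul_inv (nc_conj_pow hs st.1)
    rw [← eq_mul_inv_iff_mul_eq] at h1 h2
    rw [h2, h1, pow_succ']
    group

theorem nc_pushSimple {s : Perm (Fin n)} (hs : NC s) (ε : Bool)
    {st : ℕ × List (Perm (Fin n))} (h : ∀ u ∈ st.2, NC u) : ∀ u ∈ (pushSimple s ε st).2, NC u := by
  have h1 : (germ n).Simple _ := nc_conj_pow hs st.1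
  cases ε with
  | true =>
    simp only [pushSimple, if_true, List.mem_cons, forall_eq_or_imp]
    exact ⟨h1, h⟩
  | false =>
    simp only [pushSimple, Bool.false_eq_true, if_false, List.mem_cons, forall_eq_or_imp]
    exact ⟨h1.c_mul_inv.1, h⟩

theorem length_pushSimple (s : Perm (Fin n)) (ε : Bool) (st : ℕ × List (Perm (Fin n))) :
    (pushSimple s ε st).2.length = st.2.length + 1 := by
  cases ε <;> simp [pushSimple]

theorem fst_pushSimple_le {s : Perm (Fin n)} {ε : Bool} {st : ℕ × List (Perm (Fin n))}
    (h : st.1 ≤ st.2.length) : (pushSimple s ε st).1 ≤ (pushSimple s ε st).2.length := by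
  cases ε <;> simp [pushSimple] <;> omega

end AbsoluteOrder

/-! ## A small structured language and its translation to machine code -/

namespace RAM

set_option linter.constructorNameAsVariable false

/-- The scalar variables. -/
inductive Var where
  | n | k | shift | len | cnt | i | x | j | t | s | e | q | ans
  deriving DecidableEq

/-- The arrays. -/
inductive Arr where
  | letters | seq | u | ui | d | la | lb | m | mi | tbl | row
  deriving DecidableEq

/-- Positions of the variables in memory. -/
def Var.idx : Var → ℕ
  | n => 0 | k => 1 | shift => 2 | len => 3 | cnt => 4 | i => 5 | x => 6 | j => 7 | t => 8 | s => 9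
  | e => 10 | q => 11 | ans => 12

/-- Positions of the arrays in memory. -/
def Arr.idx : Arr → ℕ
  | letters => 0 | seq => 1 | u => 2 | ui => 3 | d => 4 | la => 5 | lb => 6 | m => 7 | mi => 8
  | tbl => 9 | row => 10

theorem Var.idx_inj {x y : Var} (h : x.idx = y.idx) : x = y := by
  cases x <;> cases y <;> first | rfl | simp [idx] at h

theorem Arr.idx_inj {x y : Arr} (h : x.idx = y.idx) : x = y := by
  cases x <;> cases y <;> first | rfl | simp [idx] at h

theorem Arr.idx_lt (x : Arr) : x.idx < 11 := by
  cases x <;> simp [idx]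

/-- The states of the structured language. -/
structure St where
  v : Var → ℤ
  a : Arr → ℕ → ℤ
  inp : List ℤ
  out : List ℤ

namespace St

/-- Assign to a variable. -/
def setV (s : St) (x : Var) (z : ℤ) : St := { s with v := Function.update s.v x z }

/-- Replace an array. -/
def setArr (s : St) (j : Arr) (f : ℕ → ℤ) : St := { s with a := Function.update s.a j f }

/-- Assign to an array entry. -/
def setA (s : St) (j : Arr) (r : ℕ) (z : ℤ) : St := s.setArr j (Function.update (s.a j) r z)

variable (s : St) (x y : Var) (z : ℤ) (j l : Arr) (f : ℕ → ℤ) (r : ℕ)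

@[simp] theorem setV_v : (s.setV x z).v y = if y = x then z else s.v y := by
  simp [setV, Function.update_apply]
@[simp] theorem setV_a : (s.setV x z).a = s.a := rfl
@[simp] theorem setV_inp : (s.setV x z).inp = s.inp := rfl
@[simp] theorem setV_out : (s.setV x z).out = s.out := rfl
@[simp] theorem setArr_v : (s.setArr j f).v = s.v := rfl
@[simp] theorem setArr_a : (s.setArr j f).a l = if l = j then f else s.a l := by
  simp [setArr, Function.update_apply]
@[simp] theorem setArr_inp : (s.setArr j f).inp = s.inp := rfl
@[simp] theorem setArr_out : (s.setArr j f).out = s.out := rfl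
@[simp] theorem setA_v : (s.setA j r z).v = s.v := rfl
@[simp] theorem setA_a : (s.setA j r z).a l = if l = j then Function.update (s.a j) r z else s.a l := by
  simp [setA]
@[simp] theorem setA_inp : (s.setA j r z).inp = s.inp := rfl
@[simp] theorem setA_out : (s.setA j r z).out = s.out := rfl

end St

/-- Expressions. -/
inductive Expr where
  | const (k : ℤ)
  | var (x : Var)
  | add (e f : Expr)
  | sub (e f : Expr)
  | mul (e f : Expr)
  | get (j : Arr) (e : Expr)

namespace Expr

/-- The value of an expression. -/
def eval (s : St) : Expr → ℤ
  | const k => k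
  | var x => s.v x
  | add e f => e.eval s + f.eval s
  | sub e f => e.eval s - f.eval s
  | mul e f => e.eval s * f.eval s
  | get j e => s.a j (e.eval s).toNat

/-- The evaluation of the expression is defined and involves no integer larger than `B`. -/
def Ok (B : ℤ) (s : St) : Expr → Prop
  | const k => -B ≤ k ∧ k ≤ B
  | var _ => True
  | add e f => e.Ok B s ∧ f.Ok B s ∧ -B ≤ e.eval s + f.eval s ∧ e.eval s + f.eval s ≤ B
  | sub e f => e.Ok B s ∧ f.Ok B s ∧ -B ≤ e.eval s - f.eval s ∧ e.eval s - f.eval s ≤ B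
  | mul e f => e.Ok B s ∧ f.Ok B s ∧ -B ≤ e.eval s * f.eval s ∧ e.eval s * f.eval s ≤ B
  | get _ e => e.Ok B s ∧ 0 ≤ e.eval s ∧ 16 * e.eval s + 16 ≤ B

/-- The register for the intermediate result number `d`. -/
def temp (d : ℕ) : ℕ := 16 * (d + 1)

/-- Code that loads the address of an array entry, with index in the accumulator, to a register. -/
def address (j : Arr) (d : ℕ) : List Instr :=
  [.mult (.const 16), .add (.const (j.idx + 2 : ℕ)), .store (.direct (temp d))]

/-- Code that evaluates an expression to the accumulator. -/
def code : Expr → ℕ → List Instr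
  | const k, _ => [.load (.const k)]
  | var x, _ => [.load (.direct (16 * x.idx + 1))]
  | add e f, d => f.code d ++ (.store (.direct (temp d)) :: (e.code (d + 1) ++ [.add (.direct (temp d))]))
  | sub e f, d => f.code d ++ (.store (.direct (temp d)) :: (e.code (d + 1) ++ [.sub (.direct (temp d))]))
  | mul e f, d => f.code d ++ (.store (.direct (temp d)) :: (e.code (d + 1) ++ [.mult (.direct (temp d))]))
  | get j e, d => e.code d ++ (address j d ++ [.load (.indirect (temp d))])

/-- The number of instructions for an expression. -/
def size : Expr → ℕ
  | const _ => 1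
  | var _ => 1
  | add e f => e.size + f.size + 2
  | sub e f => e.size + f.size + 2
  | mul e f => e.size + f.size + 2
  | get _ e => e.size + 4

theorem length_code (e : Expr) (d : ℕ) : (e.code d).length = e.size := by
  induction e generalizing d <;> simp [code, size, address, *] <;> omega

end Expr

/-! ### Compiled expressions and the memory layout -/

/-- The code `l` is found at position `k` of the program `P`. -/
def At (P : Program) (k : ℕ) (l : List Instr) : Prop := ∀ i a, l[i]? = some a → P[k + i]? = some a

theorem At.append {P : Program} {k : ℕ} {l l' : List Instr} (h : At P k (l ++ l')) :
    At P k l ∧ At P (k + l.length) l' := by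
  constructor
  · intro i a hi
    exact h i a (by rw [List.getElem?_append_left (List.getElem?_eq_some_iff.1 hi).1, hi])
  · intro i a hi
    have := h (l.length + i) a (by rw [List.getElem?_append_right (by omega), Nat.add_sub_cancel_left, hi])
    rwa [← add_assoc] at this

theorem At.cons {P : Program} {k : ℕ} {a : Instr} {l : List Instr} (h : At P k (a :: l)) :
    P[k]? = some a ∧ At P (k + 1) l :=
  ⟨h 0 a rfl, (At.append (l := [a]) h).2⟩

/-- All registers are at most `B` in absolute value. -/
def Config.Bdd (B : ℤ) (c : Config) : Prop := ∀ r, |c.reg r| ≤ B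

/-- The program takes `t` steps from the first to the second configuration, and all registers
are bounded by `B` all the time. -/
inductive Steps (P : Program) (B : ℤ) : Config → ℕ → Config → Prop
  | refl {c : Config} : c.Bdd B → Steps P B c 0 c
  | cons {c c' c'' : Config} {t : ℕ} : c.Bdd B → step P c = some c' → Steps P B c' t c'' →
      Steps P B c (t + 1) c''

namespace Steps

variable {P : Program} {B : ℤ} {c c' c'' : Config} {t t' : ℕ}

theorem trans (h : Steps P B c t c') (h' : Steps P B c' t' c'') : Steps P B c (t + t') c'' := by
  induction h with
  | refl _ => rwa [zero_add]
  | cons hb hs _ ih =>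
    rw [add_right_comm]
    exact cons hb hs (ih h')

theorem bdd (h : Steps P B c t c') : c'.Bdd B := by
  induction h with
  | refl h => exact h
  | cons _ _ _ ih => exact ih

theorem run_eq (h : Steps P B c t c') : run P t c = some c' := by
  induction h with
  | refl _ => rfl
  | cons _ hs _ ih => rw [run, hs, Option.bind_some, ih]

/-- The machine is deterministic, so every reachable configuration lies on the recorded path, which
ends where the machine stops. -/
theorem bdd_of_run (h : Steps P B c t c') (hc : step P c' = none) {k : ℕ} {c'' : Config}
    (hk : run P k c = some c'') : c''.Bdd B := by
  induction h generalizing k with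
  | refl h =>
    cases k with
    | zero => cases hk; exact h
    | succ k => simp [run, hc] at hk
  | cons hb hs _ ih =>
    cases k with
    | zero => cases hk; exact hb
    | succ k =>
      rw [run, hs, Option.bind_some] at hk
      exact ih hc hk

end Steps

theorem Config.Bdd.set {B : ℤ} {c : Config} (h : c.Bdd B) {r : ℕ} {z : ℤ} (h1 : -B ≤ z) (h2 : z ≤ B) :
    (c.set r z).Bdd B := by
  intro r'
  simp only [Config.set, Function.update_apply]
  split_ifs
  · exact abs_le.2 ⟨h1, h2⟩
  · exact h r'

theorem Config.set_pc (c : Config) (r : ℕ) (z : ℤ) : (c.set r z).pc = c.pc + 1 := rfl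

theorem Config.set_reg (c : Config) (r r' : ℕ) (z : ℤ) :
    (c.set r z).reg r' = if r' = r then z else c.reg r' := by
  simp [Config.set, Function.update_apply]

/-- The configuration represents the state. -/
structure Rep (s : St) (c : Config) : Prop where
  var : ∀ x : Var, c.reg (16 * x.idx + 1) = s.v x
  arr : ∀ (j : Arr) (r : ℕ), c.reg (16 * r + (j.idx + 2)) = s.a j r
  inp : c.input = s.inp
  out : c.output = s.out

/-- Registers are separated by their residue modulo 16: residue 0 holds the accumulator and
intermediate results, residue 1 the variables, and residues 2 to 12 the eleven arrays. The arrays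
are interleaved and can grow without limit. -/
theorem Rep.set_scratch {s : St} {c : Config} (h : Rep s c) {r : ℕ} (z : ℤ) (hr : r % 16 = 0) :
    Rep s (c.set r z) where
  var x := by rw [Config.set_reg, if_neg (by omega), h.var]
  arr j r := by rw [Config.set_reg, if_neg (by have := j.idx_lt; omega), h.arr]
  inp := h.inp
  out := h.out

theorem Rep.set_var {s : St} {c : Config} (h : Rep s c) (x : Var) (z : ℤ) :
    Rep (s.setV x z) (c.set (16 * x.idx + 1) z) where
  var y := by
    rw [Config.set_reg, St.setV_v, ← h.var]
    by_cases hy : y = x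
    · simp [hy]
    · rw [if_neg (fun h' => hy (Var.idx_inj (by omega))), if_neg hy]
  arr j r := by rw [Config.set_reg, if_neg (by have := j.idx_lt; omega), h.arr, St.setV_a]
  inp := h.inp
  out := h.out

theorem Rep.set_arr {s : St} {c : Config} (h : Rep s c) (j : Arr) (r : ℕ) (z : ℤ) :
    Rep (s.setA j r z) (c.set (16 * r + (j.idx + 2)) z) where
  var y := by rw [Config.set_reg, if_neg (by have := j.idx_lt; omega), h.var, St.setA_v]
  arr l r' := by
    have := j.idx_lt
    have := l.idx_lt
    rw [Config.set_reg, St.setA_a]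
    by_cases hl : l = j
    · subst hl
      rw [if_pos rfl, Function.update_apply]
      by_cases hr : r' = r
      · simp [hr]
      · rw [if_neg (by omega), if_neg hr, h.arr]
    · rw [if_neg hl, if_neg, h.arr]
      intro h'
      exact hl (Arr.idx_inj (by omega))
  inp := h.inp
  out := h.out

/-- The effect of running code. -/
structure Reaches (P : Program) (B : ℤ) (c : Config) (t : ℕ) (k : ℕ) (s : St) (c' : Config) : Prop where
  steps : Steps P B c t c'
  pc : c'.pc = k
  rep : Rep s c'

variable {P : Program} {B : ℤ} {s : St} {c : Config} {k : ℕ}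

theorem step_eq {a : Instr} (h : P[k]? = some a) (hc : c.pc = k) : step P c = exec c a := by
  rw [step, hc, h, Option.bind_some]

theorem Steps.one {c' : Config} (h : step P c = some c') (hc : c.Bdd B) (hc' : c'.Bdd B) :
    Steps P B c 1 c' := Steps.cons hc h (Steps.refl hc')

theorem Reaches.trans {c' c'' : Config} {t t' k' : ℕ} {s' : St} (h : Reaches P B c t k s c')
    (h' : Reaches P B c' t' k' s' c'') : Reaches P B c (t + t') k' s' c'' :=
  ⟨h.steps.trans h'.steps, h'.pc, h'.rep⟩

/-- Writing a bounded integer to a scratch register. -/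
theorem Reaches.scratch (hc : c.Bdd B) (hpc : c.pc = k) (hr : Rep s c) {r : ℕ} {z : ℤ}
    (hs : step P c = some (c.set r z)) (h16 : r % 16 = 0) (h1 : -B ≤ z) (h2 : z ≤ B) :
    Reaches P B c 1 (k + 1) s (c.set r z) :=
  ⟨Steps.one hs hc (hc.set h1 h2), by rw [Config.set_pc, hpc], hr.set_scratch z h16⟩

theorem Config.Bdd.le {B : ℤ} {c : Config} (h : c.Bdd B) (r : ℕ) : -B ≤ c.reg r ∧ c.reg r ≤ B :=
  abs_le.1 (h r)

namespace Expr

/-- A binary operation. -/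
theorem binary_correct {e f : Expr} {d : ℕ} (op : Operand → Instr) (o : ℤ → ℤ → ℤ)
    (hop : ∀ (c : Config) (r : ℕ), exec c (op (.direct r)) = some (c.set 0 (o (c.reg 0) (c.reg r))))
    (ihe : ∀ {k d : ℕ} {c : Config}, At P k (e.code d) → c.pc = k → c.Bdd B → Rep s c →
      ∃ c', Reaches P B c e.size (k + e.size) s c' ∧ c'.reg 0 = e.eval s ∧
        ∀ d' < d, c'.reg (temp d') = c.reg (temp d'))
    (ihf : ∀ {k d : ℕ} {c : Config}, At P k (f.code d) → c.pc = k → c.Bdd B → Rep s c →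
      ∃ c', Reaches P B c f.size (k + f.size) s c' ∧ c'.reg 0 = f.eval s ∧
        ∀ d' < d, c'.reg (temp d') = c.reg (temp d'))
    (hat : At P k (f.code d ++ (.store (.direct (temp d)) :: (e.code (d + 1) ++
      [op (.direct (temp d))])))) (hpc : c.pc = k) (hb : c.Bdd B) (hr : Rep s c)
    (h1 : -B ≤ o (e.eval s) (f.eval s)) (h2 : o (e.eval s) (f.eval s) ≤ B) :
    ∃ c', Reaches P B c (e.size + f.size + 2) (k + (e.size + f.size + 2)) s c' ∧
      c'.reg 0 = o (e.eval s) (f.eval s) ∧ ∀ d' < d, c'.reg (temp d') = c.reg (temp d') := by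
  obtain ⟨a1, a2⟩ := hat.append
  obtain ⟨a2, a3⟩ := a2.cons
  obtain ⟨a3, a4⟩ := a3.append
  have a4 := a4.cons.1
  rw [length_code] at a2 a3 a4
  rw [length_code] at a4
  obtain ⟨c1, r1, v1, t1⟩ := ihf a1 hpc hb hr
  have b1 := r1.steps.bdd
  have r2 : Reaches P B c1 1 (k + f.size + 1) s (c1.set (temp d) (c1.reg 0)) :=
    Reaches.scratch b1 r1.pc r1.rep (step_eq a2 r1.pc) (by simp [temp]) (b1.le 0).1 (b1.le 0).2
  obtain ⟨c3, r3, v3, t3⟩ := ihe a3 r2.pc r2.steps.bdd r2.rep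
  have e3 : c3.reg (temp d) = f.eval s := by
    rw [t3 d (by omega), Config.set_reg, if_pos rfl, v1]
  have r4 : Reaches P B c3 1 (k + f.size + 1 + e.size + 1) s
      (c3.set 0 (o (c3.reg 0) (c3.reg (temp d)))) :=
    Reaches.scratch r3.steps.bdd r3.pc r3.rep ((step_eq a4 r3.pc).trans (hop _ _)) rfl
      (by rwa [v3, e3]) (by rwa [v3, e3])
  refine ⟨c3.set 0 (o (c3.reg 0) (c3.reg (temp d))), ?_, ?_, ?_⟩
  · have := ((r1.trans r2).trans r3).trans r4
    rw [show e.size + f.size + 2 = f.size + 1 + e.size + 1 by omega,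
      show k + (f.size + 1 + e.size + 1) = k + f.size + 1 + e.size + 1 by omega]
    exact this
  · rw [Config.set_reg, if_pos rfl, v3, e3]
  · intro d' hd'
    rw [Config.set_reg, if_neg (by simp [temp]), t3 d' (by omega), Config.set_reg,
      if_neg (by simp only [temp]; omega), t1 d' hd']

theorem address_correct {e : Expr} {j : Arr} {d : ℕ} (hat : At P k (address j d)) (hpc : c.pc = k)
    (hb : c.Bdd B) (hr : Rep s c) (hv : c.reg 0 = e.eval s) (h0 : 0 ≤ e.eval s)
    (hB : 16 * e.eval s + 16 ≤ B) :
    ∃ c', Reaches P B c 3 (k + 3) s c' ∧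
      c'.reg (temp d) = ((16 * (e.eval s).toNat + (j.idx + 2) : ℕ) : ℤ) ∧
      ∀ d' < d, c'.reg (temp d') = c.reg (temp d') := by
  obtain ⟨a1, a2⟩ := hat.cons
  obtain ⟨a2, a3⟩ := a2.cons
  have a3 := a3.cons.1
  have hj := j.idx_lt
  have r1 : Reaches P B c 1 (k + 1) s (c.set 0 (c.reg 0 * 16)) :=
    Reaches.scratch hb hpc hr (step_eq a1 hpc) rfl (by rw [hv]; omega) (by rw [hv]; omega)
  set c1 := c.set 0 (c.reg 0 * 16) with hc1
  have v1 : c1.reg 0 = e.eval s * 16 := by rw [hc1, Config.set_reg, if_pos rfl, hv]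
  have r2 : Reaches P B c1 1 (k + 1 + 1) s (c1.set 0 (c1.reg 0 + (j.idx + 2 : ℕ))) :=
    Reaches.scratch r1.steps.bdd r1.pc r1.rep (step_eq a2 r1.pc) rfl (by rw [v1]; omega)
      (by rw [v1]; omega)
  set c2 := c1.set 0 (c1.reg 0 + (j.idx + 2 : ℕ)) with hc2
  have v2 : c2.reg 0 = e.eval s * 16 + (j.idx + 2 : ℕ) := by rw [hc2, Config.set_reg, if_pos rfl, v1]
  have r3 : Reaches P B c2 1 (k + 1 + 1 + 1) s (c2.set (temp d) (c2.reg 0)) :=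
    Reaches.scratch r2.steps.bdd r2.pc r2.rep (step_eq a3 r2.pc) (by simp [temp])
      (by rw [v2]; omega) (by rw [v2]; omega)
  refine ⟨_, (r1.trans r2).trans r3, ?_, ?_⟩
  · rw [Config.set_reg, if_pos rfl, v2]
    omega
  · intro d' hd'
    rw [Config.set_reg, if_neg (by simp only [temp]; omega), hc2, Config.set_reg,
      if_neg (by simp [temp]), hc1, Config.set_reg, if_neg (by simp [temp])]

/-- Evaluation at depth d writes only scratch registers numbered d or more. This preserves the
operands that are waiting at smaller depths. -/
theorem code_correct (e : Expr) (hok : e.Ok B s) : ∀ {k d : ℕ} {c : Config}, At P k (e.code d) →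
    c.pc = k → c.Bdd B → Rep s c →
    ∃ c', Reaches P B c e.size (k + e.size) s c' ∧ c'.reg 0 = e.eval s ∧
      ∀ d' < d, c'.reg (temp d') = c.reg (temp d') := by
  induction e with
  | const z =>
    intro k d c hat hpc hb hr
    exact ⟨_, Reaches.scratch hb hpc hr (step_eq hat.cons.1 hpc) rfl hok.1 hok.2,
      by rw [Config.set_reg, if_pos rfl]; rfl,
      fun d' _ => by rw [Config.set_reg, if_neg (by simp [temp])]⟩
  | var x =>
    intro k d c hat hpc hb hr
    refine ⟨_, Reaches.scratch hb hpc hr (step_eq hat.cons.1 hpc) rfl (hb.le _).1 (hb.le _).2,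
      by rw [Config.set_reg, if_pos rfl]; exact hr.var x,
      fun d' _ => by rw [Config.set_reg, if_neg (by simp [temp])]⟩
  | add e f ihe ihf =>
    intro k d c hat hpc hb hr
    exact binary_correct .add (· + ·) (fun _ _ => rfl) (ihe hok.1) (ihf hok.2.1) hat hpc hb hr
      hok.2.2.1 hok.2.2.2
  | sub e f ihe ihf =>
    intro k d c hat hpc hb hr
    exact binary_correct .sub (· - ·) (fun _ _ => rfl) (ihe hok.1) (ihf hok.2.1) hat hpc hb hr
      hok.2.2.1 hok.2.2.2
  | mul e f ihe ihf =>
    intro k d c hat hpc hb hr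
    exact binary_correct .mult (· * ·) (fun _ _ => rfl) (ihe hok.1) (ihf hok.2.1) hat hpc hb hr
      hok.2.2.1 hok.2.2.2
  | get j e ih =>
    intro k d c hat hpc hb hr
    obtain ⟨a1, a2⟩ := hat.append
    obtain ⟨a2, a3⟩ := a2.append
    have a3 := a3.cons.1
    rw [length_code] at a2 a3
    obtain ⟨c1, r1, v1, t1⟩ := ih hok.1 a1 hpc hb hr
    obtain ⟨c2, r2, v2, t2⟩ := address_correct a2 r1.pc r1.steps.bdd r1.rep v1 hok.2.1 hok.2.2
    have b2 := r2.steps.bdd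
    have hv : (Operand.indirect (temp d)).value c2.reg = some (s.a j (e.eval s).toNat) := by
      simp only [Operand.value, regOfInt, v2]
      rw [if_pos (by omega), Option.map_some, Int.toNat_natCast, r2.rep.arr]
    have hs : step P c2 = some (c2.set 0 (s.a j (e.eval s).toNat)) := by
      rw [step_eq a3 r2.pc, exec, hv, Option.map_some]
    have hbd := b2.le (16 * (e.eval s).toNat + (j.idx + 2))
    rw [r2.rep.arr] at hbd
    have r3 := Reaches.scratch b2 r2.pc r2.rep hs rfl hbd.1 hbd.2
    refine ⟨_, (r1.trans r2).trans r3, ?_, ?_⟩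
    · rw [Config.set_reg, if_pos rfl]
      rfl
    · intro d' hd'
      rw [Config.set_reg, if_neg (by simp [temp]), t2 d' hd', t1 d' hd']

end Expr

/-! ### Commands, their cost semantics and their compilation -/

/-- Commands. -/
inductive Cmd where
  | skip
  | assign (x : Var) (e : Expr)
  | put (j : Arr) (e f : Expr)
  | read (x : Var)
  | write (e : Expr)
  | seq (c d : Cmd)
  | ite (e : Expr) (c d : Cmd)
  | loop (e : Expr) (c : Cmd)

namespace Cmd

/-- The number of instructions for a command. -/
def size : Cmd → ℕ
  | skip => 0
  | assign _ e => e.size + 1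
  | put _ e f => e.size + 3 + f.size + 1
  | read _ => 1
  | write e => e.size + 1
  | seq c d => c.size + d.size
  | ite e c d => e.size + 1 + d.size + 1 + c.size
  | loop e c => e.size + 2 + c.size + 1

/-- The code for a command, to be placed at the given position. -/
def code : Cmd → ℕ → List Instr
  | skip, _ => []
  | assign x e, _ => e.code 0 ++ [.store (.direct (16 * x.idx + 1))]
  | put j e f, _ => e.code 0 ++ (Expr.address j 0 ++ (f.code 1 ++ [.store (.indirect (Expr.temp 0))]))
  | read x, _ => [.read (.direct (16 * x.idx + 1))]
  | write e, _ => e.code 0 ++ [.write (.direct 0)]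
  | seq c d, k => c.code k ++ d.code (k + c.size)
  | ite e c d, k => e.code 0 ++ (.jgtz (k + e.size + 1 + d.size + 1) ::
      (d.code (k + e.size + 1) ++ (.jump (k + e.size + 1 + d.size + 1 + c.size) ::
        c.code (k + e.size + 1 + d.size + 1))))
  | .loop e c, k => e.code 0 ++ (.jgtz (k + e.size + 2) :: .jump (k + e.size + 2 + c.size + 1) ::
      (c.code (k + e.size + 2) ++ [.jump k]))

theorem length_code (c : Cmd) (k : ℕ) : (c.code k).length = c.size := by
  induction c generalizing k <;>
    simp [code, size, Expr.length_code, Expr.address, *] <;> omega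

end Cmd

/-- Execution of a command, with cost and with all integers bounded by `B`. -/
inductive Big (B : ℤ) : Cmd → St → ℕ → St → Prop
  | skip {s : St} : Big B .skip s 0 s
  | assign {s : St} {x : Var} {e : Expr} : e.Ok B s → Big B (.assign x e) s (e.size + 1) (s.setV x (e.eval s))
  | put {s : St} {j : Arr} {e f : Expr} : e.Ok B s → f.Ok B s → 0 ≤ e.eval s → 16 * e.eval s + 16 ≤ B →
      Big B (.put j e f) s (e.size + 3 + f.size + 1) (s.setA j (e.eval s).toNat (f.eval s))
  | read {s : St} {x : Var} {z : ℤ} {l : List ℤ} : s.inp = z :: l → -B ≤ z → z ≤ B →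
      Big B (.read x) s 1 { s.setV x z with inp := l }
  | write {s : St} {e : Expr} : e.Ok B s → Big B (.write e) s (e.size + 1) { s with out := s.out ++ [e.eval s] }
  | seq {s s' s'' : St} {c d : Cmd} {t t' : ℕ} : Big B c s t s' → Big B d s' t' s'' → Big B (.seq c d) s (t + t') s''
  | ite_pos {s s' : St} {e : Expr} {c d : Cmd} {t : ℕ} : e.Ok B s → 0 < e.eval s → Big B c s t s' →
      Big B (.ite e c d) s (e.size + 1 + t) s'
  | ite_neg {s s' : St} {e : Expr} {c d : Cmd} {t : ℕ} : e.Ok B s → ¬ 0 < e.eval s → Big B d s t s' →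
      Big B (.ite e c d) s (e.size + 1 + t + 1) s'
  | while_pos {s s' s'' : St} {e : Expr} {c : Cmd} {t t' : ℕ} : e.Ok B s → 0 < e.eval s → Big B c s t s' →
      Big B (.loop e c) s' t' s'' → Big B (.loop e c) s (e.size + 1 + t + 1 + t') s''
  | while_neg {s : St} {e : Expr} {c : Cmd} : e.Ok B s → ¬ 0 < e.eval s → Big B (.loop e c) s (e.size + 2) s

theorem Rep.pc {s : St} {c : Config} (h : Rep s c) (k : ℕ) : Rep s { c with pc := k } :=
  ⟨h.var, h.arr, h.inp, h.out⟩

theorem Reaches.jump (hc : c.Bdd B) (hr : Rep s c) {k' : ℕ}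
    (hs : step P c = some { c with pc := k' }) : Reaches P B c 1 k' s { c with pc := k' } :=
  ⟨Steps.one hs hc hc, rfl, hr.pc k'⟩

/-- The costs in `Big` count machine instructions exactly, jumps included, so that nothing is lost
in the translation. -/
theorem Big.correct {C : Cmd} {s s' : St} {t : ℕ} (h : Big B C s t s') :
    ∀ {k : ℕ} {c : Config}, At P k (C.code k) → c.pc = k → c.Bdd B → Rep s c →
      ∃ c', Reaches P B c t (k + C.size) s' c' := by
  induction h with
  | skip =>
    intro k c _ hpc hb hr
    exact ⟨c, Steps.refl hb, hpc, hr⟩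
  | @assign s x e hok =>
    intro k c hat hpc hb hr
    obtain ⟨a1, a2⟩ := hat.append
    have a2 := a2.cons.1
    rw [Expr.length_code] at a2
    obtain ⟨c1, r1, v1, -⟩ := e.code_correct hok a1 hpc hb hr
    have b1 := r1.steps.bdd
    refine ⟨c1.set (16 * x.idx + 1) (c1.reg 0), r1.steps.trans (Steps.one (step_eq a2 r1.pc) b1
      (b1.set (b1.le 0).1 (b1.le 0).2)), by rw [Config.set_pc, r1.pc]; rfl, ?_⟩
    rw [← v1]
    exact r1.rep.set_var x _
  | @put s j e f hok hok' h0 hB =>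
    intro k c hat hpc hb hr
    obtain ⟨a1, a2⟩ := hat.append
    obtain ⟨a2, a3⟩ := a2.append
    obtain ⟨a3, a4⟩ := a3.append
    have a4 := a4.cons.1
    rw [Expr.length_code] at a2 a3 a4
    rw [Expr.length_code] at a4
    obtain ⟨c1, r1, v1, -⟩ := e.code_correct hok a1 hpc hb hr
    obtain ⟨c2, r2, v2, -⟩ := Expr.address_correct a2 r1.pc r1.steps.bdd r1.rep v1 h0 hB
    obtain ⟨c3, r3, v3, t3⟩ := f.code_correct hok' a3 r2.pc r2.steps.bdd r2.rep
    have b3 := r3.steps.bdd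
    have e3 := (t3 0 (by omega)).trans v2
    have hs : step P c3 = some (c3.set (16 * (e.eval s).toNat + (j.idx + 2)) (c3.reg 0)) := by
      have hv : (Dest.indirect (Expr.temp 0)).register c3.reg =
          some (16 * (e.eval s).toNat + (j.idx + 2)) := by
        simp only [Dest.register, regOfInt, e3]
        rw [if_pos (by omega), Int.toNat_natCast]
      rw [step_eq a4 r3.pc, exec, hv, Option.map_some]
    refine ⟨_, ((r1.trans r2).trans r3).steps.trans (Steps.one hs b3
      (b3.set (b3.le 0).1 (b3.le 0).2)), ?_, ?_⟩
    · have hl : (Expr.address j 0).length = 3 := rfl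
      rw [Config.set_pc, r3.pc, Cmd.size]
      omega
    · rw [← v3]
      exact r3.rep.set_arr j _ _
  | @read s x z l hz h1 h2 =>
    intro k c hat hpc hb hr
    have hs : step P c = some { c.set (16 * x.idx + 1) z with input := l } := by
      rw [step_eq hat.cons.1 hpc]
      simp [exec, Dest.register, hr.inp, hz]
    have hr' := hr.set_var x z
    refine ⟨_, Steps.one hs hb (hb.set h1 h2), ?_, hr'.var, hr'.arr, rfl, hr.out⟩
    simp [Config.set_pc, hpc, Cmd.size]
  | @write s e hok =>
    intro k c hat hpc hb hr
    obtain ⟨a1, a2⟩ := hat.append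
    have a2 := a2.cons.1
    rw [Expr.length_code] at a2
    obtain ⟨c1, r1, v1, -⟩ := e.code_correct hok a1 hpc hb hr
    have b1 := r1.steps.bdd
    refine ⟨{ c1 with pc := c1.pc + 1, output := c1.output ++ [c1.reg 0] },
      r1.steps.trans (Steps.one (step_eq a2 r1.pc) b1 b1), by simp [r1.pc, Cmd.size]; omega,
      r1.rep.var, r1.rep.arr, r1.rep.inp, ?_⟩
    rw [v1, r1.rep.out]
  | seq _ _ ih1 ih2 =>
    intro k c hat hpc hb hr
    obtain ⟨a1, a2⟩ := hat.append
    rw [Cmd.length_code] at a2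
    obtain ⟨c1, r1⟩ := ih1 a1 hpc hb hr
    obtain ⟨c2, r2⟩ := ih2 a2 r1.pc r1.steps.bdd r1.rep
    refine ⟨c2, ?_⟩
    rw [Cmd.size, ← add_assoc]
    exact r1.trans r2
  | @ite_pos s s' e C D t hok hp _ ih =>
    intro k c hat hpc hb hr
    obtain ⟨a1, a2⟩ := hat.append
    obtain ⟨a2, a3⟩ := a2.cons
    obtain ⟨a3, a4⟩ := a3.append
    obtain ⟨a4, a5⟩ := a4.cons
    rw [Expr.length_code] at a2 a3 a4 a5
    rw [Cmd.length_code] at a4 a5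
    obtain ⟨c1, r1, v1, -⟩ := e.code_correct hok a1 hpc hb hr
    have r2 := Reaches.jump r1.steps.bdd r1.rep (k' := k + e.size + 1 + D.size + 1) (by
      rw [step_eq a2 r1.pc, exec, v1, if_pos hp])
    obtain ⟨c3, r3⟩ := ih a5 r2.pc r2.steps.bdd r2.rep
    refine ⟨c3, ?_⟩
    have := (r1.trans r2).trans r3
    rw [Cmd.size, show k + (e.size + 1 + D.size + 1 + C.size) =
      k + e.size + 1 + D.size + 1 + C.size by omega]
    exact this
  | @ite_neg s s' e C D t hok hp _ ih =>
    intro k c hat hpc hb hr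
    obtain ⟨a1, a2⟩ := hat.append
    obtain ⟨a2, a3⟩ := a2.cons
    obtain ⟨a3, a4⟩ := a3.append
    obtain ⟨a4, a5⟩ := a4.cons
    rw [Expr.length_code] at a2 a3 a4 a5
    rw [Cmd.length_code] at a4 a5
    obtain ⟨c1, r1, v1, -⟩ := e.code_correct hok a1 hpc hb hr
    have r2 := Reaches.jump r1.steps.bdd r1.rep (k' := k + e.size + 1) (by
      rw [step_eq a2 r1.pc, exec, v1, if_neg hp, r1.pc])
    obtain ⟨c3, r3⟩ := ih a3 r2.pc r2.steps.bdd r2.rep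
    have r4 := Reaches.jump r3.steps.bdd r3.rep (k' := k + e.size + 1 + D.size + 1 + C.size) (by
      rw [step_eq a4 r3.pc, exec])
    have := ((r1.trans r2).trans r3).trans r4
    rw [Cmd.size, show k + (e.size + 1 + D.size + 1 + C.size) =
      k + e.size + 1 + D.size + 1 + C.size by omega]
    exact ⟨_, this⟩
  | @while_pos s s' s'' e C t t' hok hp _ _ ih1 ih2 =>
    intro k c hat hpc hb hr
    obtain ⟨a1, a2⟩ := hat.append
    obtain ⟨a2, a3⟩ := a2.cons
    obtain ⟨-, a4⟩ := a3.cons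
    obtain ⟨a4, a5⟩ := a4.append
    have a5 := a5.cons.1
    rw [Expr.length_code] at a2 a4 a5
    rw [Cmd.length_code] at a5
    obtain ⟨c1, r1, v1, -⟩ := e.code_correct hok a1 hpc hb hr
    have r2 := Reaches.jump r1.steps.bdd r1.rep (k' := k + e.size + 2) (by
      rw [step_eq a2 r1.pc, exec, v1, if_pos hp])
    obtain ⟨c3, r3⟩ := ih1 a4 r2.pc r2.steps.bdd r2.rep
    have r4 := Reaches.jump r3.steps.bdd r3.rep (k' := k) (by
      rw [step_eq a5 (r3.pc.trans (by omega)), exec])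
    obtain ⟨c5, r5⟩ := ih2 hat r4.pc r4.steps.bdd r4.rep
    exact ⟨c5, (((r1.trans r2).trans r3).trans r4).trans r5⟩
  | @while_neg s e C hok hp =>
    intro k c hat hpc hb hr
    obtain ⟨a1, a2⟩ := hat.append
    obtain ⟨a2, a3⟩ := a2.cons
    have a3 := a3.cons.1
    rw [Expr.length_code] at a2 a3
    obtain ⟨c1, r1, v1, -⟩ := e.code_correct hok a1 hpc hb hr
    have r2 := Reaches.jump r1.steps.bdd r1.rep (k' := k + e.size + 1) (by
      rw [step_eq a2 r1.pc, exec, v1, if_neg hp, r1.pc])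
    have r3 := Reaches.jump r2.steps.bdd r2.rep (k' := k + e.size + 2 + C.size + 1) (by
      rw [step_eq a3 r2.pc, exec])
    have := (r1.trans r2).trans r3
    rw [Cmd.size, show k + (e.size + 2 + C.size + 1) = k + e.size + 2 + C.size + 1 by omega]
    exact ⟨_, this⟩

/-- The initial state. -/
def St.init (inp : List ℤ) : St := ⟨fun _ => 0, fun _ _ => 0, inp, []⟩

/-- The zero registers at the start represent a state in which all variables and arrays vanish, and
the final `halt` ends the run without a further step. -/
theorem Big.haltsWith {C : Cmd} {inp : List ℤ} {t : ℕ} {s' : St} {B : ℕ}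
    (h : Big B C (St.init inp) t s') :
    HaltsWith (C.code 0 ++ [.halt]) inp s'.out t ∧
      RegistersBoundedBy (C.code 0 ++ [.halt]) inp B := by
  have hat : At (C.code 0 ++ [.halt]) 0 (C.code 0 ++ [.halt]) := fun i a hi => by rwa [zero_add]
  obtain ⟨a1, a2⟩ := hat.append
  rw [Cmd.length_code] at a2
  obtain ⟨c, r⟩ := h.correct (c := start inp) a1 rfl (fun r => by simp [start])
    ⟨fun _ => rfl, fun _ _ => rfl, rfl, rfl⟩
  have hs : step (C.code 0 ++ [.halt]) c = none := by
    rw [step_eq a2.cons.1 r.pc, exec]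
  exact ⟨⟨c, r.steps.run_eq, hs, r.rep.out⟩, fun k c' hk => r.steps.bdd_of_run hs hk⟩

end RAM

/-! ### Rules for bounding the running time of commands -/

namespace RAM

set_option linter.constructorNameAsVariable false

/-- Started in the state `s`, the command finishes within time `T` in a state that satisfies `Q`. -/
def Runs (B : ℤ) (c : Cmd) (s : St) (T : ℕ) (Q : St → Prop) : Prop :=
  ∃ t s', t ≤ T ∧ Big B c s t s' ∧ Q s'

namespace Cmd

/-- Sequential composition of a list of commands. -/
def block : List Cmd → Cmd
  | [] => skip
  | [c] => c
  | c :: l => seq c (block l)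

/-- The counting loop. -/
def forL (x : Var) (e : Expr) (c : Cmd) : Cmd :=
  seq (assign x (.const 0)) (loop (.sub e (.var x)) (seq c (assign x (.add (.var x) (.const 1)))))

/-- The effect of a command without loops and input or output. -/
def exec : Cmd → St → St
  | assign x e, s => s.setV x (e.eval s)
  | put j e f, s => s.setA j (e.eval s).toNat (f.eval s)
  | seq c d, s => d.exec (c.exec s)
  | ite e c d, s => if 0 < e.eval s then c.exec s else d.exec s
  | _, s => s

/-- A command without loops and input or output can be executed. -/
def Ok (B : ℤ) : Cmd → St → Prop
  | skip, _ => True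
  | assign _ e, s => e.Ok B s
  | put _ e f, s => e.Ok B s ∧ f.Ok B s ∧ 0 ≤ e.eval s ∧ 16 * e.eval s + 16 ≤ B
  | seq c d, s => c.Ok B s ∧ d.Ok B (c.exec s)
  | ite e c d, s => e.Ok B s ∧ (0 < e.eval s → c.Ok B s) ∧ (¬ 0 < e.eval s → d.Ok B s)
  | _, _ => False

/-- The cost of a command without loops. -/
def cost : Cmd → ℕ
  | skip => 0
  | assign _ e => e.size + 1
  | put _ e f => e.size + 3 + f.size + 1
  | seq c d => c.cost + d.cost
  | ite e c d => e.size + 2 + max c.cost d.cost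
  | _ => 0

end Cmd

variable {B : ℤ} {s : St} {T T' : ℕ} {Q Q' : St → Prop} {c d : Cmd}

theorem Runs.mono (h : Runs B c s T Q) (hT : T ≤ T') (hQ : ∀ s, Q s → Q' s) : Runs B c s T' Q' := by
  obtain ⟨t, s', h1, h2, h3⟩ := h
  exact ⟨t, s', h1.trans hT, h2, hQ _ h3⟩

theorem Runs.seq (h : Runs B c s T fun s' => Runs B d s' T' Q) : Runs B (.seq c d) s (T + T') Q := by
  obtain ⟨t, s', h1, h2, t', s'', h3, h4, h5⟩ := h
  exact ⟨t + t', s'', by omega, h2.seq h4, h5⟩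

theorem Runs.block_cons {l : List Cmd}
    (h : Runs B c s T fun s' => Runs B (.block (d :: l)) s' T' Q) :
    Runs B (.block (c :: d :: l)) s (T + T') Q := h.seq

/-- Loop-free code is handled by symbolic execution: its effect is a function of the state, and its
cost is bounded by taking the dearer branch. -/
theorem Runs.straight (hok : c.Ok B s) (hQ : Q (c.exec s)) : Runs B c s c.cost Q := by
  suffices h : ∃ t, t ≤ c.cost ∧ Big B c s t (c.exec s) by
    obtain ⟨t, h1, h2⟩ := h
    exact ⟨t, _, h1, h2, hQ⟩
  clear hQ
  induction c generalizing s with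
  | skip => exact ⟨0, le_rfl, .skip⟩
  | assign x e => exact ⟨_, le_rfl, .assign hok⟩
  | put j e f => exact ⟨_, le_rfl, .put hok.1 hok.2.1 hok.2.2.1 hok.2.2.2⟩
  | read => exact hok.elim
  | write => exact hok.elim
  | seq c d ihc ihd =>
    obtain ⟨t, h1, h2⟩ := ihc hok.1
    obtain ⟨t', h3, h4⟩ := ihd hok.2
    exact ⟨_, add_le_add h1 h3, h2.seq h4⟩
  | ite e c d ihc ihd =>
    by_cases hp : 0 < e.eval s
    · obtain ⟨t, h1, h2⟩ := ihc (hok.2.1 hp)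
      refine ⟨_, ?_, by rw [Cmd.exec, if_pos hp]; exact h2.ite_pos hok.1 hp⟩
      rw [Cmd.cost]
      omega
    · obtain ⟨t, h1, h2⟩ := ihd (hok.2.2 hp)
      refine ⟨_, ?_, by rw [Cmd.exec, if_neg hp]; exact h2.ite_neg hok.1 hp⟩
      rw [Cmd.cost]
      omega
  | loop => exact hok.elim

theorem Runs.ite {e : Expr} (hok : e.Ok B s) (h1 : 0 < e.eval s → Runs B c s T Q)
    (h2 : ¬ 0 < e.eval s → Runs B d s T Q) : Runs B (.ite e c d) s (e.size + 2 + T) Q := by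
  by_cases hp : 0 < e.eval s
  · obtain ⟨t, s', h3, h4, h5⟩ := h1 hp
    exact ⟨_, s', by omega, h4.ite_pos hok hp, h5⟩
  · obtain ⟨t, s', h3, h4, h5⟩ := h2 hp
    exact ⟨_, s', by omega, h4.ite_neg hok hp, h5⟩

theorem Runs.read {x : Var} {z : ℤ} {l : List ℤ} (h : s.inp = z :: l) (h1 : -B ≤ z) (h2 : z ≤ B)
    (hQ : Q { s.setV x z with inp := l }) : Runs B (.read x) s 1 Q :=
  ⟨_, _, le_rfl, .read h h1 h2, hQ⟩

theorem Runs.write {e : Expr} (hok : e.Ok B s) (hQ : Q { s with out := s.out ++ [e.eval s] }) :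
    Runs B (.write e) s (e.size + 1) Q :=
  ⟨_, _, le_rfl, .write hok, hQ⟩

/-- Besides the body, an iteration evaluates e - x (size e + 3), tests it (1), increments x (5) and
jumps back (1), which makes size e + 10. The initial assignment costs 2 and the last test size e +
5. -/
theorem Runs.forL {x : Var} {e : Expr} (m : ℕ) (I : ℕ → St → Prop) (h0 : I 0 (s.setV x 0))
    (he : ∀ k ≤ m, ∀ s, I k s → s.v x = k → e.Ok B s ∧ e.eval s = m) (hB : (m : ℤ) + 1 ≤ B)
    (hbody : ∀ k < m, ∀ s, I k s → s.v x = k →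
      Runs B c s T fun s' => s'.v x = k ∧ I (k + 1) (s'.setV x (k + 1 : ℕ)))
    (hQ : ∀ s, I m s → s.v x = m → Q s) :
    Runs B (.forL x e c) s (m * (T + e.size + 10) + e.size + 7) Q := by
  -- Induction on the number r of iterations that remain.
  have key : ∀ r k : ℕ, k + r = m → ∀ s, I k s → s.v x = k →
      Runs B (.loop (.sub e (.var x)) (.seq c (.assign x (.add (.var x) (.const 1))))) s
        (r * (T + e.size + 10) + e.size + 5) Q := by
    intro r
    induction r with
    | zero =>
      intro k hk s hI hx
      obtain ⟨h1, h2⟩ := he k (by omega) s hI hx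
      rw [add_zero] at hk
      subst hk
      refine ⟨_, s, ?_, .while_neg ⟨h1, trivial, ?_, ?_⟩ ?_, hQ s hI hx⟩
      · simp [Expr.size]
      all_goals simp only [Expr.eval, h2, hx]; omega
    | succ r ih =>
      intro k hk s hI hx
      obtain ⟨h1, h2⟩ := he k (by omega) s hI hx
      obtain ⟨t, s', h3, h4, h5, h6⟩ := hbody k (by omega) s hI hx
      obtain ⟨t', s'', h7, h8, h9⟩ := ih (k + 1) (by omega) _ h6 (by simp)
      have h10 := Big.assign (B := B) (s := s') (x := x) (e := .add (.var x) (.const 1))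
        ⟨trivial, ⟨by omega, by omega⟩, by simp only [Expr.eval, h5]; omega,
          by simp only [Expr.eval, h5]; omega⟩
      have h11 : Expr.eval s' (.add (.var x) (.const 1)) = (k + 1 : ℕ) := by
        simp only [Expr.eval, h5]
        push_cast
        rfl
      rw [h11] at h10
      have h12 : Expr.eval s (.sub e (.var x)) = m - k := by simp only [Expr.eval, h2, hx]
      refine ⟨_, s'', ?_, .while_pos ⟨h1, trivial, ?_, ?_⟩ (by rw [h12]; omega) (h4.seq h10) h8, h9⟩
      · simp only [Expr.size]
        rw [add_mul]
        omega
      · change -B ≤ Expr.eval s (.sub e (.var x))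
        rw [h12]
        omega
      · change Expr.eval s (.sub e (.var x)) ≤ B
        rw [h12]
        omega
  obtain ⟨t, s', h1, h2, h3⟩ := key m 0 (by omega) _ h0 (by simp)
  refine ⟨_, s', ?_, (Big.assign (s := s) (x := x) (e := .const 0) ⟨by omega, by omega⟩).seq h2, h3⟩
  simp only [Expr.size]
  omega

/-- The states agree except for the given variables and arrays. -/
structure Frame (V : List Var) (A : List Arr) (s s' : St) : Prop where
  v : ∀ y, y ∉ V → s'.v y = s.v y
  a : ∀ j, j ∉ A → s'.a j = s.a j
  inp : s'.inp = s.inp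
  out : s'.out = s.out

namespace Frame

variable {V V' : List Var} {A A' : List Arr} {s s' s'' : St}

theorem refl (V : List Var) (A : List Arr) (s : St) : Frame V A s s :=
  ⟨fun _ _ => rfl, fun _ _ => rfl, rfl, rfl⟩

theorem trans (h : Frame V A s s') (h' : Frame V A s' s'') : Frame V A s s'' :=
  ⟨fun y hy => (h'.v y hy).trans (h.v y hy), fun j hj => (h'.a j hj).trans (h.a j hj),
    h'.inp.trans h.inp, h'.out.trans h.out⟩

theorem mono (h : Frame V A s s') (hV : V ⊆ V') (hA : A ⊆ A') : Frame V' A' s s' :=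
  ⟨fun y hy => h.v y fun h => hy (hV h), fun j hj => h.a j fun h => hj (hA h), h.inp, h.out⟩

theorem setV (h : Frame V A s s') {y : Var} (hy : y ∈ V) (z : ℤ) : Frame V A s (s'.setV y z) :=
  ⟨fun w hw => by rw [St.setV_v, if_neg (fun e : w = y => hw (e ▸ hy)), h.v w hw], h.a, h.inp, h.out⟩

theorem setArr (h : Frame V A s s') {j : Arr} (hj : j ∈ A) (f : ℕ → ℤ) :
    Frame V A s (s'.setArr j f) :=
  ⟨h.v, fun l hl => by rw [St.setArr_a, if_neg (fun e : l = j => hl (e ▸ hj)), h.a l hl], h.inp, h.out⟩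

theorem setA (h : Frame V A s s') {j : Arr} (hj : j ∈ A) (r : ℕ) (z : ℤ) :
    Frame V A s (s'.setA j r z) := h.setArr hj _

end Frame

/-- A loop that fills an array. -/
theorem Runs.fill {e1 e2 : Expr} {A : Arr} {n : ℕ} (idx : Fin n → ℕ) (val : Fin n → ℤ)
    (hn : s.v .n = n) (hB : (n : ℤ) + 1 ≤ B) (hA : ∀ k l, idx k = idx l → val k = val l)
    (h1 : ∀ (k : Fin n) f, e1.Ok B ((s.setV .x (k : ℕ)).setArr A f) ∧
      e1.eval ((s.setV .x (k : ℕ)).setArr A f) = idx k ∧ 16 * (idx k : ℤ) + 16 ≤ B)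
    (h2 : ∀ (k : Fin n) f, e2.Ok B ((s.setV .x (k : ℕ)).setArr A f) ∧
      e2.eval ((s.setV .x (k : ℕ)).setArr A f) = val k)
    (hQ : ∀ s', Frame [.x] [A] s s' → (∀ k, s'.a A (idx k) = val k) →
      (∀ r, (∀ k, idx k ≠ r) → s'.a A r = s.a A r) → Q s') :
    Runs B (.forL .x (.var .n) (.put A e1 e2)) s (n * (e1.size + e2.size + 15) + 8) Q := by
  have key := Runs.forL (B := B) (s := s) (c := .put A e1 e2) (e := .var .n) (x := .x) (Q := Q)
    (T := e1.size + e2.size + 4) n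
    (fun k s' => ∃ f, s' = (s.setV .x k).setArr A f ∧ (∀ l : Fin n, (l : ℕ) < k → f (idx l) = val l) ∧
      ∀ r, (∀ l : Fin n, (l : ℕ) < k → idx l ≠ r) → f r = s.a A r)
    ⟨s.a A, by simp [St.setArr, St.setV], by simp, fun r _ => rfl⟩ ?_ hB ?_ ?_
  · exact key.mono (by
      simp only [Expr.size]
      rw [show e1.size + e2.size + 4 + 1 + 10 = e1.size + e2.size + 15 by omega])
      fun s h => h
  · rintro k hk _ ⟨f, rfl, -⟩ -
    exact ⟨trivial, by simp [Expr.eval, hn]⟩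
  · rintro k hk _ ⟨f, rfl, hf1, hf2⟩ -
    obtain ⟨ok1, ev1, b1⟩ := h1 ⟨k, hk⟩ f
    obtain ⟨ok2, ev2⟩ := h2 ⟨k, hk⟩ f
    refine (Runs.straight (c := .put A e1 e2)
      ⟨ok1, ok2, ev1 ▸ Int.natCast_nonneg _, by rw [ev1]; exact b1⟩
      ?_).mono (by simp only [Cmd.cost]; omega) fun s h => h
    refine ⟨by simp [Cmd.exec], Function.update f (idx ⟨k, hk⟩) (val ⟨k, hk⟩), ?_, ?_, ?_⟩
    · simp only [Cmd.exec, ev1, ev2, Int.toNat_natCast]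
      simp [St.setArr, St.setV, St.setA]
    · intro l hl
      rw [Function.update_apply]
      -- A cell may be written several times, provided that the values agree; this occurs when the
      -- table is cleared.
      split_ifs with h
      · exact hA _ _ h.symm
      · refine hf1 l (lt_of_le_of_ne (Nat.lt_succ_iff.1 hl) ?_)
        rintro rfl
        exact h rfl
    · intro r hr
      rw [Function.update_of_ne (hr ⟨k, hk⟩ (Nat.lt_succ_self k)).symm]
      exact hf2 r fun l hl => hr l (by omega)
  · rintro _ ⟨f, rfl, hf1, hf2⟩ -
    refine hQ _ (((Frame.refl _ _ s).setV (by simp) _).setArr (by simp) f) (fun k => ?_)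
      fun r hr => ?_
    · simp [hf1 k k.2]
    · simp [hf2 r fun l _ => hr l]

/-! ### The program -/

namespace Prog

open Cmd RAM.Expr

/-- The current value of the inner loop variable. -/
abbrev X : Expr := .var .x

/-- The label of every element is the least element of its cycle. -/
def label (src dst : Arr) : Cmd :=
  block [forL .x (var .n) (put dst X X),
    forL .x (var .n) (ite (sub (get src X) X) (put dst (get src X) (get dst X)) skip)]

/-- The meet of two noncrossing permutations, from the keys of the intersections of their cycles. -/
def meet : Cmd :=
  forL .x (var .n) (block [assign .q (get .tbl (get .ui X)), put .m X X,
    ite (var .q) (seq (put .m X (get .m (sub (var .q) (const 1)))) (put .m (sub (var .q) (const 1)) X))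
      skip,
    put .tbl (get .ui X) (add X (const 1))])

/-- Multiply the permutation `u` to the permutation at position `t` in the sequence, and replace
`u` by the carry. -/
def slide : Cmd := block [
  forL .x (var .n) (put .ui (get .u X) X),
  forL .x (var .n) (put .d X (get .ui (add X (const 1)))),
  put .d (sub (var .n) (const 1)) (get .ui (const 0)),
  label .d .la,
  forL .x (var .n) (put .row X (get .seq (add (var .t) X))),
  label .row .lb,
  forL .x (var .n) (put .ui X (add (mul (get .la X) (var .n)) (get .lb X))),
  meet,
  forL .x (var .n) (put .tbl (get .ui X) (const 0)),
  forL .x (var .n) (put .mi (get .m X) X),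
  forL .x (var .n) (put .seq (add (var .t) X) (get .u (get .m X))),
  forL .x (var .n) (put .u X (get .mi (get .row X)))]

/-- Reduce a variable modulo `n`. -/
def reduce (y : Var) : Cmd :=
  ite (sub (var y) (sub (var .n) (const 1))) (assign y (sub (var y) (var .n))) skip

/-- The permutation `u` for a letter. -/
def letter : Cmd := block [
  assign .t (add (sub (var .n) (var .t)) (var .shift)), reduce .t,
  assign .s (add (sub (var .n) (var .s)) (var .shift)), reduce .s,
  forL .x (var .n) (put .d X X),
  put .d (var .t) (var .s),
  put .d (var .s) (var .t),
  ite (var .e) (forL .x (var .n) (put .u X (get .d X)))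
    (block [forL .x (var .n) (put .ui X (add X (const 1))),
      put .ui (sub (var .n) (const 1)) (const 0),
      forL .x (var .n) (put .u X (get .ui (get .d X))),
      assign .k (add (var .k) (const 1)),
      assign .shift (add (var .shift) (const 1)), reduce .shift])]

/-- Multiply by a letter. -/
def push : Cmd := block [
  letter,
  forL .i (var .len) (seq (assign .t (mul (var .i) (var .n))) slide),
  assign .t (mul (var .len) (var .n)),
  forL .x (var .n) (put .seq (add (var .t) X) (get .u X)),
  assign .len (add (var .len) (const 1))]

/-- Read a letter. -/
def readLetter : Cmd := block [read .t, read .s, read .e]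

/-- Read the first word. -/
def readFirst : Cmd :=
  forL .j (var .cnt) (block [
    readLetter,
    assign .q (mul (var .j) (const 3)),
    put .letters (var .q) (var .t),
    put .letters (add (var .q) (const 1)) (var .s),
    put .letters (add (var .q) (const 2)) (var .e)])

/-- Multiply by the letters of the first word, from right to left. -/
def pushFirst : Cmd :=
  forL .j (var .cnt) (block [
    assign .q (mul (sub (sub (var .cnt) (const 1)) (var .j)) (const 3)),
    assign .t (get .letters (var .q)),
    assign .s (get .letters (add (var .q) (const 1))),
    assign .e (get .letters (add (var .q) (const 2))),
    push])

/-- Multiply by the inverses of the letters of the second word, from left to right. -/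
def pushSecond : Cmd :=
  forL .j (var .cnt) (block [readLetter, assign .e (sub (const 0) (var .e)), push])

/-- Compare the sequence with a power of the Garside element. -/
def compare : Cmd := block [
  forL .x (var .n) (put .d X (add X (const 1))),
  put .d (sub (var .n) (const 1)) (const 0),
  assign .ans (const 1),
  forL .i (var .len) (block [
    assign .t (mul (var .i) (var .n)),
    forL .x (var .n) (block [
      assign .q (get .seq (add (var .t) X)),
      ite (sub (var .k) (var .i)) (assign .q (sub (var .q) (get .d X))) (assign .q (sub (var .q) X)),
      ite (mul (var .q) (var .q)) (assign .ans (const 0)) skip])]),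
  write (var .ans)]

/-- The program for the word problem. -/
def main : Cmd := block [read .n, read .cnt, readFirst, pushFirst, read .cnt, pushSecond, compare]

end Prog

end RAM

/-! ### Correctness of the program -/

namespace AbsoluteOrder

open Equiv

variable {n : ℕ}

/-- The element reached by going back along a cycle as long as this decreases. -/
def lab (σ : Perm (Fin n)) (y : Fin n) : Fin n :=
  if σ⁻¹ y < y then lab σ (σ⁻¹ y) else y
termination_by y

theorem lab_of_lt {σ : Perm (Fin n)} {y : Fin n} (h : σ⁻¹ y < y) : lab σ y = lab σ (σ⁻¹ y) := by
  rw [lab, if_pos h]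

theorem lab_of_not_lt {σ : Perm (Fin n)} {y : Fin n} (h : ¬ σ⁻¹ y < y) : lab σ y = y := by
  rw [lab, if_neg h]

theorem lab_spec (σ : Perm (Fin n)) (y : Fin n) :
    σ.SameCycle (lab σ y) y ∧ ¬ σ⁻¹ (lab σ y) < lab σ y := by
  induction y using WellFoundedLT.induction with
  | ind y ih =>
    by_cases h : σ⁻¹ y < y
    · rw [lab_of_lt h]
      exact ⟨Perm.sameCycle_symm_apply_right.1 (ih _ h).1, (ih _ h).2⟩
    · rw [lab_of_not_lt h]
      exact ⟨Perm.SameCycle.refl _ _, h⟩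

/-- For a noncrossing permutation only the least element of a cycle is preceded by a larger or equal
one, since `mem_Ico_iff` puts the predecessor of any other element below it. So `lab` is the minimum
of the cycle. -/
theorem lab_eq_iff {σ : Perm (Fin n)} (hσ : NC σ) {y z : Fin n} :
    lab σ y = lab σ z ↔ σ.SameCycle y z := by
  constructor
  · intro h
    exact ((lab_spec σ y).1.symm.trans (h ▸ Perm.SameCycle.refl _ _)).trans (lab_spec σ z).1
  · intro h
    have key : ∀ y z, σ.SameCycle y z → lab σ y ≤ lab σ z := by
      intro y z h
      by_contra! hlt
      have hc := ((lab_spec σ z).1.trans h.symm).trans (lab_spec σ y).1.symm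
      refine (lab_spec σ y).2 ((hσ.mem_Ico_iff hlt hc _).2 ?_).2
      rw [show σ (σ⁻¹ (lab σ y)) = lab σ y from σ.apply_symm_apply _]
      exact ⟨hlt, _root_.le_refl _⟩
    exact le_antisymm (key _ _ h) (key _ _ h.symm)

/-- The array lists the values of the map. -/
def IsArr (f : ℕ → ℤ) (σ : Fin n → Fin n) : Prop := ∀ k : Fin n, f k = ((σ k : ℕ) : ℤ)

end AbsoluteOrder

/-! ### Cycle labels and meets in linear time -/

namespace RAM

open AbsoluteOrder Equiv

variable {n : ℕ} {B : ℤ} {s : St} {T T' : ℕ} {Q Q' : St → Prop} {c d : Cmd}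

theorem Runs.block_one (h : Runs B c s T Q) : Runs B (.block [c]) s T Q := h

/-- One increasing pass suffices: a label travels only from x to a larger σ x, and by the time x is
visited its own label is final. After k steps exactly the labels of those y with σ⁻¹ y < k need be
settled; the others still hold y. -/
theorem runs_label {src dst : Arr} (hne : src ≠ dst) (hn : s.v .n = n) (hB : 16 * (n : ℤ) + 32 ≤ B)
    {σ : Perm (Fin n)} (hsrc : IsArr (s.a src) σ)
    (hQ : ∀ s', Frame [.x] [dst] s s' → IsArr (s'.a dst) (lab σ) → Q s') :
    Runs B (Prog.label src dst) s (n * 60 + 20) Q := by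
  apply Runs.mono
  case hQ => exact fun _ h => h
  · apply Runs.block_cons
    apply Runs.fill (n := n) (fun k => k) (fun k => (k : ℕ)) hn
    · omega
    · intro k l h
      simp [h]
    · intro k f
      have := k.2
      exact ⟨trivial, by simp [Expr.eval], by omega⟩
    · intro k f
      exact ⟨trivial, by simp [Expr.eval]⟩
    intro s1 h1 hs1 _
    apply Runs.block_one
    refine Runs.forL (T := 26) n (fun k s' => Frame [.x] [dst] s s' ∧
      ∀ y : Fin n, s'.a dst y = ((if (σ⁻¹ y : ℕ) < k then lab σ y else y : Fin n) : ℕ))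
        ⟨h1.setV (by simp) _, ?_⟩ ?_ (by omega) ?_ ?_
    · intro y
      simp [hs1]
    · rintro k hk s' ⟨h2, -⟩ -
      exact ⟨trivial, by simp [Expr.eval, h2.v, hn]⟩
    · rintro k hk s' ⟨h2, hf⟩ hx
      have e1 : s'.a src k = (σ ⟨k, hk⟩ : ℕ) := by
        rw [h2.a _ (by simpa using hne)]
        exact hsrc ⟨k, hk⟩
      have hw := (σ ⟨k, hk⟩).2
      refine (Runs.straight ?_ ?_).mono (by simp [Cmd.cost, Expr.size]) fun _ h => h
      · simp [Cmd.Ok, Expr.Ok, Expr.eval, hx, e1]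
        omega
      · simp only [Cmd.exec, Expr.eval, hx, Int.toNat_natCast, e1]
        have hk' : σ⁻¹ (σ ⟨k, hk⟩) = ⟨k, hk⟩ := σ.symm_apply_apply _
        have step : ∀ y : Fin n, y ≠ σ ⟨k, hk⟩ →
            ((σ⁻¹ y : ℕ) < k + 1 ↔ (σ⁻¹ y : ℕ) < k) := by
          intro y hy
          have : (σ⁻¹ y : ℕ) ≠ k := by
            intro h
            apply hy
            rw [show (⟨k, hk⟩ : Fin n) = σ⁻¹ y from Fin.ext h.symm]
            exact (σ.apply_symm_apply _).symm
          omega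
        have hlab : s'.a dst k = (lab σ ⟨k, hk⟩ : ℕ) := by
          have := hf ⟨k, hk⟩
          split_ifs at this with h
          · exact this
          · rw [lab_of_not_lt (by rwa [Fin.lt_def])]
            exact this
        have hstep : (if (σ ⟨k, hk⟩ : ℕ) > k then lab σ ⟨k, hk⟩ else σ ⟨k, hk⟩) =
            lab σ (σ ⟨k, hk⟩) := by
          split_ifs with h
          · rw [lab_of_lt (y := σ ⟨k, hk⟩) (by rw [hk']; exact h), hk']
          · rw [lab_of_not_lt]
            rw [hk']
            exact h
        split_ifs with h
        · refine ⟨by simp [hx], (h2.setA (by simp) _ _).setV (by simp) _, fun y => ?_⟩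
          rw [if_pos (by omega)] at hstep
          rw [St.setV_a, St.setA_a, if_pos rfl]
          by_cases hy : y = σ ⟨k, hk⟩
          · subst hy
            rw [Function.update_self, hk', if_pos (Nat.lt_succ_self k), ← hstep, hlab]
          · rw [Function.update_of_ne (fun h => hy (Fin.ext h)), hf]
            simp only [step y hy]
        · refine ⟨hx, h2.setV (by simp) _, fun y => ?_⟩
          rw [if_neg (by omega)] at hstep
          rw [St.setV_a]
          rw [hf]
          by_cases hy : y = σ ⟨k, hk⟩
          · subst hy
            rw [hk', if_pos (Nat.lt_succ_self k), if_neg (Nat.lt_irrefl k), ← hstep]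
          · simp only [step y hy]
    · rintro s' ⟨h2, hf⟩ -
      exact hQ s' h2 fun k => by rw [hf, if_pos (σ⁻¹ k).2]
  · simp [Expr.size]
    omega

/-- The table cell of a key holds one more than the last visited element of that class, and 0 if
there is none. So the predecessor p used in `classPermAux` is found in constant time, and the two
assignments to m perform the multiplication by the transposition. -/
theorem runs_meet {E : Fin n → Fin n → Prop} (hE : Equivalence E) (key : Fin n → ℕ)
    (hkey : ∀ k l, key k = key l ↔ E k l) (hkB : ∀ k, 16 * (key k : ℤ) + 16 ≤ B)
    (hn : s.v .n = n) (hB : 16 * (n : ℤ) + 32 ≤ B) (hui : ∀ k : Fin n, s.a .ui k = key k)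
    (htbl : ∀ r, s.a .tbl r = 0)
    (hQ : ∀ s', Frame [.x, .q] [.m, .tbl] s s' → IsArr (s'.a .m) (classPerm E) →
      (∀ r, (∀ k, key k ≠ r) → s'.a .tbl r = 0) → Q s') :
    Runs B Prog.meet s (n * 80 + 20) Q := by
  apply Runs.mono
  case hQ => exact fun _ h => h
  · apply Runs.forL (T := 67) n (fun k s' => Frame [.x, .q] [.m, .tbl] s s' ∧
      (∀ y : Fin n, (y : ℕ) < k → s'.a .m y = (classPermAux E k y : ℕ)) ∧
      (∀ y l : Fin n, (l : ℕ) < k → E l y → (∀ l' : Fin n, (l' : ℕ) < k → E l' y → l' ≤ l) →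
        s'.a .tbl (key y) = (l : ℕ) + 1) ∧
      ∀ r, (∀ l : Fin n, (l : ℕ) < k → key l ≠ r) → s'.a .tbl r = 0)
    · exact ⟨(Frame.refl _ _ _).setV (by simp) _, by simp, by simp, by simp [htbl]⟩
    · rintro k hk s' ⟨h1, -⟩ -
      exact ⟨trivial, by simp [Expr.eval, h1.v, hn]⟩
    · omega
    · rintro k hk s' ⟨h1, h2, h3, h4⟩ hx
      obtain ⟨hspec1, hspec2⟩ := classPermAux_spec hE k hk.le
      have hui' : s'.a .ui k = key ⟨k, hk⟩ := by rw [h1.a _ (by simp)]; exact hui ⟨k, hk⟩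
      have hkB' := hkB ⟨k, hk⟩
      obtain ⟨p, hp⟩ : ∃ p, p = prevInClass E ⟨k, hk⟩ := ⟨_, rfl⟩
      have hsucc : classPermAux E (k + 1) = classPermAux E k * swap p ⟨k, hk⟩ := by
        rw [classPermAux, dif_pos hk, hp]
      have hps := prevInClass_spec E ⟨k, hk⟩
      rw [← hp] at hps
      have hq : s'.a .tbl (key ⟨k, hk⟩) = if (p : ℕ) < k then (p : ℕ) + 1 else 0 := by
        rcases hps with ⟨p1, p2⟩ | ⟨p1, p2, p3⟩
        · rw [if_neg (by rw [p1]; simp)]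
          exact h4 _ fun l hl h => p2 l hl ((hkey _ _).1 h)
        · rw [if_pos (Fin.lt_def.1 p1)]
          push_cast
          exact h3 _ _ p1 p2 p3
      -- After its cell has been overwritten, the class of k has k as its last element; the cells of
      -- other classes are untouched because their keys differ.
      have t1 : ∀ y l : Fin n, (l : ℕ) < k + 1 → E l y →
          (∀ l' : Fin n, (l' : ℕ) < k + 1 → E l' y → l' ≤ l) →
          Function.update (s'.a .tbl) (key ⟨k, hk⟩) (k + 1) (key y) = (l : ℕ) + 1 := by
        intro y l hl hly hmax
        by_cases h : E ⟨k, hk⟩ y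
        · rw [(hkey ⟨k, hk⟩ y).2 h, Function.update_self]
          have h5 : k ≤ l := hmax ⟨k, hk⟩ (Nat.lt_succ_self k) h
          rw [show (l : ℕ) = k by omega]
        · rw [Function.update_of_ne fun h' => h ((hkey _ _).1 h'.symm)]
          have h5 : (l : ℕ) ≠ k := by
            rintro rfl
            exact h hly
          exact h3 y l (by omega) hly fun l' hl' => hmax l' (by omega)
      have t2 : ∀ r, (∀ l : Fin n, (l : ℕ) < k + 1 → key l ≠ r) →
          Function.update (s'.a .tbl) (key ⟨k, hk⟩) ((k : ℤ) + 1) r = 0 := by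
        intro r hr
        rw [Function.update_of_ne (hr ⟨k, hk⟩ (Nat.lt_succ_self k)).symm]
        exact h4 r fun l hl => hr l (by omega)
      rcases hps with ⟨p1, -⟩ | ⟨p1, -⟩
      · rw [if_neg (by rw [p1]; simp)] at hq
        refine (Runs.straight ?_ ?_).mono (by simp [Cmd.cost, Cmd.block, Expr.size]) fun _ h => h
        · simp [Cmd.Ok, Expr.Ok, Expr.eval, Cmd.block, Cmd.exec, hx, hui', hq]
          have := p.2
          omega
        · simp [Expr.eval, Cmd.block, Cmd.exec, hx, hui', hq]
          refine ⟨(((h1.setV (by simp) _).setA (by simp) _ _).setA (by simp) _ _).setV (by simp) _,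
            fun y hy => ?_,
            fun y l hl h h' => t1 y l (by omega) h fun l' hl' => h' l' (by omega),
            fun r hr => t2 r fun l hl => hr l (by omega)⟩
          rw [hsucc, p1, swap_self, Perm.mul_apply, Equiv.refl_apply]
          by_cases hy' : (y : ℕ) = k
          · rw [hspec1 y hy'.ge, hy', Function.update_self]
          · rw [Function.update_of_ne hy', h2 y (by omega)]
      · rw [if_pos (Fin.lt_def.1 p1)] at hq
        push_cast at hq
        refine (Runs.straight ?_ ?_).mono (by simp [Cmd.cost, Cmd.block, Expr.size]) fun _ h => h
        · simp [Cmd.Ok, Expr.Ok, Expr.eval, Cmd.block, Cmd.exec, hx, hui', hq]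
          have := p.2
          omega
        · simp [Expr.eval, Cmd.block, Cmd.exec, hx, hui', hq]
          refine ⟨(((((h1.setV (by simp) _).setA (by simp) _ _).setA (by simp) _ _).setA (by simp)
            _ _).setA (by simp) _ _).setV (by simp) _, fun y hy => ?_,
            fun y l hl h h' => t1 y l (by omega) h fun l' hl' => h' l' (by omega),
            fun r hr => t2 r fun l hl => hr l (by omega)⟩
          have p1' : (p : ℕ) < k := p1
          rw [hsucc, Perm.mul_apply, Function.update_of_ne p1'.ne, h2 p p1']
          by_cases hy1 : (y : ℕ) = p
          · rw [hy1, Function.update_self, Fin.ext hy1, swap_apply_left, hspec1 _ le_rfl]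
          · rw [Function.update_of_ne hy1]
            by_cases hy2 : (y : ℕ) = k
            · rw [hy2, Function.update_self, show y = ⟨k, hk⟩ from Fin.ext hy2, swap_apply_right]
            · rw [Function.update_of_ne hy2, swap_apply_of_ne_of_ne (fun e => hy1 (congrArg Fin.val e))
                (fun e => hy2 (congrArg Fin.val e)), h2 y (by omega)]
    · rintro s' ⟨h1, h2, h3, h4⟩ -
      exact hQ s' h1 (fun k => h2 k k.2) fun r hr => h4 r fun l _ => hr l
  · simp [Expr.size]
    omega

end RAM

/-! ### One step of a sweep in linear time -/

namespace RAM

open AbsoluteOrder Equiv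

variable {n : ℕ} {B : ℤ} {s : St} {T T' : ℕ} {Q Q' : St → Prop} {c d : Cmd}

/-- Filling an initial part of an array. -/
theorem Runs.fillX {e2 : Expr} {A : Arr} (val : Fin n → ℤ) (hn : s.v .n = n)
    (hB : 16 * (n : ℤ) + 32 ≤ B)
    (h2 : ∀ (k : Fin n) f, e2.Ok B ((s.setV .x (k : ℕ)).setArr A f) ∧
      e2.eval ((s.setV .x (k : ℕ)).setArr A f) = val k)
    (hQ : ∀ s', Frame [.x] [A] s s' → (∀ k : Fin n, s'.a A k = val k) → Q s') :
    Runs B (.forL .x (.var .n) (.put A Prog.X e2)) s (n * (e2.size + 16) + 8) Q := by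
  have := Runs.fill (Q := Q) (e1 := Prog.X) (e2 := e2) (A := A) (fun k : Fin n => k) val hn
    (by omega) (fun k l h => by rw [Fin.ext h]) (fun k f => ⟨trivial, by simp [Expr.eval], by
      have := k.2
      omega⟩) h2 fun s' h1 h2 _ => hQ s' h1 h2
  rwa [show Prog.X.size + e2.size + 15 = e2.size + 16 by simp [Expr.size]; omega] at this

/-- The inverse of a permutation. -/
theorem Runs.fillInv {j A : Arr} (hj : j ≠ A) {σ : Perm (Fin n)} (hσ : IsArr (s.a j) σ)
    (hn : s.v .n = n) (hB : 16 * (n : ℤ) + 32 ≤ B)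
    (hQ : ∀ s', Frame [.x] [A] s s' → IsArr (s'.a A) (σ⁻¹ : Perm (Fin n)) → Q s') :
    Runs B (.forL .x (.var .n) (.put A (.get j Prog.X) Prog.X)) s (n * 21 + 8) Q := by
  refine Runs.fill (fun k : Fin n => (σ k : ℕ)) (fun k => (k : ℕ)) hn (by omega)
    (fun k l h => by rw [σ.injective (Fin.ext h)]) (fun k f => ?_)
    (fun k f => ⟨trivial, by simp [Expr.eval]⟩) fun s' h1 h2 _ => hQ s' h1 fun k => ?_
  · have h := hσ k
    have := k.2
    have := (σ k).2
    refine ⟨?_, ?_, by omega⟩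
    · simp [Expr.Ok, Expr.eval]
      omega
    · simp [Expr.eval, hj, h]
  · have := h2 (σ⁻¹ k)
    rwa [show σ (σ⁻¹ k) = k from σ.apply_symm_apply k] at this

theorem mul_add_lt_mul_self {a b : ℕ} (ha : a < n) (hb : b < n) : a * n + b < n * n := by
  have := Nat.mul_le_mul_right n (Nat.succ_le_of_lt ha)
  rw [Nat.succ_mul] at this
  omega

theorem mul_add_inj {a b a' b' : ℕ} (hb : b < n) (hb' : b' < n) :
    a * n + b = a' * n + b' ↔ a = a' ∧ b = b' := by
  constructor
  · intro h
    have key : ∀ a b : ℕ, b < n → (a * n + b) / n = a := fun a b hb => by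
      rw [mul_comm, Nat.mul_add_div (by omega), Nat.div_eq_of_lt hb, add_zero]
    have h1 := key a b hb
    rw [h, key a' b' hb'] at h1
    subst h1
    exact ⟨rfl, by omega⟩
  · rintro ⟨rfl, rfl⟩
    rfl

/-- Every ingredient is a bounded number of passes over n entries: the complement U⁻¹c, the labels
of it and of S, their meet M, and then the new entry UM and the new carry M⁻¹S. The table must be
zero before and is zero again afterwards, which lets all calls share it. -/
theorem runs_slide (hn1 : 1 ≤ n) {U S : Perm (Fin n)} (hU : NC U) (hS : NC S) {b : ℕ}
    (hn : s.v .n = n) (ht : s.v .t = b) (hB1 : 16 * ((n * n : ℕ) : ℤ) + 64 ≤ B)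
    (hB2 : 16 * ((b + n : ℕ) : ℤ) + 64 ≤ B) (hu : IsArr (s.a .u) U)
    (hs : ∀ l : Fin n, s.a .seq (b + l) = (S l : ℕ)) (htbl : ∀ r, s.a .tbl r = 0)
    (hQ : ∀ s', Frame [.x, .q] [.seq, .u, .ui, .d, .la, .lb, .m, .mi, .tbl, .row] s s' →
      IsArr (s'.a .u) (((germ n).slide U S)⁻¹ * S : Perm (Fin n)) →
      (∀ l : Fin n, s'.a .seq (b + l) = ((U * (germ n).slide U S) l : ℕ)) →
      (∀ r, (∀ l : Fin n, b + l ≠ r) → s'.a .seq r = s.a .seq r) →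
      (∀ r, s'.a .tbl r = 0) → Q s') :
    Runs B Prog.slide s (n * 1000 + 200) Q := by
  have hB : 16 * (n : ℤ) + 64 ≤ B := by
    have := Nat.le_mul_self n
    omega
  apply Runs.mono
  case hQ => exact fun _ h => h
  · apply Runs.block_cons
    apply Runs.fillInv (by decide) hu hn (by omega)
    intro s1 f1 ui1
    have n1 : s1.v .n = n := by simp [f1.v, hn]
    apply Runs.block_cons
    apply Runs.fillX (n := n) (fun k => s1.a .ui (k + 1)) n1 (by omega)
    · intro k f
      have := k.2
      simp [Expr.Ok, Expr.eval]
      omega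
    intro s2 f2 d2
    have n2 : s2.v .n = n := by simp [f2.v, n1]
    apply Runs.block_cons
    apply Runs.straight
    · simp [Cmd.Ok, Expr.Ok, Expr.eval, n2]
      omega
    have n3 : (s2.v .n - 1).toNat = n - 1 := by omega
    simp only [Cmd.exec, Expr.eval, n3]
    set s3 := s2.setA .d (n - 1) (s2.a .ui (0 : ℤ).toNat) with hs3
    have f3 : Frame [.x] [.d] s1 s3 := f2.setA (by simp) _ _
    -- (U⁻¹c)(x) = U⁻¹(x + 1), with wrap-around at n - 1: the inverse array shifted by one place.
    have d3 : IsArr (s3.a .d) (U⁻¹ * finRotate n : Perm (Fin n)) := by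
      intro k
      have hk := k.2
      have hr := finRotate_val k
      rw [hs3, St.setA_a, if_pos rfl, Function.update_apply, Perm.mul_apply]
      split_ifs with h
      · rw [if_neg (by omega)] at hr
        rw [show finRotate n k = ⟨0, hn1⟩ from Fin.ext hr, f2.a _ (by simp)]
        exact ui1 ⟨0, hn1⟩
      · rw [if_pos (by omega)] at hr
        rw [show finRotate n k = ⟨k + 1, by omega⟩ from Fin.ext hr, d2]
        exact ui1 ⟨k + 1, by omega⟩
    apply Runs.block_cons
    apply runs_label (n := n) (by decide) (by simp [f3.v, n1]) (by omega) d3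
    intro s4 f4 la4
    have n4 : s4.v .n = n := by simp [f4.v, f3.v, n1]
    have t4 : s4.v .t = b := by simp [f4.v, f3.v, f1.v, ht]
    apply Runs.block_cons
    apply Runs.fillX (n := n) (fun k => (S k : ℕ)) n4 (by omega)
    · intro k f
      have := k.2
      simp [Expr.Ok, Expr.eval, t4]
      have e1 : ((b : ℤ) + (k : ℕ)).toNat = b + k := by omega
      rw [e1, f4.a _ (by simp), f3.a _ (by simp), f1.a _ (by simp), hs]
      exact ⟨by omega, rfl⟩
    intro s5 f5 row5
    have n5 : s5.v .n = n := by simp [f5.v, n4]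
    apply Runs.block_cons
    apply runs_label (n := n) (by decide) n5 (by omega) (σ := S) row5
    intro s6 f6 lb6
    have n6 : s6.v .n = n := by simp [f6.v, n5]
    have la6 : IsArr (s6.a .la) (lab (U⁻¹ * finRotate n : Perm (Fin n))) := by
      simpa [f6.a, f5.a] using la4
    apply Runs.block_cons
    apply Runs.fillX (n := n) (fun k => ((lab (U⁻¹ * finRotate n) k * n + lab S k : ℕ) : ℤ)) n6
      (by omega)
    · intro k f
      have h1 := (lab (U⁻¹ * finRotate n) k).2
      have h2 := (lab S k).2
      have := k.2
      have h3 := la6 k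
      have h4 := lb6 k
      simp [Expr.Ok, Expr.eval, h3, h4, n6]
      have h5 := mul_add_lt_mul_self h1 h2
      zify at h5 hB1
      have h6 : (0 : ℤ) ≤ (lab (U⁻¹ * finRotate n) k : ℕ) * n := by positivity
      omega
    intro s7 f7 ui7
    have n7 : s7.v .n = n := by simp [f7.v, n6]
    have hUc : NC (U⁻¹ * finRotate n) := GarsideGerm.Simple.inv_mul_c (𝒢 := germ n) hU
    -- The pair of labels, written as a two-digit number in base n, identifies the class in the
    -- intersection of the partitions.
    have hkey : ∀ k l : Fin n, lab (U⁻¹ * finRotate n) k * n + lab S k =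
        lab (U⁻¹ * finRotate n) l * n + lab S l ↔ BothCycle (U⁻¹ * finRotate n) S k l := by
      intro k l
      rw [mul_add_inj (lab S k).2 (lab S l).2, Fin.val_inj, Fin.val_inj,
        lab_eq_iff hUc, lab_eq_iff hS]
      rfl
    have hkB : ∀ k : Fin n,
        16 * ((lab (U⁻¹ * finRotate n) k * n + lab S k : ℕ) : ℤ) + 16 ≤ B := by
      intro k
      have := mul_add_lt_mul_self (lab (U⁻¹ * finRotate n) k).2 (lab S k).2
      omega
    apply Runs.block_cons
    apply runs_meet (n := n) (equivalence_bothCycle (U⁻¹ * finRotate n) S)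
      (fun k => (lab (U⁻¹ * finRotate n) k : ℕ) * n + lab S k) hkey hkB n7 (by omega) ui7
    · intro r
      simp [f7.a, f6.a, f5.a, f4.a, f3.a, f1.a, htbl]
    intro s8 f8 m8 tbl8
    have n8 : s8.v .n = n := by simp [f8.v, n7]
    have ui8 : s8.a .ui = s7.a .ui := by simp [f8.a]
    apply Runs.block_cons
    -- Only the keys that occur are reset, at a cost of O(n) instead of n².
    apply Runs.fill (n := n) (fun k => lab (U⁻¹ * finRotate n) k * n + lab S k) (fun _ => 0) n8
      (by omega) (fun _ _ _ => rfl)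
    · intro k f
      have h1 := ui7 k
      have h2 := hkB k
      have := k.2
      refine ⟨?_, ?_, h2⟩
      · simp [Expr.Ok, Expr.eval]
        omega
      · simp only [Expr.eval, St.setArr_a, St.setV_a, St.setArr_v, St.setV_v, if_true,
          Int.toNat_natCast, reduceCtorEq, if_false, ui8, h1]
    · intro k f
      simp [Expr.Ok, Expr.eval]
      omega
    intro s9 f9 t9 t9'
    have n9 : s9.v .n = n := by simp [f9.v, n8]
    have m9 : IsArr (s9.a .m) ((germ n).slide U S) := by
      rw [f9.a _ (by simp)]
      exact m8
    have tbl9 : ∀ r, s9.a .tbl r = 0 := by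
      intro r
      by_cases h : ∀ k : Fin n, lab (U⁻¹ * finRotate n) k * n + lab S k ≠ r
      · rw [t9' r h, tbl8 r h]
      · push Not at h
        obtain ⟨k, rfl⟩ := h
        exact t9 k
    set M := (germ n).slide U S
    apply Runs.block_cons
    apply Runs.fillInv (by decide) m9 n9 (by omega)
    intro s10 f10 mi10
    have n10 : s10.v .n = n := by simp [f10.v, n9]
    have t10 : s10.v .t = b := by simp [f10.v, f9.v, f8.v, f7.v, f6.v, f5.v, t4]
    have m10 : IsArr (s10.a .m) M := by simpa [f10.a] using m9
    have u10 : IsArr (s10.a .u) U := by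
      simpa [f10.a, f9.a, f8.a, f7.a, f6.a, f5.a, f4.a, f3.a, f1.a] using hu
    apply Runs.block_cons
    apply Runs.fill (n := n) (fun k => b + k) (fun k => ((U * M) k : ℕ)) n10 (by omega)
      (fun k l h => by rw [Fin.ext (Nat.add_left_cancel h)])
    · intro k f
      have := k.2
      simp [Expr.Ok, Expr.eval, t10]
      omega
    · intro k f
      have h1 := m10 k
      have h2 := u10 (M k)
      have := k.2
      have := (M k).2
      simp [Expr.Ok, Expr.eval, h1, h2]
      omega
    intro s11 f11 seq11 seq11'
    have n11 : s11.v .n = n := by simp [f11.v, n10]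
    have mi11 : IsArr (s11.a .mi) (M⁻¹ : Perm (Fin n)) := by simpa [f11.a] using mi10
    have row11 : IsArr (s11.a .row) S := by
      intro k
      simpa [f11.a, f10.a, f9.a, f8.a, f7.a, f6.a] using row5 k
    apply Runs.block_one
    apply Runs.fillX (n := n) (fun k => ((M⁻¹ * S : Perm (Fin n)) k : ℕ)) n11 (by omega)
    · intro k f
      have h1 := row11 k
      have h2 := mi11 (S k)
      have := k.2
      have := (S k).2
      simp [Expr.Ok, Expr.eval, h1, h2]
      omega
    intro s12 f12 u12
    refine hQ s12 ?_ u12 ?_ ?_ ?_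
    · have g (V A s s') (h : Frame V A s s') (hV : V ⊆ [.x, .q]) (hA : A ⊆ [.seq, .u, .ui, .d, .la,
        .lb, .m, .mi, .tbl, .row]) := h.mono hV hA
      exact (g _ _ _ _ f1 (by simp) (by simp)).trans <| (g _ _ _ _ f3 (by simp) (by simp)).trans <|
        (g _ _ _ _ f4 (by simp) (by simp)).trans <| (g _ _ _ _ f5 (by simp) (by simp)).trans <|
        (g _ _ _ _ f6 (by simp) (by simp)).trans <| (g _ _ _ _ f7 (by simp) (by simp)).trans <|
        (g _ _ _ _ f8 (by simp) (by simp)).trans <| (g _ _ _ _ f9 (by simp) (by simp)).trans <|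
        (g _ _ _ _ f10 (by simp) (by simp)).trans <| (g _ _ _ _ f11 (by simp) (by simp)).trans <|
        g _ _ _ _ f12 (by simp) (by simp)
    · intro l
      simpa [f12.a] using seq11 l
    · intro r hr
      simp [f12.a, seq11' r hr, f10.a, f9.a, f8.a, f7.a, f6.a, f5.a, f4.a, f3.a, f1.a]
    · intro r
      simpa [f12.a, f11.a, f10.a] using tbl9 r
  · simp [Expr.size, Cmd.cost]
    omega

end RAM

/-! ### Rotating a letter past a power of the long cycle -/

namespace AbsoluteOrder

open Equiv

theorem finRotate_pow_val {n : ℕ} (k : ℕ) (x : Fin n) : ((finRotate n ^ k) x : ℕ) = (x + k) % n := by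
  induction k with
  | zero => exact (Nat.mod_eq_of_lt x.2).symm
  | succ k ih =>
    rw [pow_succ', Perm.mul_apply, finRotate_val, ih, ← add_assoc]
    have hn : 0 < n := x.pos
    have h := Nat.mod_lt (x + k) hn
    rw [← Nat.mod_add_mod (x + k) n 1]
    split_ifs with h'
    · exact (Nat.mod_eq_of_lt h').symm
    · rw [show (x + k) % n + 1 = n by omega, Nat.mod_self]

end AbsoluteOrder

namespace RAM

open AbsoluteOrder Equiv

variable {n : ℕ} {B : ℤ} {s : St} {T T' : ℕ} {Q Q' : St → Prop} {c d : Cmd}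

theorem runs_reduce {y : Var} {z : ℕ} (hz : s.v y = z) (hzn : z < 2 * n)
    (hn : s.v .n = n) (hB : 16 * (n : ℤ) + 32 ≤ B)
    (hQ : ∀ s', Frame [y] [] s s' → s'.v y = (z % n : ℕ) → Q s') :
    Runs B (Prog.reduce y) s 20 Q := by
  refine (Runs.straight ?_ ?_).mono (by simp [Prog.reduce, Cmd.cost, Expr.size]) fun _ h => h
  · simp [Prog.reduce, Cmd.Ok, Expr.Ok, Expr.eval, hz, hn]
    omega
  · simp only [Prog.reduce, Cmd.exec, Expr.eval, hz, hn]
    split_ifs with h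
    · apply hQ _ ((Frame.refl _ _ _).setV (by simp) _)
      rw [St.setV_v, if_pos rfl, Nat.mod_eq_sub_mod (by omega), Nat.mod_eq_of_lt (by omega)]
      omega
    · apply hQ _ (Frame.refl _ _ _)
      rw [hz, Nat.mod_eq_of_lt (by omega)]

/-- Conjugation by cᵏ adds k modulo n to both points of the transposition. The residue of k is kept
in `shift`, and each sum is below 2n, so one conditional subtraction reduces it without computing a
power. -/
theorem runs_letter {x y : Fin n} {k : ℕ} {ε : Bool} (hn : s.v .n = n) (ht : s.v .t = n - (x : ℕ))
    (hs : s.v .s = n - (y : ℕ)) (hk : s.v .k = k) (hshift : s.v .shift = (k % n : ℕ))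
    (he : 0 < s.v .e ↔ ε = true) (hB : 16 * (n : ℤ) + 64 ≤ B) (hkB : (k : ℤ) + 1 ≤ B)
    (hQ : ∀ s', Frame [.x, .t, .s, .k, .shift] [.d, .u, .ui] s s' →
      IsArr (s'.a .u) (if ε then finRotate n ^ k * swap x y * (finRotate n ^ k)⁻¹ else
        finRotate n * (finRotate n ^ k * swap x y * (finRotate n ^ k)⁻¹)⁻¹ : Perm (Fin n)) →
      s'.v .k = (if ε then k else k + 1 : ℕ) → s'.v .shift = ((if ε then k else k + 1) % n : ℕ) →
      Q s') :
    Runs B Prog.letter s (n * 200 + 300) Q := by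
  have hn1 : 0 < n := x.pos
  have hkn := Nat.mod_lt k hn1
  have hx := x.2
  have hy := y.2
  obtain ⟨X, hX⟩ : ∃ X, X = (finRotate n ^ k) x := ⟨_, rfl⟩
  obtain ⟨Y, hY⟩ : ∃ Y, Y = (finRotate n ^ k) y := ⟨_, rfl⟩
  have hX' : (X : ℕ) = (x + k % n) % n := by rw [hX, finRotate_pow_val, Nat.add_mod_mod]
  have hY' : (Y : ℕ) = (y + k % n) % n := by rw [hY, finRotate_pow_val, Nat.add_mod_mod]
  have hconj : finRotate n ^ k * swap x y * (finRotate n ^ k)⁻¹ = swap X Y := by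
    rw [Equiv.mul_swap_eq_swap_mul, mul_inv_cancel_right, hX, hY]
  rw [hconj, swap_inv] at hQ
  apply Runs.mono
  case hQ => exact fun _ h => h
  · apply Runs.block_cons
    apply Runs.straight
    · simp [Cmd.Ok, Expr.Ok, Expr.eval, hn, ht, hshift]
      omega
    simp only [Cmd.exec, Expr.eval, hn, ht, hshift]
    set s1 := s.setV .t (n - (n - (x : ℕ)) + (k % n : ℕ)) with hs1
    have f1 : Frame [.t] [] s s1 := (Frame.refl _ _ _).setV (by simp) _
    have t1 : s1.v .t = (x + k % n : ℕ) := by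
      simp [hs1]
    apply Runs.block_cons
    apply runs_reduce (n := n) t1 (by omega) (by simp [f1.v, hn]) (by omega)
    intro s2 f2 t2
    rw [← hX'] at t2
    apply Runs.block_cons
    apply Runs.straight
    · simp [Cmd.Ok, Expr.Ok, Expr.eval, f2.v, f1.v, hn, hs, hshift]
      omega
    have es : s2.v .n - s2.v .s + s2.v .shift = (y + k % n : ℕ) := by
      simp [f2.v, f1.v, hn, hs, hshift]
    simp only [Cmd.exec, Expr.eval, es]
    set s3 := s2.setV .s ((y : ℕ) + k % n : ℕ) with hs3
    have f3 : Frame [.s] [] s2 s3 := (Frame.refl _ _ _).setV (by simp) _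
    apply Runs.block_cons
    apply runs_reduce (n := n) (z := y + k % n) (by simp [hs3]) (by omega)
      (by simp [f3.v, f2.v, f1.v, hn]) (by omega)
    intro s4 f4 v4
    rw [← hY'] at v4
    have n4 : s4.v .n = n := by simp [f4.v, f3.v, f2.v, f1.v, hn]
    have t4 : s4.v .t = (X : ℕ) := by simp [f4.v, f3.v, t2]
    apply Runs.block_cons
    apply Runs.fillX (n := n) (fun k => (k : ℕ)) n4 (by omega)
    · intro k f
      exact ⟨trivial, by simp [Expr.eval]⟩
    intro s5 f5 d5
    have n5 : s5.v .n = n := by simp [f5.v, n4]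
    have t5 : s5.v .t = (X : ℕ) := by simp [f5.v, t4]
    have v5 : s5.v .s = (Y : ℕ) := by simp [f5.v, v4]
    have hXn := X.2
    have hYn := Y.2
    apply Runs.block_cons
    apply Runs.straight
    · simp [Cmd.Ok, Expr.Ok, Expr.eval, t5]
      omega
    apply Runs.block_cons
    apply Runs.straight
    · simp [Cmd.Ok, Cmd.exec, Expr.Ok, Expr.eval, v5]
      omega
    simp only [Cmd.exec, Expr.eval, t5, v5, Int.toNat_natCast, St.setA_v]
    set s7 := (s5.setA .d X (Y : ℕ)).setA .d Y (X : ℕ) with hs7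
    have f7 : Frame [] [.d] s5 s7 :=
      ((Frame.refl _ _ _).setA (by simp) _ _).setA (by simp) _ _
    have d7 : IsArr (s7.a .d) (swap X Y) := by
      intro j
      rw [hs7, St.setA_a, if_pos rfl, St.setA_a, if_pos rfl, Function.update_apply,
        Function.update_apply, d5]
      by_cases h1 : j = Y
      · rw [if_pos (by rw [h1]), h1, swap_apply_right]
      · rw [if_neg fun h => h1 (Fin.ext h)]
        by_cases h2 : j = X
        · rw [if_pos (by rw [h2]), h2, swap_apply_left]
        · rw [if_neg fun h => h2 (Fin.ext h), swap_apply_of_ne_of_ne h2 h1]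
    have F7 : Frame [.x, .t, .s, .k, .shift] [.d, .u, .ui] s s7 :=
      (f1.mono (by simp) (by simp)).trans <| (f2.mono (by simp) (by simp)).trans <|
      (f3.mono (by simp) (by simp)).trans <| (f4.mono (by simp) (by simp)).trans <|
      (f5.mono (by simp) (by simp)).trans <| f7.mono (by simp) (by simp)
    have n7 : s7.v .n = n := by simp [F7.v, hn]
    have k7 : s7.v .k = k := by simp [f7.v, f5.v, f4.v, f3.v, f2.v, f1.v, hk]
    have shift7 : s7.v .shift = (k % n : ℕ) := by
      simp [f7.v, f5.v, f4.v, f3.v, f2.v, f1.v, hshift]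
    have e7 : 0 < Expr.eval s7 (.var .e) ↔ ε = true := by
      rw [← he, Expr.eval, F7.v _ (by simp)]
    apply Runs.block_one
    refine Runs.ite (T := n * 100 + 150) trivial (fun h => ?_) fun h => ?_
    · rw [e7] at h
      simp only [h, if_true] at hQ
      refine Runs.mono (Runs.fillX (n := n) (fun k => (swap X Y k : ℕ)) n7 (by omega)
        (fun k f => ?_) fun s8 f8 u8 => hQ s8 (F7.trans (f8.mono (by simp) (by simp))) u8 ?_ ?_)
        ?_ fun _ h => h
      · have h1 := d7 k
        have := k.2
        simp [Expr.Ok, Expr.eval, h1]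
        omega
      · simp [f8.v, k7]
      · simp [f8.v, shift7]
      · simp [Expr.size]
        omega
    · rw [e7] at h
      simp only [h] at hQ
      apply Runs.mono
      case hQ => exact fun _ h => h
      · apply Runs.block_cons
        apply Runs.fillX (n := n) (fun k => (k : ℕ) + 1) n7 (by omega)
        · intro k f
          have := k.2
          simp [Expr.Ok, Expr.eval]
          omega
        intro s8 f8 ui8
        have n8 : s8.v .n = n := by simp [f8.v, n7]
        apply Runs.block_cons
        apply Runs.straight
        · simp [Cmd.Ok, Expr.Ok, Expr.eval, n8]
          omega
        have e8 : (s8.v .n - 1).toNat = n - 1 := by omega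
        simp only [Cmd.exec, Expr.eval, e8]
        set s9 := s8.setA .ui (n - 1) 0 with hs9
        have f9 : Frame [.x] [.ui] s7 s9 := f8.setA (by simp) _ _
        have ui9 : IsArr (s9.a .ui) (finRotate n) := by
          intro j
          have hj := j.2
          rw [hs9, St.setA_a, if_pos rfl, Function.update_apply, finRotate_val, ui8]
          split_ifs <;> omega
        have d9 : IsArr (s9.a .d) (swap X Y) := by
          rw [f9.a _ (by simp)]
          exact d7
        apply Runs.block_cons
        apply Runs.fillX (n := n) (fun k => ((finRotate n * swap X Y) k : ℕ)) (by simp [f9.v, n7])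
          (by omega)
        · intro k f
          have h1 := d9 k
          have h2 := ui9 (swap X Y k)
          have := k.2
          have := (swap X Y k).2
          simp [Expr.Ok, Expr.eval, h1, h2]
          omega
        intro s10 f10 u10
        have F10 : Frame [.x, .t, .s, .k, .shift] [.d, .u, .ui] s s10 :=
          F7.trans <| (f9.mono (by simp) (by simp)).trans <| f10.mono (by simp) (by simp)
        have k10 : s10.v .k = k := by simp [f10.v, f9.v, k7]
        have shift10 : s10.v .shift = (k % n : ℕ) := by simp [f10.v, f9.v, shift7]
        apply Runs.block_cons
        apply Runs.straight
        · simp [Cmd.Ok, Expr.Ok, Expr.eval, k10]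
          omega
        apply Runs.block_cons
        apply Runs.straight
        · simp [Cmd.Ok, Cmd.exec, Expr.Ok, Expr.eval, shift10]
          omega
        simp only [Cmd.exec, Expr.eval, St.setV_v, reduceCtorEq, if_false, k10, shift10]
        set s12 := (s10.setV .k (k + 1)).setV .shift ((k % n : ℕ) + 1) with hs12
        have f12 : Frame [.k, .shift] [] s10 s12 :=
          ((Frame.refl _ _ _).setV (by simp) _).setV (by simp) _
        apply Runs.block_one
        apply runs_reduce (n := n) (z := k % n + 1) (by simp [hs12]) (by omega)
          (by simp [f12.v, F10.v, hn]) (by omega)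
        intro s13 f13 v13
        rw [Nat.mod_add_mod] at v13
        refine hQ s13 (F10.trans <| (f12.mono (by simp) (by simp)).trans <|
          f13.mono (by simp) (by simp)) ?_ ?_ v13
        · intro j
          rw [f13.a _ (by simp), f12.a _ (by simp)]
          exact u10 j
        · simp [f13.v, hs12]
      · simp [Expr.size, Cmd.cost]
        omega
  · simp [Expr.size, Cmd.cost]
    omega

end RAM

/-! ### Multiplying the stored normal sequence by a letter -/

namespace RAM

open AbsoluteOrder Equiv

variable {n : ℕ} {B : ℤ} {s : St} {T T' : ℕ} {Q Q' : St → Prop} {c d : Cmd}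

/-- The machine state represents a fraction: the exponent of the denominator and the normal
sequence of the numerator. -/
structure StateRep (s : St) (st : ℕ × List (Perm (Fin n))) : Prop where
  n_eq : s.v .n = n
  k : s.v .k = st.1
  shift : s.v .shift = (st.1 % n : ℕ)
  len : s.v .len = st.2.length
  seq : ∀ i < st.2.length, ∀ l : Fin n, s.a .seq (i * n + l) = ((germ n).normalSeq st.2 i l : ℕ)
  tbl : ∀ r, s.a .tbl r = 0

/-- The variables and arrays changed by `push`. -/
abbrev PushFrame : St → St → Prop :=
  Frame [.x, .q, .i, .t, .s, .k, .shift, .len] [.seq, .u, .ui, .d, .la, .lb, .m, .mi, .tbl, .row]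

theorem mul_add_ne {i i' l l' : ℕ} (hl : l < n) (hl' : l' < n) (h : i ≠ i') :
    i * n + l ≠ i' * n + l' := fun h' => h ((mul_add_inj hl hl').1 h').1

/-- After j slides the first j rows are those of the new sequence, the others are still the old
ones, and u holds the carried element. The stored sequence grows by one row, so the cost is linear
in (length + 1)·n. -/
theorem runs_push {x y : Fin n} (hxy : x < y) {ε : Bool} {st : ℕ × List (Perm (Fin n))}
    (hst : ∀ u ∈ st.2, NC u) (hrep : StateRep s st) (ht : s.v .t = n - (x : ℕ))
    (hs : s.v .s = n - (y : ℕ)) (he : 0 < s.v .e ↔ ε = true)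
    (hB1 : 16 * ((n * n : ℕ) : ℤ) + 64 ≤ B)
    (hB2 : 16 * (((st.2.length + 1) * n : ℕ) : ℤ) + 64 ≤ B) (hk : st.1 ≤ st.2.length)
    (hQ : ∀ s', PushFrame s s' → StateRep s' (pushSimple (swap x y) ε st) → Q s') :
    Runs B Prog.push s (2000 * ((st.2.length + 1) * n)) Q := by
  have hn1 : 1 ≤ n := x.pos
  have hB : 16 * (n : ℤ) + 64 ≤ B := by
    have := Nat.le_mul_self n
    omega
  obtain ⟨k, w⟩ := st
  dsimp only at hst hB2 hk ⊢
  have hlen : w.length + 1 ≤ (w.length + 1) * n := Nat.le_mul_of_pos_right _ hn1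
  obtain ⟨U, hU⟩ : ∃ U, U = (if ε then finRotate n ^ k * swap x y * (finRotate n ^ k)⁻¹ else
        finRotate n * (finRotate n ^ k * swap x y * (finRotate n ^ k)⁻¹)⁻¹ : Perm (Fin n)) :=
    ⟨_, rfl⟩
  have hpush : pushSimple (swap x y) ε (k, w) = (if ε then k else k + 1, U :: w) := by
    cases ε <;> simp [pushSimple, hU]
  have hNC := nc_pushSimple (nc_swap hxy) ε (st := (k, w)) hst
  rw [hpush] at hQ hNC
  have hUNC : NC U := hNC U (by simp)
  have hwNC : ∀ i, NC ((germ n).normalSeq w i) :=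
    GarsideGerm.simple_normalSeq (𝒢 := germ n) hst
  set N := (germ n).normalSeq w with hN
  have hcNC : ∀ i, NC ((germ n).carry U N i) := GarsideGerm.simple_carry (𝒢 := germ n) hUNC hwNC
  have hcons : (germ n).normalSeq (U :: w) = (germ n).star U N := rfl
  apply Runs.mono
  case hQ => exact fun _ h => h
  · apply Runs.block_cons
    apply runs_letter (n := n) hrep.n_eq ht hs hrep.k hrep.shift he hB (by omega)
    intro s1 f1 u1 k1 shift1
    rw [← hU] at u1
    have len1 : s1.v .len = w.length := by rw [f1.v _ (by simp), hrep.len]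
    have n1 : s1.v .n = n := by rw [f1.v _ (by simp), hrep.n_eq]
    apply Runs.block_cons
    -- A slide costs at most 1000n + 200 and the assignment of the row address 5; as n ≥ 1, this is
    -- at most 1205n.
    apply Runs.forL (T := 1205 * n) w.length (fun j s' => Frame [.x, .q, .i, .t] [.seq, .u, .ui, .d, .la, .lb, .m, .mi,
      .tbl, .row] s1 s' ∧ IsArr (s'.a .u) ((germ n).carry U N j) ∧
      (∀ i < w.length, ∀ l : Fin n, s'.a .seq (i * n + l) =
        ((if i < j then (germ n).star U N i else N i) l : ℕ)) ∧ ∀ r, s'.a .tbl r = 0)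
    · refine ⟨(Frame.refl _ _ _).setV (by simp) _, u1, fun i hi l => ?_, fun r => ?_⟩
      · rw [St.setV_a, f1.a _ (by simp), hrep.seq i hi]
        simp [hN]
      · rw [St.setV_a, f1.a _ (by simp), hrep.tbl]
    · rintro j hj s' ⟨f2, -⟩ -
      exact ⟨trivial, by simp [Expr.eval, f2.v, len1]⟩
    · omega
    · rintro j hj s' ⟨f2, h2, h3, h4⟩ hj'
      have n2 : s'.v .n = n := by rw [f2.v _ (by simp), n1]
      have hjn : j * n + n ≤ w.length * n := by
        rw [← Nat.succ_mul]
        exact Nat.mul_le_mul_right n hj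
      have hwn : w.length * n ≤ (w.length + 1) * n := Nat.mul_le_mul_right n (by omega)
      have e2 : s'.v .i * s'.v .n = (j * n : ℕ) := by rw [hj', n2]; push_cast; rfl
      refine Runs.mono (Runs.seq (T' := n * 1000 + 200) (Runs.straight ?_ ?_)) ?_ fun _ h => h
      · simp only [Cmd.Ok, Expr.Ok, Expr.eval, e2]
        simp
        omega
      · simp only [Cmd.exec, Expr.eval, e2]
        apply runs_slide (s := s'.setV .t (j * n : ℕ)) hn1 (hcNC j) (hwNC j) (b := j * n) (by simpa using n2) (by simp) hB1
          (by omega) h2 (fun l => by rw [St.setV_a, h3 j hj]; simp) h4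
        intro s3 f3 u3 seq3 seq3' tbl3
        have f3' : Frame [.x, .q, .i, .t] [.seq, .u, .ui, .d, .la, .lb, .m, .mi, .tbl, .row] s' s3 :=
          ((Frame.refl _ _ s').setV (by simp) _).trans (f3.mono (by simp) (by simp))
        refine ⟨by rw [f3.v _ (by simp)]; simpa using hj', (f2.trans f3').setV (by simp) _, u3,
          fun i hi l => ?_, tbl3⟩
        rw [St.setV_a]
        by_cases hij : i = j
        · subst hij
          rw [seq3, if_pos (Nat.lt_succ_self i)]
          rfl
        · rw [seq3' _ fun l' => mul_add_ne l'.2 l.2 (Ne.symm hij), St.setV_a, h3 i hi]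
          by_cases hlt : i < j
          · rw [if_pos hlt, if_pos (by omega)]
          · rw [if_neg hlt, if_neg (by omega)]
      · simp only [Cmd.cost, Expr.size]
        omega
    rintro s2 ⟨f2, u2, seq2, tbl2⟩ -
    have len2 : s2.v .len = w.length := by rw [f2.v _ (by simp), len1]
    have n2 : s2.v .n = n := by rw [f2.v _ (by simp), n1]
    have e2 : s2.v .len * s2.v .n = (w.length * n : ℕ) := by rw [len2, n2]; push_cast; rfl
    have hsm : (w.length + 1) * n = w.length * n + n := Nat.succ_mul _ _
    apply Runs.block_cons
    apply Runs.straight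
    · simp only [Cmd.Ok, Expr.Ok, Expr.eval, e2]
      simp
      omega
    simp only [Cmd.exec, Expr.eval, e2]
    set s3 := s2.setV .t (w.length * n : ℕ) with hs3
    have f3 : Frame [.t] [] s2 s3 := (Frame.refl _ _ _).setV (by simp) _
    have t3 : s3.v .t = (w.length * n : ℕ) := by simp [hs3]
    have u3 : IsArr (s3.a .u) ((germ n).carry U N w.length) := u2
    apply Runs.block_cons
    apply Runs.fill (n := n) (fun l => w.length * n + l)
      (fun l => ((germ n).carry U N w.length l : ℕ)) (by simp [f3.v, n2]) (by omega)
      (fun k l h => by rw [Fin.ext (Nat.add_left_cancel h)])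
    · intro l f
      have := l.2
      simp only [Expr.Ok, Expr.eval, St.setArr_v, St.setV_v, reduceCtorEq, if_false, if_true, t3]
      exact ⟨⟨trivial, trivial, by omega, by omega⟩, by omega, by omega⟩
    · intro l f
      have h1 := u3 l
      have := l.2
      simp [Expr.Ok, Expr.eval, h1]
      omega
    intro s4 f4 seq4 seq4'
    have len4 : s4.v .len = w.length := by rw [f4.v _ (by simp), f3.v _ (by simp), len2]
    apply Runs.block_one
    apply Runs.straight
    · simp [Cmd.Ok, Expr.Ok, Expr.eval, len4]
      omega
    simp only [Cmd.exec, Expr.eval, len4]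
    have F4 : PushFrame s s4 := (f1.mono (by simp) (by simp)).trans <|
      (f2.mono (by simp) (by simp)).trans <| (f3.mono (by simp) (by simp)).trans <|
      f4.mono (by simp) (by simp)
    refine hQ _ (F4.setV (by simp) _) ⟨?_, ?_, ?_, ?_, ?_, ?_⟩
    · simp [F4.v, hrep.n_eq]
    · simp [f4.v, f3.v, f2.v, k1]
    · simp [f4.v, f3.v, f2.v, shift1]
    · simp
    · intro i hi l
      rw [St.setV_a, hcons]
      dsimp only at hi
      by_cases hiw : i = w.length
      · subst hiw
        -- The old sequence has the entry 1 at this position, so the new last entry is the carried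
        -- element itself.
        rw [seq4, GarsideGerm.star_eq_carry (𝒢 := germ n) hUNC hwNC
          (GarsideGerm.normalSeq_eq_one (𝒢 := germ n) hst le_rfl)]
      · rw [List.length_cons] at hi
        rw [seq4' _ fun l' => mul_add_ne l'.2 l.2 (Ne.symm hiw), f3.a _ (by simp),
          seq2 i (by omega), if_pos (by omega)]
    · intro r
      rw [St.setV_a, f4.a _ (by simp), f3.a _ (by simp), tbl2]
  · simp [Expr.size, Cmd.cost]
    have h1 : w.length * (1205 * n + 1 + 10) = 1205 * (w.length * n) + 11 * w.length := by ring
    have h2 : (w.length + 1) * n = w.length * n + n := Nat.succ_mul _ _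
    omega

end RAM

/-! ### Words as lists of transpositions, and the criterion for triviality -/

namespace BandIndex

variable {n : ℕ} (a : BandIndex n)

/-- The smaller point of the transposition of a band generator. -/
def left : Fin n := ⟨n - a.t, by have := a.lt; have := a.le; omega⟩

/-- The larger point of the transposition of a band generator. -/
def right : Fin n := ⟨n - a.s, by have := a.one_le; have := a.lt; have := a.le; omega⟩

theorem left_lt_right : a.left < a.right := by
  have := a.lt
  have := a.le
  simp only [left, right, Fin.lt_def]
  omega

/-- The transposition of a band generator. -/
def transposition : Equiv.Perm (Fin n) := Equiv.swap a.left a.right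

theorem nc_transposition : AbsoluteOrder.NC a.transposition :=
  AbsoluteOrder.nc_swap a.left_lt_right

end BandIndex

namespace AbsoluteOrder

open Equiv

variable {n : ℕ}

theorem ncBraid_transposition (a : BandIndex n) : ncBraid a.transposition = bandGen a := by
  have := a.lt
  have := a.le
  rw [BandIndex.transposition, ncBraid_swap a.left_lt_right, finBand, bandGen_eq]
  congr 1 <;> simp only [BandIndex.left, BandIndex.right] <;> omega

/-- All factors are noncrossing and the exponent is at most the number of factors. -/
def Good (st : ℕ × List (Perm (Fin n))) : Prop := (∀ u ∈ st.2, NC u) ∧ st.1 ≤ st.2.length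

/-- The state after multiplication by the letters of a word from right to left. -/
def pushWord (V : BandWord n) (st : ℕ × List (Perm (Fin n))) : ℕ × List (Perm (Fin n)) :=
  V.foldr (fun x st => pushSimple (BandIndex.transposition x.1) x.2 st) st

/-- The state after multiplication by the inverses of the letters of a word from left to right. -/
def pushInv (W : BandWord n) (st : ℕ × List (Perm (Fin n))) : ℕ × List (Perm (Fin n)) :=
  W.foldl (fun st x => pushSimple (BandIndex.transposition x.1) (!x.2) st) st

theorem Good.pushSimple {st : ℕ × List (Perm (Fin n))} (h : Good st) (a : BandIndex n) (ε : Bool) :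
    Good (pushSimple (BandIndex.transposition a) ε st) :=
  ⟨nc_pushSimple (BandIndex.nc_transposition a) ε h.1, fst_pushSimple_le h.2⟩

theorem Good.pushWord {st : ℕ × List (Perm (Fin n))} (h : Good st) (V : BandWord n) :
    Good (pushWord V st) := by
  induction V with
  | nil => exact h
  | cons x V ih => exact ih.pushSimple x.1 x.2

theorem Good.pushInv {st : ℕ × List (Perm (Fin n))} (h : Good st) (W : BandWord n) :
    Good (pushInv W st) := by
  induction W generalizing st with
  | nil => exact h
  | cons x W ih => exact ih (h.pushSimple x.1 _)

theorem length_pushWord (V : BandWord n) (st : ℕ × List (Perm (Fin n))) :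
    (pushWord V st).2.length = st.2.length + V.length := by
  induction V with
  | nil => rfl
  | cons x V ih =>
    change (AbsoluteOrder.pushSimple _ _ (pushWord V st)).2.length = _
    rw [length_pushSimple, ih, List.length_cons]
    omega

theorem length_pushInv (W : BandWord n) (st : ℕ × List (Perm (Fin n))) :
    (pushInv W st).2.length = st.2.length + W.length := by
  induction W generalizing st with
  | nil => rfl
  | cons x W ih =>
    change (pushInv W (AbsoluteOrder.pushSimple _ _ st)).2.length = _
    rw [ih, length_pushSimple, List.length_cons]
    omega

theorem stateBraid_pushWord (V : BandWord n) (st : ℕ × List (Perm (Fin n))) :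
    stateBraid (pushWord V st) = V.braid * stateBraid st := by
  induction V with
  | nil => simp [pushWord, BandWord.braid]
  | cons x V ih =>
    change stateBraid (AbsoluteOrder.pushSimple _ _ (pushWord V st)) = _
    rw [stateBraid_pushSimple (BandIndex.nc_transposition _), ih, ncBraid_transposition,
      BandWord.braid, BandWord.braid, List.map_cons, List.prod_cons, mul_assoc]

/-- The inverse of a word lists the inverse letters in reverse order. Multiplying on the left in the
original order therefore builds W⁻¹, and the second word can be processed while it is read. -/
theorem stateBraid_pushInv (W : BandWord n) (st : ℕ × List (Perm (Fin n))) :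
    stateBraid (pushInv W st) = W.braid⁻¹ * stateBraid st := by
  induction W generalizing st with
  | nil => simp [pushInv, BandWord.braid]
  | cons x W ih =>
    change stateBraid (pushInv W (AbsoluteOrder.pushSimple _ _ st)) = _
    rw [ih, stateBraid_pushSimple (BandIndex.nc_transposition _), ncBraid_transposition,
      BandWord.braid, BandWord.braid, List.map_cons, List.prod_cons, mul_inv_rev, mul_assoc]
    congr 2
    cases x.2 <;> simp

theorem pushInv_concat (W : BandWord n) (x : BandIndex n × Bool) (st : ℕ × List (Perm (Fin n))) :
    pushInv (W ++ [x]) st = pushSimple (BandIndex.transposition x.1) (!x.2) (pushInv W st) := by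
  simp [pushInv]

/-- The state of the empty word. -/
def emptyState : ℕ × List (Perm (Fin n)) := (0, [])

theorem good_emptyState : Good (emptyState (n := n)) := ⟨by simp [emptyState], le_rfl⟩

theorem stateBraid_emptyState : stateBraid (emptyState (n := n)) = 1 := by
  simp [stateBraid, emptyState]

-- Only finitely many entries need checking: beyond the length of the list the normal sequence is 1,
-- and so is the target, because the exponent does not exceed the length.
open Classical in
theorem stateBraid_eq_one_iff {st : ℕ × List (Perm (Fin n))} (h : Good st) :
    stateBraid st = 1 ↔ ∀ i < st.2.length, (germ n).normalSeq st.2 i =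
      if i < st.1 then finRotate n else 1 := by
  rw [stateBraid, inv_mul_eq_one, eq_comm, prod_ncBraid_eq_pow_iff h.1 h.2]
  refine ⟨fun h' i _ => h' i, fun h' i => ?_⟩
  by_cases hi : i < st.2.length
  · exact h' i hi
  · rw [if_neg (by have := h.2; omega)]
    exact GarsideGerm.normalSeq_eq_one (𝒢 := germ n) h.1 (by omega)

end AbsoluteOrder

/-! ### Reading and processing the two words -/

namespace RAM

open AbsoluteOrder Equiv

variable {n : ℕ} {B : ℤ} {s : St} {T T' : ℕ} {Q Q' : St → Prop} {c d : Cmd}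

theorem StateRep.congr {st : ℕ × List (Perm (Fin n))} {s' : St} (h : StateRep s st)
    (hn : s'.v .n = s.v .n) (hk : s'.v .k = s.v .k) (hshift : s'.v .shift = s.v .shift)
    (hlen : s'.v .len = s.v .len) (hseq : s'.a .seq = s.a .seq) (htbl : s'.a .tbl = s.a .tbl) :
    StateRep s' st where
  n_eq := hn.trans h.n_eq
  k := hk.trans h.k
  shift := hshift.trans h.shift
  len := hlen.trans h.len
  seq i hi l := by rw [hseq, h.seq i hi l]
  tbl r := by rw [htbl, h.tbl]

theorem runs_readLetter {x : BandIndex n × Bool} {l : List ℤ} (h : s.inp = encodeLetter x ++ l)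
    (hB : 16 * (n : ℤ) + 64 ≤ B)
    (hQ : ∀ s', (∀ y, y ∉ [Var.t, .s, .e] → s'.v y = s.v y) → s'.a = s.a → s'.inp = l →
      s'.out = s.out → s'.v .t = (x.1.t : ℤ) → s'.v .s = (x.1.s : ℤ) → s'.v .e = (if x.2 then 1 else -1) →
      Q s') :
    Runs B Prog.readLetter s 3 Q := by
  have h1 := x.1.le
  have h2 := x.1.lt
  apply Runs.mono
  case hQ => exact fun _ h => h
  · apply Runs.block_cons
    apply Runs.read h (by omega) (by omega)
    apply Runs.block_cons
    apply Runs.read rfl (by omega) (by omega)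
    apply Runs.block_one
    apply Runs.read rfl (by split_ifs <;> omega) (by split_ifs <;> omega)
    apply hQ
    · intro y hy
      simp only [List.mem_cons, List.not_mem_nil, or_false, not_or] at hy
      simp [hy]
    all_goals simp
  · norm_num

theorem runs_readFirst {V : BandWord n} {l : List ℤ} {st : ℕ × List (Perm (Fin n))}
    (hrep : StateRep s st) (hcnt : s.v .cnt = V.length)
    (hinp : s.inp = V.flatMap encodeLetter ++ l) (hB : 16 * (n : ℤ) + 64 ≤ B)
    (hB' : 16 * (3 * (V.length : ℤ)) + 64 ≤ B)
    (hQ : ∀ s', StateRep s' st → s'.v .cnt = V.length → s'.inp = l → s'.out = s.out →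
      (∀ i (h : i < V.length), s'.a .letters (i * 3) = V[i].1.t ∧
        s'.a .letters (i * 3 + 1) = V[i].1.s ∧
        s'.a .letters (i * 3 + 2) = if V[i].2 then 1 else -1) → Q s') :
    Runs B Prog.readFirst s (V.length * 100 + 10) Q := by
  apply Runs.mono
  case hQ => exact fun _ h => h
  · apply Runs.forL (T := 50) V.length (fun j s' => StateRep s' st ∧ s'.v .cnt = V.length ∧
      s'.inp = (V.drop j).flatMap encodeLetter ++ l ∧ s'.out = s.out ∧
      (∀ i (h : i < V.length), i < j → s'.a .letters (i * 3) = V[i].1.t ∧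
        s'.a .letters (i * 3 + 1) = V[i].1.s ∧
        s'.a .letters (i * 3 + 2) = if V[i].2 then 1 else -1))
    · refine ⟨hrep.congr (by simp) (by simp) (by simp) (by simp) rfl rfl, by simpa using hcnt,
        by simpa using hinp, rfl, by simp⟩
    · rintro j hj s' ⟨-, h, -⟩ -
      exact ⟨trivial, by simp [Expr.eval, h]⟩
    · omega
    · rintro j hj s' ⟨h1, h2, h3, h4, h5⟩ hj'
      rw [List.drop_eq_getElem_cons hj, List.flatMap_cons, List.append_assoc] at h3
      apply Runs.mono
      case hQ => exact fun _ h => h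
      · apply Runs.block_cons
        apply runs_readLetter h3 hB
        intro s1 v1 a1 inp1 out1 t1 ss1 e1
        apply Runs.straight
        · have hj1 : s1.v .j = j := by rw [v1 _ (by simp), hj']
          simp [Cmd.Ok, Cmd.block, Cmd.exec, Expr.Ok, Expr.eval, hj1]
          omega
        · have hj1 : s1.v .j = j := by rw [v1 _ (by simp), hj']
          have e2 : ((j : ℤ) * 3).toNat = j * 3 := by omega
          have e3 : ((j : ℤ) * 3 + 1).toNat = j * 3 + 1 := by omega
          have e4 : ((j : ℤ) * 3 + 2).toNat = j * 3 + 2 := by omega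
          simp only [Cmd.block, Cmd.exec, Expr.eval, St.setV_v, St.setA_v, reduceCtorEq, if_false,
            if_true, hj1, e2, e3, e4, t1, ss1, e1]
          refine ⟨by simp, h1.congr ?_ ?_ ?_ ?_ ?_ ?_, ?_, inp1, out1.trans h4, ?_⟩
          any_goals simp [v1, a1, h2]
          intro i hi hij
          by_cases hij' : i = j
          · subst hij'
            simp
          · obtain ⟨h6, h7, h8⟩ := h5 i hi (by omega)
            simp only [Function.update_apply]
            rw [if_neg (by omega), if_neg (by omega), if_neg (by omega), if_neg (by omega),
              if_neg (by omega), if_neg (by omega), if_neg (by omega), if_neg (by omega),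
              if_neg (by omega), h6, h7, h8]
            simp
      · simp [Cmd.cost, Cmd.block, Expr.size]
    · rintro s' ⟨h1, h2, h3, h4, h5⟩ -
      exact hQ s' h1 h2 (by simpa using h3) h4 fun i hi => h5 i hi hi
  · simp [Expr.size]
    omega

theorem runs_pushTransposition {a : BandIndex n} {ε : Bool} {st : ℕ × List (Perm (Fin n))}
    (hst : Good st) (hrep : StateRep s st) (ht : s.v .t = a.t) (hs : s.v .s = a.s)
    (he : 0 < s.v .e ↔ ε = true) (hB1 : 16 * ((n * n : ℕ) : ℤ) + 64 ≤ B) {L : ℕ}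
    (hL : st.2.length + 1 ≤ L) (hB2 : 16 * ((L * n : ℕ) : ℤ) + 64 ≤ B)
    (hQ : ∀ s', PushFrame s s' → StateRep s' (pushSimple (BandIndex.transposition a) ε st) → Q s') :
    Runs B Prog.push s (2000 * (L * n)) Q := by
  have h1 := Nat.mul_le_mul_right n hL
  have h2 := a.lt
  have h3 := a.le
  refine (runs_push (BandIndex.left_lt_right a) hst.1 hrep ?_ ?_ he hB1 (by omega) hst.2 hQ).mono
    (by omega) fun _ h => h
  · rw [ht, BandIndex.left]
    simp only
    omega
  · rw [hs, BandIndex.right]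
    simp only
    omega

/-- Letters are multiplied on the left, so the first word has to be taken from its end; this is why
it is stored before it is processed. After j rounds the last j letters are in the state. -/
theorem runs_pushFirst {V : BandWord n} {st : ℕ × List (Perm (Fin n))}
    (hst : Good st) (hrep : StateRep s st) (hcnt : s.v .cnt = V.length)
    (hletters : ∀ i (h : i < V.length), s.a .letters (i * 3) = V[i].1.t ∧
        s.a .letters (i * 3 + 1) = V[i].1.s ∧
        s.a .letters (i * 3 + 2) = if V[i].2 then 1 else -1)
    (hB1 : 16 * ((n * n : ℕ) : ℤ) + 64 ≤ B) {L : ℕ} (hL : st.2.length + V.length ≤ L)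
    (hB2 : 16 * ((L * n : ℕ) : ℤ) + 64 ≤ B) (hB' : 16 * (3 * (V.length : ℤ)) + 64 ≤ B)
    (hQ : ∀ s', s'.inp = s.inp → s'.out = s.out → StateRep s' (pushWord V st) → Q s') :
    Runs B Prog.pushFirst s (V.length * (2000 * (L * n) + 100) + 10) Q := by
  apply Runs.mono
  case hQ => exact fun _ h => h
  · apply Runs.forL (T := 2000 * (L * n) + 50) V.length (fun j s' => s'.v .cnt = V.length ∧
      s'.a .letters = s.a .letters ∧ s'.inp = s.inp ∧ s'.out = s.out ∧
      StateRep s' (pushWord (V.drop (V.length - j)) st))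
    · refine ⟨by simpa using hcnt, rfl, rfl, rfl, ?_⟩
      rw [Nat.sub_zero, List.drop_length]
      exact hrep.congr (by simp) (by simp) (by simp) (by simp) rfl rfl
    · rintro j hj s' ⟨h, -⟩ -
      exact ⟨trivial, by simp [Expr.eval, h]⟩
    · omega
    · rintro j hj s' ⟨h1, h2, h3, h4, h5⟩ hj'
      have hi : V.length - 1 - j < V.length := by omega
      obtain ⟨i, hi'⟩ : ∃ i, i = V.length - 1 - j := ⟨_, rfl⟩
      rw [← hi'] at hi
      have hdrop : V.drop (V.length - (j + 1)) = V[i] :: V.drop (V.length - j) := by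
        rw [show V.length - (j + 1) = i by omega, List.drop_eq_getElem_cons hi,
          show i + 1 = V.length - j by omega]
      obtain ⟨l1, l2, l3⟩ := hletters i hi
      rw [← h2] at l1 l2 l3
      have e1 : (V.length : ℤ) - 1 - j = i := by omega
      have e2 : ((i : ℤ) * 3).toNat = i * 3 := by omega
      have e3 : ((i : ℤ) * 3 + 1).toNat = i * 3 + 1 := by omega
      have e4 : ((i : ℤ) * 3 + 2).toNat = i * 3 + 2 := by omega
      apply Runs.mono
      case hQ => exact fun _ h => h
      · apply Runs.block_cons
        apply Runs.straight
        · simp [Cmd.Ok, Expr.Ok, Expr.eval, h1, hj', e1]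
          omega
        apply Runs.block_cons
        apply Runs.straight
        · simp [Cmd.Ok, Cmd.exec, Expr.Ok, Expr.eval, h1, hj', e1]
          omega
        apply Runs.block_cons
        apply Runs.straight
        · simp [Cmd.Ok, Cmd.exec, Expr.Ok, Expr.eval, h1, hj', e1]
          omega
        apply Runs.block_cons
        apply Runs.straight
        · simp [Cmd.Ok, Cmd.exec, Expr.Ok, Expr.eval, h1, hj', e1]
          omega
        simp only [Cmd.exec, Expr.eval, St.setV_v, St.setV_a, reduceCtorEq, if_false,
            if_true, h1, hj', e1, e2, e3, e4, l1, l2, l3]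
        apply Runs.block_one
        apply runs_pushTransposition (a := V[i].1) (ε := V[i].2) (L := L)
          (hst.pushWord (V.drop (V.length - j)))
          (h5.congr (by simp) (by simp) (by simp) (by simp) (by simp) (by simp)) (by simp) (by simp)
          (by cases V[i].2 <;> simp) hB1 (by rw [length_pushWord, List.length_drop]; omega) hB2
        intro s1 f1 r1
        refine ⟨by simp [f1.v, hj'], by simp [f1.v, h1], by simp [f1.a, h2], by simp [f1.inp, h3],
          by simp [f1.out, h4], ?_⟩
        rw [hdrop]
        exact r1.congr (by simp) (by simp) (by simp) (by simp) rfl rfl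
      · simp [Cmd.cost, Expr.size]
        omega
    · rintro s' ⟨h1, h2, h3, h4, h5⟩ -
      rw [Nat.sub_self, List.drop_zero] at h5
      exact hQ s' h3 h4 h5
  · simp [Expr.size]
    rw [show 2000 * (L * n) + 50 + 1 + 10 = 2000 * (L * n) + 61 by omega, mul_add, mul_add]
    omega

theorem runs_pushSecond {W : BandWord n} {l : List ℤ} {st : ℕ × List (Perm (Fin n))}
    (hst : Good st) (hrep : StateRep s st) (hcnt : s.v .cnt = W.length)
    (hinp : s.inp = W.flatMap encodeLetter ++ l) (hn1 : 1 ≤ n)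
    (hB1 : 16 * ((n * n : ℕ) : ℤ) + 64 ≤ B) {L : ℕ} (hL : st.2.length + W.length ≤ L)
    (hB2 : 16 * ((L * n : ℕ) : ℤ) + 64 ≤ B)
    (hQ : ∀ s', s'.out = s.out → StateRep s' (pushInv W st) → Q s') :
    Runs B Prog.pushSecond s (W.length * (2000 * (L * n) + 100) + 10) Q := by
  have hB : 16 * (n : ℤ) + 64 ≤ B := by
    have := Nat.le_mul_self n
    omega
  have hLn : L ≤ L * n := Nat.le_mul_of_pos_right _ hn1
  apply Runs.mono
  case hQ => exact fun _ h => h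
  · apply Runs.forL (T := 2000 * (L * n) + 50) W.length (fun j s' => s'.v .cnt = W.length ∧
      s'.inp = (W.drop j).flatMap encodeLetter ++ l ∧ s'.out = s.out ∧
      StateRep s' (pushInv (W.take j) st))
    · exact ⟨by simpa using hcnt, by simpa using hinp, rfl,
        hrep.congr (by simp) (by simp) (by simp) (by simp) rfl rfl⟩
    · rintro j hj s' ⟨h, -⟩ -
      exact ⟨trivial, by simp [Expr.eval, h]⟩
    · omega
    · rintro j hj s' ⟨h1, h2, h3, h4⟩ hj'
      rw [List.drop_eq_getElem_cons hj, List.flatMap_cons, List.append_assoc] at h2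
      have htake : W.take (j + 1) = W.take j ++ [W[j]] := by simp
      apply Runs.mono
      case hQ => exact fun _ h => h
      · apply Runs.block_cons
        apply runs_readLetter h2 hB
        intro s1 v1 a1 inp1 out1 t1 ss1 e1
        apply Runs.block_cons
        apply Runs.straight
        · simp [Cmd.Ok, Expr.Ok, Expr.eval, e1]
          split_ifs <;> omega
        simp only [Cmd.exec, Expr.eval, e1]
        apply Runs.block_one
        apply runs_pushTransposition (a := W[j].1) (ε := !W[j].2) (L := L)
          (hst.pushInv (W.take j))
          (h4.congr (by simp [v1]) (by simp [v1]) (by simp [v1]) (by simp [v1]) (by simp [a1])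
            (by simp [a1])) (by simpa using t1) (by simpa using ss1)
          (by cases W[j].2 <;> simp) hB1 (by rw [length_pushInv, List.length_take]; omega) hB2
        intro s2 f2 r2
        refine ⟨by simp [f2.v, v1, hj'], by simp [f2.v, v1, h1], by simp [f2.inp, inp1],
          by simp [f2.out, out1, h3], ?_⟩
        rw [htake, pushInv_concat]
        exact r2.congr (by simp) (by simp) (by simp) (by simp) rfl rfl
      · simp [Cmd.cost, Expr.size]
        omega
    · rintro s' ⟨h1, h2, h3, h4⟩ -
      rw [List.take_length] at h4
      exact hQ s' h3 h4
  · simp [Expr.size]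
    rw [show 2000 * (L * n) + 50 + 1 + 10 = 2000 * (L * n) + 61 by omega, mul_add, mul_add]
    omega

end RAM

/-! ### The final comparison and the whole program -/

namespace RAM

open AbsoluteOrder Equiv

variable {n : ℕ} {B : ℤ} {s : St} {T T' : ℕ} {Q Q' : St → Prop} {c d : Cmd}

open Classical in
theorem runs_compare {st : ℕ × List (Perm (Fin n))} (hst : Good st) (hrep : StateRep s st)
    (hn1 : 1 ≤ n) (hB1 : 16 * ((n * n : ℕ) : ℤ) + 64 ≤ B) {L : ℕ} (hL : st.2.length ≤ L)
    (hB2 : 16 * ((L * n : ℕ) : ℤ) + 64 ≤ B)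
    (hQ : ∀ s', s'.out = s.out ++ [if stateBraid st = 1 then 1 else 0] → Q s') :
    Runs B Prog.compare s (200 * ((L + 1) * n)) Q := by
  have hB : 16 * (n : ℤ) + 64 ≤ B := by
    have := Nat.le_mul_self n
    omega
  have hLn : L ≤ L * n := Nat.le_mul_of_pos_right _ hn1
  rw [stateBraid_eq_one_iff hst] at hQ
  set N := (germ n).normalSeq st.2
  set tgt : ℕ → Perm (Fin n) := fun i => if i < st.1 then finRotate n else 1 with htgt
  apply Runs.mono
  case hQ => exact fun _ h => h
  · apply Runs.block_cons
    apply Runs.fillX (n := n) (fun k => (k : ℕ) + 1) hrep.n_eq (by omega)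
    · intro k f
      have := k.2
      simp [Expr.Ok, Expr.eval]
      omega
    intro s1 f1 d1
    have n1 : s1.v .n = n := by rw [f1.v _ (by simp), hrep.n_eq]
    apply Runs.block_cons
    apply Runs.straight
    · simp [Cmd.Ok, Expr.Ok, Expr.eval, n1]
      omega
    have e1 : (s1.v .n - 1).toNat = n - 1 := by omega
    simp only [Cmd.exec, Expr.eval, e1]
    set s2 := s1.setA .d (n - 1) 0 with hs2
    have f2 : Frame [.x] [.d] s s2 := f1.setA (by simp) _ _
    have d2 : IsArr (s2.a .d) (finRotate n) := by
      intro j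
      have hj := j.2
      rw [hs2, St.setA_a, if_pos rfl, Function.update_apply, finRotate_val, d1]
      split_ifs <;> omega
    apply Runs.block_cons
    apply Runs.straight
    · simp [Cmd.Ok, Expr.Ok]
      omega
    simp only [Cmd.exec, Expr.eval]
    set s3 := s2.setV .ans 1 with hs3
    have f3 : Frame [.x, .ans] [.d] s s3 := (f2.mono (by simp) (by simp)).setV (by simp) _
    have d3 : IsArr (s3.a .d) (finRotate n) := d2
    have ans3 : s3.v .ans = 1 := by simp [hs3]
    apply Runs.block_cons
    apply Runs.forL (T := 100 * n) st.2.length (fun i s' => Frame [.x, .t, .q, .ans, .i] [] s3 s' ∧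
      s'.v .ans = if ∀ i' < i, N i' = tgt i' then 1 else 0)
    · exact ⟨(Frame.refl _ _ _).setV (by simp) _, by simp [ans3]⟩
    · rintro i hi s' ⟨h, -⟩ -
      exact ⟨trivial, by simp [Expr.eval, h.v, f3.v, hrep.len]⟩
    · omega
    · rintro i hi s4 ⟨f4, ans4⟩ hi4
      have n4 : s4.v .n = n := by rw [f4.v _ (by simp), f3.v _ (by simp), hrep.n_eq]
      have hin : i * n + n ≤ L * n := by
        rw [← Nat.succ_mul]
        exact Nat.mul_le_mul_right n (by omega)
      have e4 : s4.v .i * s4.v .n = (i * n : ℕ) := by rw [hi4, n4]; push_cast; rfl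
      apply Runs.mono
      case hQ => exact fun _ h => h
      · apply Runs.block_cons
        apply Runs.straight
        · simp only [Cmd.Ok, Expr.Ok, Expr.eval, e4]
          exact ⟨trivial, trivial, by omega, by omega⟩
        simp only [Cmd.exec, Expr.eval, e4]
        set s5 := s4.setV .t (i * n : ℕ) with hs5
        have f5 : Frame [.t] [] s4 s5 := (Frame.refl _ _ _).setV (by simp) _
        apply Runs.block_one
        apply Runs.forL (T := 60) n (fun l s' => Frame [.x, .q, .ans] [] s5 s' ∧
          s'.v .ans = if (∀ i' < i, N i' = tgt i') ∧ ∀ l' : Fin n, (l' : ℕ) < l → N i l' = tgt i l'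
            then 1 else 0)
        · refine ⟨(Frame.refl _ _ _).setV (by simp) _, ?_⟩
          simp [hs5, ans4]
        · rintro l hl s' ⟨h, -⟩ -
          exact ⟨trivial, by simp [Expr.eval, h.v, f5.v, n4]⟩
        · omega
        · rintro l hl s6 ⟨f6, ans6⟩ hl6
          have hNl := (N i ⟨l, hl⟩).2
          have hcl := (finRotate n ⟨l, hl⟩).2
          have t6 : s6.v .t = (i * n : ℕ) := by simp [f6.v, hs5]
          have i6 : s6.v .i = i := by rw [f6.v _ (by simp), f5.v _ (by simp), hi4]
          have k6 : s6.v .k = st.1 := by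
            rw [f6.v _ (by simp), f5.v _ (by simp), f4.v _ (by simp), f3.v _ (by simp), hrep.k]
          have d6 : s6.a .d l = (finRotate n ⟨l, hl⟩ : ℕ) := by
            rw [f6.a _ (by simp), f5.a _ (by simp), f4.a _ (by simp)]
            exact d3 ⟨l, hl⟩
          have seq6 : s6.a .seq (i * n + l) = (N i ⟨l, hl⟩ : ℕ) := by
            rw [f6.a _ (by simp), f5.a _ (by simp), f4.a _ (by simp), f3.a _ (by simp)]
            exact hrep.seq i hi ⟨l, hl⟩
          have e6 : (((i * n : ℕ) : ℤ) + l).toNat = i * n + l := by omega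
          have hkB := hst.2
          apply Runs.mono
          case hQ => exact fun _ h => h
          · apply Runs.block_cons
            apply Runs.straight
            · simp only [Cmd.Ok, Expr.Ok, Expr.eval, t6, hl6]
              exact ⟨⟨trivial, trivial, by omega, by omega⟩, by omega, by omega⟩
            simp only [Cmd.exec, Expr.eval, t6, hl6, e6, seq6]
            set s7 := s6.setV .q (N i ⟨l, hl⟩ : ℕ) with hs7
            have f7 : Frame [.q] [] s6 s7 := (Frame.refl _ _ _).setV (by simp) _
            have q7 : s7.v .q = (N i ⟨l, hl⟩ : ℕ) := by simp [hs7]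
            have x7 : s7.v .x = l := by simp [hs7, hl6]
            have i7 : s7.v .i = i := by simp [hs7, i6]
            have k7 : s7.v .k = st.1 := by simp [hs7, k6]
            have d7 : s7.a .d l = (finRotate n ⟨l, hl⟩ : ℕ) := d6
            apply Runs.block_cons
            apply Runs.straight
            · simp only [Cmd.Ok, Expr.Ok, Expr.eval, q7, x7, i7, k7, d7, Int.toNat_natCast]
              exact ⟨⟨trivial, trivial, by omega, by omega⟩, fun _ => ⟨trivial, ⟨trivial, by omega,
                by omega⟩, by omega, by omega⟩, fun _ => ⟨trivial, trivial, by omega, by omega⟩⟩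
            have e7 : Cmd.exec (.ite (.sub (.var .k) (.var .i)) (.assign .q (.sub (.var .q)
                (.get .d Prog.X))) (.assign .q (.sub (.var .q) Prog.X))) s7 =
                s7.setV .q ((N i ⟨l, hl⟩ : ℕ) - (tgt i ⟨l, hl⟩ : ℕ)) := by
              simp only [Cmd.exec, Expr.eval, q7, x7, i7, k7, Int.toNat_natCast, d7, htgt]
              by_cases hik : i < st.1
              · rw [if_pos (by omega), if_pos hik]
              · rw [if_neg (by omega), if_neg hik]
                rfl
            rw [e7]
            have htl := (tgt i ⟨l, hl⟩).2
            -- The test for z ≠ 0 is 0 < z², since conditionals only test for positive values; z² ≤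
            -- n² keeps the register within its bound.
            obtain ⟨z, hz⟩ : ∃ z : ℤ, z = (N i ⟨l, hl⟩ : ℕ) - (tgt i ⟨l, hl⟩ : ℕ) := ⟨_, rfl⟩
            have hz0 : z = 0 ↔ N i ⟨l, hl⟩ = tgt i ⟨l, hl⟩ := by
              rw [← Fin.val_inj]
              omega
            have hzz : z * z ≤ n * n := by
              rw [← abs_mul_abs_self z]
              have : |z| ≤ n := abs_le.2 ⟨by omega, by omega⟩
              exact mul_le_mul this this (abs_nonneg z) (by omega)
            have hzz0 : 0 ≤ z * z := mul_self_nonneg z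
            push_cast at hB1
            rw [← hz]
            apply Runs.block_one
            apply Runs.straight
            · simp only [Cmd.Ok, Expr.Ok, Expr.eval, St.setV_v, if_true]
              exact ⟨⟨trivial, trivial, by omega, by omega⟩, fun _ => ⟨by omega, by omega⟩,
                fun _ => trivial⟩
            -- The flag is never raised again once cleared, so it records agreement on all entries
            -- compared so far.
            have hQ' : ((∀ i' < i, N i' = tgt i') ∧
                ∀ l' : Fin n, (l' : ℕ) < l + 1 → N i l' = tgt i l') ↔
                ((∀ i' < i, N i' = tgt i') ∧
                ∀ l' : Fin n, (l' : ℕ) < l → N i l' = tgt i l') ∧ z = 0 := by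
              rw [hz0, and_assoc]
              refine and_congr_right fun _ => ⟨fun h => ⟨fun l' hl' => h l' (by omega),
                h ⟨l, hl⟩ (Nat.lt_succ_self l)⟩, fun h l' hl' => ?_⟩
              by_cases hll : (l' : ℕ) = l
              · rw [show l' = ⟨l, hl⟩ from Fin.ext hll]
                exact h.2
              · exact h.1 l' (by omega)
            simp only [Cmd.exec, Expr.eval, St.setV_v, if_true]
            by_cases hpos : 0 < z * z
            · rw [if_pos hpos]
              have hzne : z ≠ 0 := by
                rintro rfl
                exact lt_irrefl _ hpos
              refine ⟨by simp [x7], ((((f6.trans (f7.mono (by simp) (by simp))).setV (by simp)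
                _).setV (by simp) _).setV (by simp) _), ?_⟩
              rw [if_neg fun h => hzne (hQ'.1 h).2]
              simp
            · rw [if_neg hpos]
              have hz' : z = 0 := by
                by_contra h
                exact hpos (lt_of_le_of_ne hzz0 (mul_self_ne_zero.2 h).symm)
              refine ⟨by simp [x7], (((f6.trans (f7.mono (by simp) (by simp))).setV (by simp)
                _).setV (by simp) _), ?_⟩
              simp only [hQ', hz', and_true]
              simp [hs7, ans6]
          · simp [Cmd.cost, Expr.size]
        · rintro s6 ⟨f6, ans6⟩ -
          refine ⟨by rw [f6.v _ (by simp), f5.v _ (by simp), hi4], (f4.trans <|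
            (f5.mono (by simp) (by simp)).trans <| f6.mono (by simp) (by simp)).setV (by simp) _, ?_⟩
          rw [St.setV_v, if_neg (by simp), ans6]
          refine if_congr ⟨fun h i' hi' => ?_, fun h => ⟨fun i' hi' => h i' (by omega), fun l' _ => by
            rw [h i (Nat.lt_succ_self i)]⟩⟩ rfl rfl
          by_cases hii : i' = i
          · subst hii
            exact Equiv.ext fun l' => h.2 l' l'.2
          · exact h.1 i' (by omega)
      · simp [Cmd.cost, Expr.size]
        omega
    rintro s4 ⟨f4, ans4⟩ -
    apply Runs.block_one
    apply Runs.write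
    · exact trivial
    apply hQ
    simp only [Expr.eval, f4.out, f3.out, ans4]
    congr
  · simp [Cmd.cost, Expr.size]
    have h1 : st.2.length * (100 * n + 1 + 10) = 100 * (st.2.length * n) + 11 * st.2.length := by ring
    have h2 : (L + 1) * n = L * n + n := Nat.succ_mul _ _
    have h3 := Nat.mul_le_mul_right n hL
    omega

open Classical in
theorem runs_main (V W : BandWord n) (hn1 : 1 ≤ n) {L : ℕ} (hV : V.length ≤ L) (hW : W.length ≤ L)
    (hB1 : 16 * ((n * n : ℕ) : ℤ) + 64 ≤ B) (hB2 : 48 * (((L + 1) * n : ℕ) : ℤ) + 64 ≤ B)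
    (hQ : ∀ s', s'.out = [wordProblemAnswer V W] → Q s') :
    Runs B Prog.main (St.init (encodeInstance n V W))
      (L * (8000 * (L * n) + 300) + 400 * ((L + 1) * n) + 300 * n + 100) Q := by
  have hB : 16 * (n : ℤ) + 64 ≤ B := by
    have := Nat.le_mul_self n
    omega
  have hLn : L ≤ L * n := Nat.le_mul_of_pos_right _ hn1
  have hsm : (L + 1) * n = L * n + n := Nat.succ_mul _ _
  have h2L : 2 * L * n = 2 * (L * n) := mul_assoc _ _ _
  apply Runs.mono
  case hQ => exact fun _ h => h
  · apply Runs.block_cons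
    apply Runs.read (z := n) (l := encodeWord V ++ encodeWord W) rfl (by omega) (by omega)
    apply Runs.block_cons
    apply Runs.read (z := V.length) (l := V.flatMap encodeLetter ++ encodeWord W) rfl (by omega)
      (by omega)
    apply Runs.block_cons
    -- The zero initial memory is the state of the empty word, with all table cells zero, so there
    -- is nothing to initialise.
    apply runs_readFirst (V := V) (l := encodeWord W) (st := emptyState (n := n))
      ⟨by simp, by simp [St.init, emptyState], by simp [St.init, emptyState],
        by simp [St.init, emptyState], by simp [emptyState], by simp [St.init]⟩ (by simp) rfl hB
      (by omega)
    intro s1 r1 cnt1 inp1 out1 let1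
    apply Runs.block_cons
    -- Both words together contribute at most 2L factors, which bounds the length of the sequence
    -- throughout.
    apply runs_pushFirst (V := V) (L := 2 * L) good_emptyState r1 cnt1 let1 hB1
      (by simp [emptyState]; omega) (by omega) (by omega)
    intro s2 inp2 out2 r2
    apply Runs.block_cons
    apply Runs.read (z := W.length) (l := W.flatMap encodeLetter ++ [])
      (by rw [inp2, inp1, List.append_nil]; rfl) (by omega) (by omega)
    apply Runs.block_cons
    apply runs_pushSecond (W := W) (l := []) (L := 2 * L) (good_emptyState.pushWord V)
      (r2.congr (by simp) (by simp) (by simp) (by simp) (by simp) (by simp)) (by simp) rfl hn1 hB1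
      (by rw [length_pushWord]; simp [emptyState]; omega) (by omega)
    intro s3 out3 r3
    apply Runs.block_one
    apply runs_compare (L := 2 * L) ((good_emptyState.pushWord V).pushInv W) r3 hn1 hB1
      (by rw [length_pushInv, length_pushWord]; simp [emptyState]; omega) (by omega)
    intro s4 out4
    apply hQ
    -- The final state represents W⁻¹V, which is trivial exactly if V = W in B_n.
    have e : ([] : List ℤ) ++ [if stateBraid (pushInv W (pushWord V emptyState)) = 1 then 1 else 0] =
        [wordProblemAnswer V W] := by
      rw [stateBraid_pushInv, stateBraid_pushWord, stateBraid_emptyState, mul_one, inv_mul_eq_one,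
        List.nil_append, wordProblemAnswer]
      simp only [eq_comm]
    rw [out4, out3, ← e]
    congr 1
    simp [out2, out1, St.init]
  · have h1 := Nat.mul_le_mul_right (2000 * (2 * L * n) + 100) hV
    have h2 := Nat.mul_le_mul_right (2000 * (2 * L * n) + 100) hW
    have h3 : (2 * L + 1) * n = 2 * (L * n) + n := by ring
    rw [h2L] at h1 h2
    rw [h2L, h3, hsm]
    have h4 : L * (2000 * (2 * (L * n)) + 100) = 4000 * (L * (L * n)) + 100 * L := by ring
    have h5 : L * (8000 * (L * n) + 300) = 8000 * (L * (L * n)) + 300 * L := by ring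
    omega

end RAM

theorem mainTheorem4 :
    ∃ (P : RAM.Program) (C d : ℕ), ∀ (n : ℕ), 1 ≤ n → ∀ (V W : BandWord n),
      (∃ T : ℕ, T ≤ C * (max 1 (max V.length W.length) ^ 2 * n) ∧
        RAM.HaltsWith P (encodeInstance n V W) [wordProblemAnswer V W] T) ∧
      RAM.RegistersBoundedBy P (encodeInstance n V W)
        ((n + max V.length W.length + 1) ^ d) := by
  -- The time bound of `runs_main` has coefficients with sum 9500 once every term is estimated by
  -- max(1, L)²·n, so C = 10000 suffices. Registers and addresses are quadratic in n + L + 1 ≥ 2,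
  -- and the exponent 10 absorbs the constants.
  refine ⟨RAM.Prog.main.code 0 ++ [.halt], 10000, 10, fun n hn V W => ?_⟩
  obtain ⟨L, hL⟩ : ∃ L, L = max V.length W.length := ⟨_, rfl⟩
  rw [← hL]
  obtain ⟨X, hX⟩ : ∃ X, X = n + L + 1 := ⟨_, rfl⟩
  have hX2 : 2 ≤ X := by omega
  -- X ≥ 2 gives X⁸ ≥ 256, and 256X² exceeds 48X² + 64.
  have hpow : 48 * (X * X) + 64 ≤ X ^ 10 := by
    have h1 : 2 ^ 7 ≤ X ^ 7 := Nat.pow_le_pow_left hX2 7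
    have h2 : X ^ 10 = X ^ 7 * X * (X * X) := by ring
    have h3 : 2 ^ 7 * 2 ≤ X ^ 7 * X := Nat.mul_le_mul h1 hX2
    have h4 : 2 * 2 ≤ X * X := Nat.mul_le_mul hX2 hX2
    have h5 := Nat.mul_le_mul_right (X * X) h3
    omega
  have h1 : n * n ≤ X * X := Nat.mul_le_mul (by omega) (by omega)
  have h2 : (L + 1) * n ≤ X * X := Nat.mul_le_mul (by omega) (by omega)
  obtain ⟨T, s', hT, hbig, hout⟩ := RAM.runs_main (B := (X ^ 10 : ℕ)) V W hn (L := L) (by omega)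
    (by omega) (by omega) (by omega) fun s' h => h
  obtain ⟨h3, h4⟩ := hbig.haltsWith
  rw [hout] at h3
  rw [← hX]
  refine ⟨⟨T, hT.trans ?_, h3⟩, h4⟩
  obtain ⟨M, hM⟩ : ∃ M, M = max 1 L := ⟨_, rfl⟩
  rw [← hM]
  have hM1 : 1 ≤ M := by omega
  have hLM : L ≤ M := by omega
  have m1 : M ≤ M * M := Nat.le_mul_self M
  have m2 : L * (L * n) ≤ M * M * n := by
    rw [← mul_assoc]
    exact Nat.mul_le_mul_right n (Nat.mul_le_mul hLM hLM)
  have m3 : L * n ≤ M * M * n := Nat.mul_le_mul_right n (hLM.trans m1)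
  have m4 : n ≤ M * M * n := Nat.le_mul_of_pos_left n (by positivity)
  have m5 : L ≤ L * n := Nat.le_mul_of_pos_right _ hn
  have e1 : L * (8000 * (L * n) + 300) = 8000 * (L * (L * n)) + 300 * L := by ring
  have e2 : (L + 1) * n = L * n + n := Nat.succ_mul _ _
  rw [sq, e1, e2]
  omega
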